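/- **Theorem 5.1.** Let $c\in(0,\infty)$ and let $p=p(n)$ be such that $p/n\to c$ as $n\to\infty$. For each $n$ let $Z_1=Z_1^{(n)}$, $Z_2=Z_2^{(n)}$ be $p\times n$ complex random matrices, all defined on one probability space, such that for each $n$ all entries of $Z_1^{(n)}$ and $Z_2^{(n)}$ are independent, with zero mean and unit variance ($\mathbb E|z|^2=1$), and such that for some $\eta_0>0$ the absolute moments of order $4+\eta_0$ of all entries are bounded uniformly in the entries and in $n$. Let $$S_n^-=\frac1n\,(Z_1Z_2^*-Z_2Z_1^*)$$ (the case $\Sigma_n=I_p$). This matrix is skew-Hermitian; if its eigenvalues are $\mathrm i\lambda_1,\dots,\mathrm i\lambda_p$, its empirical spectral distribution, viewed on the real line, is $\frac1p\sum_{j=1}^p\delta_{\lambda_j}$. Then almost surely these empirical spectral distributions converge weakly to a nonrandom probability measure on $\mathbb R$ (the LSD); let $\tilde F$ be its distribution function. It has the following properties. Put $$r_1=-\frac{c+1}{3c^3},\quad r_3=-\frac{(c-2)^3}{27c^3},\quad d_0=\frac1{27c^6},\quad d_2=\frac{2c^2+10c-1}{27c^6},\quad d_4=\frac{(1-2/c)^3}{27c^2},$$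 $$R_\pm=\frac{d_2\pm\sqrt{d_2^2-4d_0d_4}}{2d_0},\quad L_c=\sqrt{\max(R_-,0)},\quad U_c=\sqrt{R_+},\quad S_c=(-U_c,-L_c)\cup(L_c,U_c),$$ and for real $x\neq0$ $$r(x)=\lim_{\epsilon\downarrow0}\Big(\frac{r_1}{-\epsilon+\mathrm ix}+\frac{r_3}{(-\epsilon+\mathrm ix)^3}\Big)=\frac{r_1}{\mathrm ix}+\frac{r_3}{(\mathrm ix)^3},\quad d(x)=d_0-\frac{d_2}{x^2}+\frac{d_4}{x^4},\quad V_\pm(x)=|r(x)|\pm\sqrt{-d(x)}\ \ (x\in S_c).$$ 1. $\tilde F$ is differentiable at every $x\ne0$, with derivative $$f_c(x)=\frac{\sqrt3}{2\pi}\Big(V_+(x)^{1/3}-V_-(x)^{1/3}\Big)\ \text{ if } x\in S_c,\qquad f_c(x)=0\ \text{ if } x\notin S_c,$$ and on $\mathbb R\setminus\{0\}$ the LSD is absolutely continuous with density $f_c$. 2. $\tilde F$ is differentiable at $0$ if and only if $0<c<2$, and in that case its derivative there is $f_c(0)=\dfrac1{\pi\sqrt{2c-c^2}}$. 3. The derivative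 of $\tilde F$ is continuous on the set of points where $\tilde F$ is differentiable. -/

import Mathlib

open MeasureTheory ProbabilityTheory Filter Topology Matrix

noncomputable section

namespace CommutatorLSD

/-! ### The random matrices and their spectral distributions -/

/-- The sample commutator matrix `(1/n) (X₁ X₂* - X₂ X₁*)` of two `p × n` matrices. -/
def commutatorMatrix {p n : ℕ} (X₁ X₂ : Matrix (Fin p) (Fin n) ℂ) :
    Matrix (Fin p) (Fin p) ℂ :=
  ((n : ℂ)⁻¹) • (X₁ * X₂ᴴ - X₂ * X₁ᴴ)

theorem commutatorMatrix_conjTranspose {p n : ℕ} (X₁ X₂ : Matrix (Fin p) (Fin n) ℂ) :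
    (commutatorMatrix X₁ X₂)ᴴ = -commutatorMatrix X₁ X₂ := by
  simp [commutatorMatrix, Matrix.conjTranspose_smul, Matrix.conjTranspose_sub,
    Matrix.conjTranspose_mul, ← smul_neg]

/-- If `S` is skew-Hermitian then `-i S` is Hermitian. -/
theorem isHermitian_neg_I_smul {p : ℕ} {S : Matrix (Fin p) (Fin p) ℂ} (hS : Sᴴ = -S) :
    ((-Complex.I) • S).IsHermitian := by
  simp [Matrix.IsHermitian, Matrix.conjTranspose_smul, hS]

/-- The empirical spectral distribution of a skew-Hermitian matrix `S` with eigenvalues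
`i λ₁, …, i λ_p`, read on the real line: the measure `(1/p) ∑ⱼ δ_{λⱼ}`, where the `λⱼ` are the
eigenvalues (with multiplicity) of the Hermitian matrix `-i S`.
It is a probability measure as soon as `p ≠ 0`; for `p = 0` it is the zero measure. -/
def skewESD {p : ℕ} (S : Matrix (Fin p) (Fin p) ℂ) (hS : Sᴴ = -S) : FiniteMeasure ℝ :=
  ⟨∑ j : Fin p, (p : ENNReal)⁻¹ • Measure.dirac ((isHermitian_neg_I_smul hS).eigenvalues j), by
    refine ⟨?_⟩
    simp only [Measure.coe_finsetSum, Finset.sum_apply, Measure.smul_apply, measure_univ,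
      smul_eq_mul, mul_one, Finset.sum_const, Finset.card_univ, Fintype.card_fin, nsmul_eq_mul]
    exact lt_of_le_of_lt (ENNReal.mul_inv_le_one _) ENNReal.one_lt_top⟩

/-- The assumptions on the data matrices `Z₁⁽ⁿ⁾ = Z 0 n`, `Z₂⁽ⁿ⁾ = Z 1 n`, of size `p n × n`:
for each `n` all the entries of the two matrices are independent complex random variables, they
have mean zero and variance one, and their moments of order `4 + η` are bounded, for some `η > 0`,
uniformly in the entries and in `n`. Nothing is assumed on the joint law for different `n`. -/
structure IsDataModel {Ω : Type*} [MeasurableSpace Ω] (P : Measure Ω) (p : ℕ → ℕ)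
    (Z : Fin 2 → (n : ℕ) → Ω → Matrix (Fin (p n)) (Fin n) ℂ) : Prop where
  measurable_entry : ∀ k n i j, Measurable fun ω => Z k n ω i j
  indep : ∀ n, iIndepFun
    (fun (t : Fin 2 × Fin (p n) × Fin n) (ω : Ω) => Z t.1 n ω t.2.1 t.2.2) P
  mean_zero : ∀ k n i j, ∫ ω, Z k n ω i j ∂P = 0
  unit_variance : ∀ k n i j, ∫ ω, ‖Z k n ω i j‖ ^ 2 ∂P = 1
  moment_bound : ∃ η : ℝ, 0 < η ∧ ∃ M : ℝ, ∀ k n i j,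
    ∫⁻ ω, ENNReal.ofReal (‖Z k n ω i j‖ ^ (4 + η)) ∂P ≤ ENNReal.ofReal M

/-- `μ` is the limiting spectral distribution, read on the real line, of the matrices
`Sₙ⁻ = (1/n) (Z₁ Z₂* - Z₂ Z₁*)`: almost surely, their empirical spectral distributions
converge weakly to the (nonrandom) probability measure `μ`. -/
def IsLSD {Ω : Type*} [MeasurableSpace Ω] (P : Measure Ω) (p : ℕ → ℕ)
    (Z : Fin 2 → (n : ℕ) → Ω → Matrix (Fin (p n)) (Fin n) ℂ) (μ : ProbabilityMeasure ℝ) : Prop :=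
  ∀ᵐ ω ∂P, Tendsto
    (fun n : ℕ => skewESD (commutatorMatrix (Z 0 n ω) (Z 1 n ω))
      (commutatorMatrix_conjTranspose (Z 0 n ω) (Z 1 n ω)))
    atTop (𝓝 μ.toFiniteMeasure)

/-! ### The explicit functions of `c` -/

def r1 (c : ℝ) : ℝ := -((c + 1) / (3 * c ^ 3))
def r3 (c : ℝ) : ℝ := -((c - 2) ^ 3 / (27 * c ^ 3))
def d0 (c : ℝ) : ℝ := 1 / (27 * c ^ 6)
def d2 (c : ℝ) : ℝ := (2 * c ^ 2 + 10 * c - 1) / (27 * c ^ 6)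
def d4 (c : ℝ) : ℝ := (1 - 2 / c) ^ 3 / (27 * c ^ 2)

/-- `R(z) = r₁ / z + r₃ / z³` for `z ≠ 0`. -/
def R (c : ℝ) (z : ℂ) : ℂ := (r1 c : ℂ) / z + (r3 c : ℂ) / z ^ 3

/-- `r(x)`, for real `x ≠ 0`: the limit of `R(-ε + i x)` as `ε ↓ 0` (see `tendsto_R`). -/
def r (c x : ℝ) : ℂ := R c (Complex.I * x)

theorem tendsto_R (c : ℝ) {x : ℝ} (hx : x ≠ 0) :
    Tendsto (fun ε : ℝ => R c (-(ε : ℂ) + Complex.I * x)) (𝓝[>] 0) (𝓝 (r c x)) := by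
  have hz : Complex.I * (x : ℂ) ≠ 0 :=
    mul_ne_zero Complex.I_ne_zero (Complex.ofReal_ne_zero.mpr hx)
  have hR : ContinuousAt (R c) (Complex.I * (x : ℂ)) := by
    unfold R
    exact (continuousAt_const.div continuousAt_id hz).add
      (continuousAt_const.div (continuousAt_id.pow 3) (pow_ne_zero 3 hz))
  have hl : Tendsto (fun ε : ℝ => -(ε : ℂ) + Complex.I * x) (𝓝[>] 0)
      (𝓝 (Complex.I * (x : ℂ))) := by
    have h : Continuous fun ε : ℝ => -(ε : ℂ) + Complex.I * x := by fun_prop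
    have h0 := h.tendsto 0
    simp only [Complex.ofReal_zero, neg_zero, zero_add] at h0
    exact h0.mono_left nhdsWithin_le_nhds
  exact hR.tendsto.comp hl

/-- `d(x) = d₀ - d₂ / x² + d₄ / x⁴`, for `x ≠ 0`. -/
def d (c x : ℝ) : ℝ := d0 c - d2 c / x ^ 2 + d4 c / x ^ 4

def Rplus (c : ℝ) : ℝ := (d2 c + √(d2 c ^ 2 - 4 * d0 c * d4 c)) / (2 * d0 c)
def Rminus (c : ℝ) : ℝ := (d2 c - √(d2 c ^ 2 - 4 * d0 c * d4 c)) / (2 * d0 c)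

/-- `L_c`, the square root of the positive part of `R₋`. -/
def lowerEdge (c : ℝ) : ℝ := √(max (Rminus c) 0)

/-- `U_c`, the square root of `R₊` (which is positive for `c > 0`). -/
def upperEdge (c : ℝ) : ℝ := √(Rplus c)

/-- `S_c = (-U_c, -L_c) ∪ (L_c, U_c)`. -/
def supportSet (c : ℝ) : Set ℝ :=
  Set.Ioo (-upperEdge c) (-lowerEdge c) ∪ Set.Ioo (lowerEdge c) (upperEdge c)

def Vplus (c x : ℝ) : ℝ := ‖r c x‖ + √(-d c x)
def Vminus (c x : ℝ) : ℝ := ‖r c x‖ - √(-d c x)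

/-- The density away from `0`:
`(√3 / (2π)) (V₊(x)^{1/3} - V₋(x)^{1/3})` on `S_c`, and `0` elsewhere. -/
def density (c : ℝ) : ℝ → ℝ :=
  (supportSet c).indicator fun x =>
    √3 / (2 * Real.pi) * (Vplus c x ^ (1 / 3 : ℝ) - Vminus c x ^ (1 / 3 : ℝ))

end CommutatorLSD

end

/-! After multiplication by `-i` the matrix is Hermitian: a sum over the columns of `n` independent
rank-two blocks `-(i/n)(a b* - b a*)`. The Stieltjes transform of its spectral distribution is the
normalized trace `m` of the resolvent `R`.

The trace identity `card_add_mul_trace_res` writes `p(1 + z m)` as a sum of forms `-(i/n)(b* R a -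
a* R b)`, one per column. Removing the block of a column leaves a resolvent `G` independent of `a`
and `b`. Fourth moments make `a* G a / n` and `b* G b / n` concentrate at `tr G / n`, and the mixed
forms at `0` (`IsStdFamily.quadratic`). The resolvent identity turns this into a nearly diagonal
linear system for the forms of `R` (`norm_pair_equation_le`). With `y = p/n`, summing over columns
gives the approximate cubic `(1 + z m)(1 - y² m²) + 2 y m² = 0` in mean. Changing one column moves
the trace by a bounded amount, so bounded differences and Borel–Cantelli pass from the mean to
almost every sample.

The limiting cubic has the partial fraction form `z = -1/m + 1/(1 + c m) - 1/(1 - c m)`. Its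
imaginary part gives, for roots with `Im m > 0`, the closed inequality `c(|m/(1 + c m)|² + |m/(1 - c
m)|²) ≤ 1`. Together with `Im m ≥ 0` this singles out at most one root, even for real `z`
(`Admissible.unique`). Hence compactness alone yields boundary values on the real line, and their
continuity, wherever roots stay bounded: at all `x ≠ 0`, and also at `0` when `c < 2`.

Stieltjes inversion makes the boundary value the density, and Cardano's formula makes it explicit
(`Admissible.im_eq_density`). The density off `0` and the total mass fix the law, so all limit
points agree; tightness follows from the cubic on the imaginary axis. At `0` with `c ≥ 2`,
differentiability of the distribution function would bound `Im m(iε)`, which the cubic at `iε`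
forbids. -/

noncomputable section

namespace CommutatorLSD

/-! ### Resolvents of Hermitian matrices -/

section Resolvent

variable {ι : Type*} [Fintype ι]

/-- The squared Euclidean norm of a complex vector. -/
def normSq (x : ι → ℂ) : ℝ := ∑ i, ‖x i‖ ^ 2

theorem normSq_nonneg (x : ι → ℂ) : 0 ≤ normSq x :=
  Finset.sum_nonneg fun _ _ => by positivity

theorem star_dotProduct_self (x : ι → ℂ) : star x ⬝ᵥ x = (normSq x : ℂ) := by
  simp only [dotProduct, normSq, Pi.star_apply, Complex.ofReal_sum]
  refine Finset.sum_congr rfl fun i _ => ?_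
  rw [RCLike.star_def, Complex.conj_mul']
  push_cast; rfl

theorem norm_star_dotProduct_sq_le (x y : ι → ℂ) :
    ‖star x ⬝ᵥ y‖ ^ 2 ≤ normSq x * normSq y := by
  have h1 : ‖star x ⬝ᵥ y‖ ≤ ∑ i, ‖x i‖ * ‖y i‖ := by
    refine (norm_sum_le _ _).trans (Finset.sum_le_sum fun i _ => ?_)
    simp
  calc ‖star x ⬝ᵥ y‖ ^ 2 ≤ (∑ i, ‖x i‖ * ‖y i‖) ^ 2 := by gcongr
    _ ≤ _ := Finset.sum_mul_sq_le_sq_mul_sq _ _ _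

variable [DecidableEq ι]

/-- The resolvent `(H - z)⁻¹`. -/
def res (H : Matrix ι ι ℂ) (z : ℂ) : Matrix ι ι ℂ := (H - z • 1)⁻¹

theorem im_star_dotProduct_mulVec {H : Matrix ι ι ℂ} (hH : H.IsHermitian) (x : ι → ℂ) :
    (star x ⬝ᵥ (H *ᵥ x)).im = 0 := by
  have h : star (star x ⬝ᵥ (H *ᵥ x)) = star x ⬝ᵥ (H *ᵥ x) := by
    rw [← star_dotProduct_star, star_star, star_mulVec, hH.eq,
      ← dotProduct_mulVec]
  exact Complex.conj_eq_iff_im.mp h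

theorem im_form_sub_smul {H : Matrix ι ι ℂ} (hH : H.IsHermitian) (z : ℂ) (x : ι → ℂ) :
    (star x ⬝ᵥ ((H - z • 1) *ᵥ x)).im = - z.im * normSq x := by
  rw [sub_mulVec, smul_mulVec, one_mulVec, dotProduct_sub, dotProduct_smul,
    star_dotProduct_self, Complex.sub_im, im_star_dotProduct_mulVec hH]
  simp

/-- A kernel vector `x` would make the form of `H - z` vanish at `x`, while its imaginary part is
`-Im z` times the squared length of `x`. -/
theorem isUnit_det_sub_smul {H : Matrix ι ι ℂ} (hH : H.IsHermitian) {z : ℂ} (hz : z.im ≠ 0) :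
    IsUnit (H - z • 1).det := by
  rw [isUnit_iff_ne_zero]
  intro h0
  obtain ⟨x, hx, hx0⟩ := exists_mulVec_eq_zero_iff.mpr h0
  have h := im_form_sub_smul hH z x
  rw [hx0, dotProduct_zero, Complex.zero_im] at h
  have h1 : normSq x = 0 := by
    rcases mul_eq_zero.mp h.symm with h | h
    · exact absurd (neg_eq_zero.mp h) hz
    · exact h
  apply hx
  funext i
  have := (Finset.sum_eq_zero_iff_of_nonneg (fun i _ => by positivity)).mp h1 i (Finset.mem_univ i)
  simpa using this

theorem res_mul {H : Matrix ι ι ℂ} (hH : H.IsHermitian) {z : ℂ} (hz : z.im ≠ 0) :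
    res H z * (H - z • 1) = 1 := nonsing_inv_mul _ (isUnit_det_sub_smul hH hz)

theorem mul_res {H : Matrix ι ι ℂ} (hH : H.IsHermitian) {z : ℂ} (hz : z.im ≠ 0) :
    (H - z • 1) * res H z = 1 := mul_nonsing_inv _ (isUnit_det_sub_smul hH hz)

theorem res_conjTranspose {H : Matrix ι ι ℂ} (hH : H.IsHermitian) (z : ℂ) :
    (res H z)ᴴ = res H (star z) := by
  rw [res, res, conjTranspose_nonsing_inv, conjTranspose_sub, conjTranspose_smul, hH.eq,
    conjTranspose_one]

/-- Put `x = (H - z) y` and take the imaginary part of `y* (H - z) y`. This Ward identity is the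
source of every resolvent bound below. -/
theorem im_mul_normSq_res {H : Matrix ι ι ℂ} (hH : H.IsHermitian) {z : ℂ} (hz : z.im ≠ 0)
    (x : ι → ℂ) : z.im * normSq (res H z *ᵥ x) = (star x ⬝ᵥ (res H z *ᵥ x)).im := by
  set y := res H z *ᵥ x with hy
  have hx : x = (H - z • 1) *ᵥ y := by
    rw [hy, mulVec_mulVec, mul_res hH hz, one_mulVec]
  have h1 := im_form_sub_smul hH z y
  rw [← hx] at h1
  have h2 : star x ⬝ᵥ y = star (star y ⬝ᵥ x) := by
    rw [star_dotProduct]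
  rw [h2, RCLike.star_def, Complex.conj_im, h1]
  ring

theorem im_mul_normSq_res_star {H : Matrix ι ι ℂ} (hH : H.IsHermitian) {z : ℂ} (hz : z.im ≠ 0)
    (x : ι → ℂ) : z.im * normSq ((res H z)ᴴ *ᵥ x) = (star x ⬝ᵥ (res H z *ᵥ x)).im := by
  have hz' : (star z).im ≠ 0 := by simpa using hz
  have h := im_mul_normSq_res hH hz' x
  rw [← res_conjTranspose hH] at h
  have h2 : star x ⬝ᵥ ((res H z)ᴴ *ᵥ x) = star (star x ⬝ᵥ (res H z *ᵥ x)) := by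
    rw [star_dotProduct, star_mulVec, conjTranspose_conjTranspose, ← dotProduct_mulVec]
  rw [h2, RCLike.star_def, Complex.conj_im, Complex.conj_im] at h
  linarith

/-- The Ward identity and Cauchy–Schwarz give `Im z · N ≤ ‖x‖ √N` for `N = ‖G x‖²`. -/
theorem normSq_res_le {H : Matrix ι ι ℂ} (hH : H.IsHermitian) {z : ℂ} (hz : 0 < z.im)
    (x : ι → ℂ) : normSq (res H z *ᵥ x) ≤ normSq x / z.im ^ 2 := by
  have h1 := im_mul_normSq_res hH hz.ne' x
  have h2 := norm_star_dotProduct_sq_le x (res H z *ᵥ x)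
  have h3 := Complex.abs_im_le_norm (star x ⬝ᵥ (res H z *ᵥ x))
  set N := normSq (res H z *ᵥ x)
  have hN : 0 ≤ N := normSq_nonneg _
  rw [← h1, abs_of_nonneg (by positivity)] at h3
  have h4 : (z.im * N) ^ 2 ≤ normSq x * N := le_trans (by gcongr) h2
  rw [le_div_iff₀ (by positivity)]
  rcases hN.eq_or_lt with h0 | h0
  · rw [← h0]; simpa using normSq_nonneg x
  · nlinarith

theorem norm_form_res_sq_le {H : Matrix ι ι ℂ} (hH : H.IsHermitian) {z : ℂ} (hz : 0 < z.im)
    (x y : ι → ℂ) : ‖star x ⬝ᵥ (res H z *ᵥ y)‖ ^ 2 ≤ normSq x * normSq y / z.im ^ 2 := by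
  refine (norm_star_dotProduct_sq_le _ _).trans ?_
  rw [mul_div_assoc]
  exact mul_le_mul_of_nonneg_left (normSq_res_le hH hz y) (normSq_nonneg x)

theorem sum_norm_res_sq_le {H : Matrix ι ι ℂ} (hH : H.IsHermitian) {z : ℂ} (hz : 0 < z.im) :
    ∑ i, ∑ j, ‖res H z i j‖ ^ 2 ≤ Fintype.card ι / z.im ^ 2 := by
  rw [Finset.sum_comm]
  calc ∑ j, ∑ i, ‖res H z i j‖ ^ 2 = ∑ j, normSq (res H z *ᵥ Pi.single j 1) := by
        simp [normSq]
    _ ≤ ∑ _j : ι, 1 / z.im ^ 2 := by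
        refine Finset.sum_le_sum fun j _ => (normSq_res_le hH hz _).trans (le_of_eq ?_)
        congr 1
        rw [normSq, Finset.sum_eq_single j] <;> simp +contextual [Pi.single_apply]
    _ = _ := by simp [div_eq_mul_inv]

theorem norm_res_apply_le {H : Matrix ι ι ℂ} (hH : H.IsHermitian) {z : ℂ} (hz : 0 < z.im)
    (i : ι) : ‖res H z i i‖ ≤ 1 / z.im := by
  have h := norm_form_res_sq_le hH hz (Pi.single i 1) (Pi.single i 1)
  have h1 : normSq (Pi.single i 1 : ι → ℂ) = 1 := by
    rw [normSq, Finset.sum_eq_single i] <;> simp +contextual [Pi.single_apply]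
  rw [h1] at h
  have h2 : star (Pi.single i 1 : ι → ℂ) ⬝ᵥ (res H z *ᵥ Pi.single i 1) = res H z i i := by
    rw [mulVec_single_one, ← Pi.single_star, star_one, single_one_dotProduct, col_apply]
  rw [h2] at h
  refine le_of_sq_le_sq ?_ (by positivity)
  rw [div_pow]; simpa using h

theorem norm_trace_res_le {H : Matrix ι ι ℂ} (hH : H.IsHermitian) {z : ℂ} (hz : 0 < z.im) :
    ‖(res H z).trace‖ ≤ Fintype.card ι / z.im := by
  refine (norm_sum_le _ _).trans ((Finset.sum_le_sum fun i _ => norm_res_apply_le hH hz i).trans ?_)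
  simp [div_eq_mul_inv]

/-- The resolvent identity. -/
theorem res_sub_res {H H' : Matrix ι ι ℂ} (hH : H.IsHermitian) (hH' : H'.IsHermitian) {z : ℂ}
    (hz : z.im ≠ 0) : res H' z - res H z = - (res H' z * (H' - H) * res H z) := by
  have h : H' - H = (H' - z • 1) - (H - z • 1) := by abel
  rw [h, mul_sub, sub_mul, res_mul hH' hz, mul_assoc, mul_res hH hz]
  simp

theorem trace_mul_vecMulVec (A : Matrix ι ι ℂ) (u w : ι → ℂ) :
    (A * vecMulVec u w).trace = w ⬝ᵥ (A *ᵥ u) := by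
  rw [mul_vecMulVec, trace_vecMulVec, dotProduct_comm]

/-- A Hermitian rank-one perturbation changes the trace of the resolvent by at most `1 / Im z`. -/
theorem norm_trace_res_rank_one_le {H H' : Matrix ι ι ℂ} (hH : H.IsHermitian)
    (hH' : H'.IsHermitian) {z : ℂ} (hz : 0 < z.im) (σ : ℝ) (u : ι → ℂ)
    (h : H' = H + (σ : ℂ) • vecMulVec u (star u)) :
    ‖(res H' z).trace - (res H z).trace‖ ≤ 1 / z.im := by
  have hd : H' - H = (σ : ℂ) • vecMulVec u (star u) := by rw [h]; abel
  have hr := res_sub_res hH hH' hz.ne'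
  rw [hd] at hr
  set G := res H z
  set G' := res H' z
  set α := star u ⬝ᵥ (G *ᵥ u) with hα
  set α' := star u ⬝ᵥ (G' *ᵥ u) with hα'
  -- The Sherman–Morrison formula in scalar form, for the quadratic forms at `u`.
  have e1 : α' - α = - (σ * α' * α) := by
    have := congrArg (fun M => star u ⬝ᵥ (M *ᵥ u)) hr
    simp only [sub_mulVec, dotProduct_sub, neg_mulVec, dotProduct_neg, Matrix.mul_smul, Matrix.smul_mul,
      smul_mulVec, dotProduct_smul, smul_eq_mul] at this
    rw [this, mul_vecMulVec, vecMulVec_mul, vecMulVec_mulVec]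
    simp only [← dotProduct_mulVec, dotProduct_smul, ← hα, ← hα', op_smul_eq_smul, smul_eq_mul]
    ring
  -- The trace difference is an inner product of `Gᴴ u` and `G' u`. The Ward identities turn their
  -- squared lengths into `Im α / Im z` and `Im α' / Im z`.
  have e2 : G'.trace - G.trace = - (σ * (star (Gᴴ *ᵥ u) ⬝ᵥ (G' *ᵥ u))) := by
    rw [← trace_sub, hr, trace_neg, Matrix.mul_smul, Matrix.smul_mul, trace_smul, trace_mul_comm, ← mul_assoc,
      trace_mul_vecMulVec, star_mulVec, conjTranspose_conjTranspose, ← dotProduct_mulVec,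
      mulVec_mulVec, smul_eq_mul]
  have i1 := im_mul_normSq_res_star hH hz.ne' u
  have i2 := im_mul_normSq_res hH' hz.ne' u
  have cs := norm_star_dotProduct_sq_le (Gᴴ *ᵥ u) (G' *ᵥ u)
  -- From `α' = α / (1 + σ α)` one gets `Im α' = Im α / |1 + σ α|²`, and `|1 + σ α|` is at least `|σ
  -- Im α|`.
  have key : σ ^ 2 * (α.im * α'.im) ≤ 1 := by
    have e3 : α' * (1 + σ * α) = α := by linear_combination e1
    have hne : 1 + σ * α ≠ 0 := by
      intro h0
      rw [h0, mul_zero] at e3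
      rw [← e3] at h0
      simp at h0
    have e4 : α' = α / (1 + σ * α) := by rw [eq_div_iff hne, e3]
    have e5 : α'.im * Complex.normSq (1 + σ * α) = α.im := by
      rw [e4, Complex.div_im]
      have hns : Complex.normSq (1 + σ * α) ≠ 0 := by simpa using hne
      field_simp
      simp
      ring
    have hpos : 0 < Complex.normSq (1 + σ * α) := Complex.normSq_pos.mpr hne
    have e6 : (σ * α.im) ^ 2 ≤ Complex.normSq (1 + σ * α) := by
      rw [Complex.normSq_apply]; simp; nlinarith [mul_self_nonneg (1 + σ * α.re)]
    have e7 : σ ^ 2 * (α.im * α'.im) * Complex.normSq (1 + σ * α) ≤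
        1 * Complex.normSq (1 + σ * α) := by
      calc _ = σ ^ 2 * α.im * (α'.im * Complex.normSq (1 + σ * α)) := by ring
        _ = (σ * α.im) ^ 2 := by rw [e5]; ring
        _ ≤ _ := by rw [one_mul]; exact e6
    exact le_of_mul_le_mul_right e7 hpos
  refine le_of_sq_le_sq ?_ (by positivity)
  rw [e2, norm_neg, norm_mul, mul_pow, Complex.norm_real, Real.norm_eq_abs, sq_abs]
  rw [div_pow, one_pow, le_div_iff₀ (by positivity)]
  calc σ ^ 2 * ‖star (Gᴴ *ᵥ u) ⬝ᵥ (G' *ᵥ u)‖ ^ 2 * z.im ^ 2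
      ≤ σ ^ 2 * (normSq (Gᴴ *ᵥ u) * normSq (G' *ᵥ u)) * z.im ^ 2 := by gcongr
    _ = σ ^ 2 * ((z.im * normSq (Gᴴ *ᵥ u)) * (z.im * normSq (G' *ᵥ u))) := by ring
    _ ≤ 1 := by rw [i1, i2]; exact key

end Resolvent

/-! ### Rank-two commutator blocks -/

section Blocks

variable {ι : Type*} [Fintype ι] [DecidableEq ι]

/-- The Hermitian matrix `-i s (a b* - b a*)`. -/
def block (s : ℝ) (a b : ι → ℂ) : Matrix ι ι ℂ :=
  (-Complex.I * s) • (vecMulVec a (star b) - vecMulVec b (star a))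

omit [Fintype ι] [DecidableEq ι] in
theorem block_isHermitian (s : ℝ) (a b : ι → ℂ) : (block s a b).IsHermitian := by
  unfold block
  ext i j
  simp [vecMulVec_apply]
  ring

omit [Fintype ι] [DecidableEq ι] in
theorem vecMulVec_star_isHermitian (σ : ℝ) (u : ι → ℂ) :
    ((σ : ℂ) • vecMulVec u (star u)).IsHermitian := by
  ext i j
  simp only [conjTranspose_apply, Matrix.smul_apply, vecMulVec_apply, smul_eq_mul, star_mul',
    Pi.star_apply, RCLike.star_def, Complex.conj_ofReal, Complex.conj_conj]
  ring

-- Polarization with `a ± i b` splits a rank-two block into a difference of two rank-one projectors,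
-- so the rank-one trace bound applies twice.
omit [Fintype ι] [DecidableEq ι] in
theorem block_eq (s : ℝ) (a b : ι → ℂ) :
    block s a b = ((s / 2 : ℝ) : ℂ) • vecMulVec (a + Complex.I • b) (star (a + Complex.I • b))
      + ((-(s / 2) : ℝ) : ℂ) • vecMulVec (a - Complex.I • b) (star (a - Complex.I • b)) := by
  ext i j
  simp [block, vecMulVec_apply]
  ring

theorem norm_trace_res_add_block_le {H : Matrix ι ι ℂ} (hH : H.IsHermitian) {z : ℂ}
    (hz : 0 < z.im) (s : ℝ) (a b : ι → ℂ) :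
    ‖(res (H + block s a b) z).trace - (res H z).trace‖ ≤ 2 / z.im := by
  rw [block_eq, ← add_assoc]
  set u := a + Complex.I • b
  set w := a - Complex.I • b
  have h1 : (H + ((s / 2 : ℝ) : ℂ) • vecMulVec u (star u)).IsHermitian :=
    hH.add (vecMulVec_star_isHermitian _ _)
  have b1 := norm_trace_res_rank_one_le hH h1 hz (s / 2) u rfl
  have b2 := norm_trace_res_rank_one_le h1 (h1.add (vecMulVec_star_isHermitian (-(s / 2)) w)) hz
    (-(s / 2)) w rfl
  refine (norm_sub_le_norm_sub_add_norm_sub _ _ _).trans ((add_le_add b2 b1).trans (le_of_eq ?_))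
  ring

/-- With `x` and `y` ranging over `a` and `b`, these relations form a closed linear system for the
four forms of the full resolvent in terms of those of `res H z`. -/
theorem form_res_add_block {H : Matrix ι ι ℂ} (hH : H.IsHermitian) {z : ℂ}
    (hz : 0 < z.im) (s : ℝ) (a b x y : ι → ℂ) :
    star x ⬝ᵥ (res (H + block s a b) z *ᵥ y) = star x ⬝ᵥ (res H z *ᵥ y) +
      Complex.I * s * ((star x ⬝ᵥ (res H z *ᵥ a)) * (star b ⬝ᵥ (res (H + block s a b) z *ᵥ y)) -
        (star x ⬝ᵥ (res H z *ᵥ b)) * (star a ⬝ᵥ (res (H + block s a b) z *ᵥ y))) := by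
  have h1 : (H + block s a b).IsHermitian := hH.add (block_isHermitian s a b)
  have hr := res_sub_res h1 hH hz.ne'
  set G := res H z
  set G' := res (H + block s a b) z
  have hb : H - (H + block s a b) = - block s a b := by abel
  rw [hb] at hr
  have := congrArg (fun M => star x ⬝ᵥ (M *ᵥ y)) hr
  simp only [sub_mulVec, dotProduct_sub, block, Matrix.mul_smul, Matrix.smul_mul,
    smul_mulVec, dotProduct_smul, smul_eq_mul, mul_neg, neg_mul, neg_neg, mul_sub, sub_mul,
    mul_vecMulVec, vecMulVec_mul, vecMulVec_mulVec, op_smul_eq_smul, ← dotProduct_mulVec] at this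
  linear_combination -this

/-- By cyclicity the change is a combination of two forms of `G G'`, each controlled by the norm
bound `1 / (Im z)²`. It measures the cost of replacing the trace without a column by the full trace.
-/
theorem norm_trace_res_add_block_sub_le {H : Matrix ι ι ℂ} (hH : H.IsHermitian) {z : ℂ}
    (hz : 0 < z.im) {s : ℝ} (hs : 0 ≤ s) (a b : ι → ℂ) :
    ‖(res (H + block s a b) z).trace - (res H z).trace‖ ≤
      s * (normSq a + normSq b) / z.im ^ 2 := by
  have h1 : (H + block s a b).IsHermitian := hH.add (block_isHermitian s a b)
  have hr := res_sub_res hH h1 hz.ne'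
  have hb : (H + block s a b) - H = block s a b := by abel
  rw [hb] at hr
  set G := res H z with hG
  set G' := res (H + block s a b) z with hG'
  have key : ∀ x y : ι → ℂ, ‖star x ⬝ᵥ ((G * G') *ᵥ y)‖ ≤
      (normSq x + normSq y) / 2 / z.im ^ 2 := by
    intro x y
    rw [← mulVec_mulVec]
    have c1 := norm_form_res_sq_le hH hz x (G' *ᵥ y)
    have c2 := normSq_res_le h1 hz y
    refine le_of_sq_le_sq (c1.trans ?_) (by have := normSq_nonneg x; have := normSq_nonneg y; positivity)
    have hx := normSq_nonneg x
    have hy := normSq_nonneg y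
    calc normSq x * normSq (G' *ᵥ y) / z.im ^ 2 ≤ normSq x * (normSq y / z.im ^ 2) / z.im ^ 2 := by
          gcongr
      _ = (normSq x * normSq y) / (z.im ^ 2) ^ 2 := by field_simp
      _ ≤ ((normSq x + normSq y) / 2) ^ 2 / (z.im ^ 2) ^ 2 := by
          gcongr; nlinarith [sq_nonneg (normSq x - normSq y)]
      _ = _ := by rw [← div_pow]
  have e : G'.trace - G.trace =
      Complex.I * s * (star b ⬝ᵥ ((G * G') *ᵥ a) - star a ⬝ᵥ ((G * G') *ᵥ b)) := by
    rw [← trace_sub, hr, trace_neg, trace_mul_comm, ← mul_assoc, block, Matrix.mul_smul, trace_smul,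
      mul_sub, trace_sub, trace_mul_vecMulVec, trace_mul_vecMulVec, smul_eq_mul]
    ring
  rw [e, norm_mul, norm_mul, Complex.norm_I, one_mul, Complex.norm_real, Real.norm_eq_abs,
    abs_of_nonneg hs, mul_div_assoc]
  refine mul_le_mul_of_nonneg_left ?_ hs
  refine (norm_sub_le _ _).trans ((add_le_add (key b a) (key a b)).trans (le_of_eq ?_))
  ring

/-- The Hermitian matrix with column pairs `x k`. -/
def blockSum {κ : Type*} [Fintype κ] (s : ℝ) (x : κ → (ι → ℂ) × (ι → ℂ)) : Matrix ι ι ℂ :=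
  ∑ k, block s (x k).1 (x k).2

omit [Fintype ι] [DecidableEq ι] in
theorem isHermitian_sum_block {κ : Type*} (t : Finset κ) (s : ℝ) (x : κ → (ι → ℂ) × (ι → ℂ)) :
    (∑ k ∈ t, block s (x k).1 (x k).2).IsHermitian := by
  classical
  induction t using Finset.induction with
  | empty => simp
  | insert k t hk ih => rw [Finset.sum_insert hk]; exact (block_isHermitian _ _ _).add ih

/-- The trace identity behind the fixed point equation. -/
theorem card_add_mul_trace_res {κ : Type*} [Fintype κ] (s : ℝ) (x : κ → (ι → ℂ) × (ι → ℂ))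
    {z : ℂ} (hz : 0 < z.im) :
    (Fintype.card ι : ℂ) + z * (res (blockSum s x) z).trace =
      ∑ k, -Complex.I * s * (star (x k).2 ⬝ᵥ (res (blockSum s x) z *ᵥ (x k).1) -
        star (x k).1 ⬝ᵥ (res (blockSum s x) z *ᵥ (x k).2)) := by
  have hH : (blockSum s x).IsHermitian := isHermitian_sum_block _ s x
  have h := congrArg trace (res_mul hH hz.ne')
  set G := res (blockSum s x) z
  rw [mul_sub, trace_sub, Matrix.mul_smul, mul_one, trace_smul, trace_one, smul_eq_mul,
    sub_eq_iff_eq_add] at h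
  rw [← h, blockSum, Finset.mul_sum, trace_sum]
  refine Finset.sum_congr rfl fun k _ => ?_
  rw [block, Matrix.mul_smul, trace_smul, mul_sub, trace_sub, trace_mul_vecMulVec, trace_mul_vecMulVec,
    smul_eq_mul]

end Blocks

theorem neg_I_smul_commutatorMatrix {p n : ℕ} (X₁ X₂ : Matrix (Fin p) (Fin n) ℂ) :
    (-Complex.I) • commutatorMatrix X₁ X₂ =
      blockSum ((n : ℝ)⁻¹) fun k => (fun i => X₁ i k, fun i => X₂ i k) := by
  ext i j
  simp only [commutatorMatrix, blockSum, block, Matrix.smul_apply, Matrix.sub_apply, mul_apply, Matrix.sum_apply,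
    conjTranspose_apply, vecMulVec_apply, smul_eq_mul, Pi.star_apply]
  rw [← Finset.mul_sum, Finset.sum_sub_distrib]
  push_cast
  ring

theorem integral_skewESD {p : ℕ} (S : Matrix (Fin p) (Fin p) ℂ) (hS : Sᴴ = -S) {z : ℂ}
    (hz : 0 < z.im) :
    ∫ x : ℝ, ((x : ℂ) - z)⁻¹ ∂(skewESD S hS : Measure ℝ) =
      (p : ℂ)⁻¹ * (res ((-Complex.I) • S) z).trace := by
  have hH := isHermitian_neg_I_smul hS
  have hne : ∀ x : ℝ, (x : ℂ) - z ≠ 0 := fun x h => by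
    have := congrArg Complex.im h
    simp at this; exact hz.ne' this
  have hres : res ((-Complex.I) • S) z =
      (hH.eigenvectorUnitary : Matrix (Fin p) (Fin p) ℂ) *
        diagonal (fun j => ((hH.eigenvalues j : ℂ) - z)⁻¹) *
        star (hH.eigenvectorUnitary : Matrix (Fin p) (Fin p) ℂ) := by
    rw [res]
    refine inv_eq_right_inv ?_
    have hU : star (hH.eigenvectorUnitary : Matrix (Fin p) (Fin p) ℂ) *
        (hH.eigenvectorUnitary : Matrix (Fin p) (Fin p) ℂ) = 1 := by simp
    have hU' : (hH.eigenvectorUnitary : Matrix (Fin p) (Fin p) ℂ) *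
        star (hH.eigenvectorUnitary : Matrix (Fin p) (Fin p) ℂ) = 1 := by simp
    have hsp : (-Complex.I) • S - z • 1 =
        (hH.eigenvectorUnitary : Matrix (Fin p) (Fin p) ℂ) *
        diagonal (fun j => (hH.eigenvalues j : ℂ) - z) *
        star (hH.eigenvectorUnitary : Matrix (Fin p) (Fin p) ℂ) := by
      have h1 := hH.spectral_theorem
      rw [Unitary.conjStarAlgAut_apply] at h1
      have h2 : diagonal (fun j => (hH.eigenvalues j : ℂ) - z) =
          diagonal (RCLike.ofReal ∘ hH.eigenvalues) - z • (1 : Matrix (Fin p) (Fin p) ℂ) := by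
        ext i j
        by_cases hij : i = j <;> simp [hij, diagonal]
      rw [h2, mul_sub, sub_mul, ← h1, Matrix.mul_smul, Matrix.smul_mul, mul_one, hU']
    rw [hsp]
    calc _ = (hH.eigenvectorUnitary : Matrix (Fin p) (Fin p) ℂ) *
        (diagonal (fun j => (hH.eigenvalues j : ℂ) - z) *
        (star (hH.eigenvectorUnitary : Matrix (Fin p) (Fin p) ℂ) *
        (hH.eigenvectorUnitary : Matrix (Fin p) (Fin p) ℂ)) *
        diagonal (fun j => ((hH.eigenvalues j : ℂ) - z)⁻¹)) *
        star (hH.eigenvectorUnitary : Matrix (Fin p) (Fin p) ℂ) := by simp only [mul_assoc]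
      _ = 1 := by
        rw [hU, mul_one, diagonal_mul_diagonal]
        simp only [mul_inv_cancel₀ (hne _)]
        rw [diagonal_one, mul_one, hU']
  have htr : (res ((-Complex.I) • S) z).trace = ∑ j, ((hH.eigenvalues j : ℂ) - z)⁻¹ := by
    rw [hres, trace_mul_comm, ← mul_assoc]
    simp [trace_diagonal]
  rw [htr]
  -- For `p = 0` the spectral distribution is the zero measure and the inverse of `0` is `0`, so
  -- both sides vanish.
  rcases Nat.eq_zero_or_pos p with hp | hp
  · subst hp
    simp [skewESD]
  have hpi : (p : ENNReal)⁻¹ ≠ ⊤ := by simp [hp.ne']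
  change ∫ x : ℝ, ((x : ℂ) - z)⁻¹ ∂(∑ j : Fin p, (p : ENNReal)⁻¹ •
    Measure.dirac (hH.eigenvalues j)) = _
  rw [integral_finsetSum_measure]
  · simp [integral_smul_measure, Finset.mul_sum]
  · intro j _
    refine Integrable.smul_measure ?_ hpi
    exact integrable_dirac (by simp)

/-! ### Second moments of quadratic forms in independent variables -/

section QuadraticForm

variable {Ω : Type*} [MeasurableSpace Ω] {P : Measure Ω}

theorem memLp_two_of_norm_sq {U : Ω → ℂ} (hU : AEStronglyMeasurable U P)
    (h : Integrable (fun ω => ‖U ω‖ ^ 2) P) : MemLp U 2 P :=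
  (memLp_two_iff_integrable_sq_norm hU).mpr h

theorem MemLp.integrable_norm_sq_two {U : Ω → ℂ} (h : MemLp U 2 P) :
    Integrable (fun ω => ‖U ω‖ ^ 2) P :=
  (memLp_two_iff_integrable_sq_norm h.1).mp h

theorem memLp_two_star {U : Ω → ℂ} (h : MemLp U 2 P) : MemLp (fun ω => star (U ω)) 2 P :=
  h.of_le h.1.star (Eventually.of_forall fun ω => by simp)

theorem memLp_two_mul_of_indepFun {U V : Ω → ℂ} (hU : MemLp U 2 P) (hV : MemLp V 2 P)
    (h : IndepFun U V P) : MemLp (fun ω => U ω * V ω) 2 P ∧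
      ∫ ω, ‖U ω * V ω‖ ^ 2 ∂P = (∫ ω, ‖U ω‖ ^ 2 ∂P) * ∫ ω, ‖V ω‖ ^ 2 ∂P := by
  have hn : Measurable fun z : ℂ => ‖z‖ ^ 2 := by fun_prop
  have h2 : IndepFun (fun ω => ‖U ω‖ ^ 2) (fun ω => ‖V ω‖ ^ 2) P := h.comp hn hn
  have iU := MemLp.integrable_norm_sq_two hU
  have iV := MemLp.integrable_norm_sq_two hV
  have e : (fun ω => ‖U ω * V ω‖ ^ 2) = fun ω => ‖U ω‖ ^ 2 * ‖V ω‖ ^ 2 := by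
    funext ω; rw [norm_mul, mul_pow]
  refine ⟨memLp_two_of_norm_sq (hU.1.mul hV.1) ?_, ?_⟩
  · rw [e]; exact h2.integrable_mul iU iV
  · rw [e]; exact h2.integral_fun_mul_eq_mul_integral iU.1 iV.1

theorem integral_add₃ {E : Type*} [NormedAddCommGroup E] [NormedSpace ℝ E] {f g h : Ω → E}
    (hf : Integrable f P) (hg : Integrable g P) (hh : Integrable h P) :
    ∫ ω, f ω + g ω + h ω ∂P = ∫ ω, f ω ∂P + ∫ ω, g ω ∂P + ∫ ω, h ω ∂P := by
  rw [← integral_add hf hg]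
  exact integral_add (hf.add hg) hh

theorem measurable_complex_star : Measurable (star : ℂ → ℂ) := continuous_star.measurable

theorem integral_norm_sq_add_of_orthogonal {U V : Ω → ℂ} (hU : MemLp U 2 P) (hV : MemLp V 2 P)
    (h : ∫ ω, star (U ω) * V ω ∂P = 0) :
    ∫ ω, ‖U ω + V ω‖ ^ 2 ∂P = (∫ ω, ‖U ω‖ ^ 2 ∂P) + ∫ ω, ‖V ω‖ ^ 2 ∂P := by
  have iU := MemLp.integrable_norm_sq_two hU
  have iV := MemLp.integrable_norm_sq_two hV
  have iUV : Integrable (fun ω => star (U ω) * V ω) P := (memLp_two_star hU).integrable_mul hV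
  have e : ∀ ω, ‖U ω + V ω‖ ^ 2 = ‖U ω‖ ^ 2 + ‖V ω‖ ^ 2 + 2 * (star (U ω) * V ω).re := by
    intro ω
    rw [← Complex.normSq_eq_norm_sq, Complex.normSq_add, Complex.normSq_eq_norm_sq,
      Complex.normSq_eq_norm_sq]
    simp
  have hre : ∫ ω, (star (U ω) * V ω).re ∂P = 0 := by
    have := integral_re iUV
    rw [h] at this
    simpa using this
  simp_rw [e]
  have iR : Integrable (fun ω => 2 * (star (U ω) * V ω).re) P := iUV.re.const_mul 2
  rw [integral_add₃ iU iV iR, integral_const_mul, hre]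
  ring

variable {ι : Type*} {x : ι → Ω → ℂ}

/-- A function of the variables indexed by `s` is independent of a variable outside `s`. -/
theorem indepFun_of_finset_of_notMem {β γ : Type*} [MeasurableSpace β] [MeasurableSpace γ]
    {x : ι → Ω → γ} [Zero γ]
    (hx : ∀ i, Measurable (x i)) (hi : iIndepFun x P) {s t : Finset ι} (hst : Disjoint s t)
    {F : (ι → γ) → β} (hF : Measurable F) (hs : ∀ y y', (∀ i ∈ s, y i = y' i) → F y = F y')
    {β' : Type*} [MeasurableSpace β'] {F' : (ι → γ) → β'} (hF' : Measurable F')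
    (ht : ∀ y y', (∀ i ∈ t, y i = y' i) → F' y = F' y') :
    IndepFun (fun ω => F fun i => x i ω) (fun ω => F' fun i => x i ω) P := by
  classical
  have h := hi.indepFun_finset s t hst hx
  -- Extension by zero lets `F` and `F'` factor through the coordinates in `s` and `t`; by `hs` and
  -- `ht` the filled-in values do not matter.
  let e : ∀ u : Finset ι, (u → γ) → ι → γ := fun u y i => if h : i ∈ u then y ⟨i, h⟩ else 0
  have he : ∀ u, Measurable (e u) := fun u => by
    refine measurable_pi_lambda _ fun i => ?_
    by_cases hi : i ∈ u
    · simp only [e, hi, dif_pos]; exact measurable_pi_apply _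
    · simp only [e, hi]; exact measurable_const
  have h' := h.comp (hF.comp (he s)) (hF'.comp (he t))
  convert h' using 1
  · funext ω
    exact hs _ _ fun i hi => by simp [e, hi]
  · funext ω
    exact ht _ _ fun i hi => by simp [e, hi]

variable [IsProbabilityMeasure P]

/-- Independent, centred, normalized complex random variables. -/
structure IsStdFamily (P : Measure Ω) (x : ι → Ω → ℂ) : Prop where
  meas : ∀ i, Measurable (x i)
  indep : iIndepFun x P
  mean : ∀ i, ∫ ω, x i ω ∂P = 0
  var : ∀ i, ∫ ω, ‖x i ω‖ ^ 2 ∂P = 1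
  memLp : ∀ i, MemLp (x i) 2 P

theorem IsStdFamily.indepFun (h : IsStdFamily P x) {s : Finset ι} {k : ι} (hk : k ∉ s)
    {F : (ι → ℂ) → ℂ} (hF : Measurable F) (hs : ∀ y y', (∀ i ∈ s, y i = y' i) → F y = F y') :
    IndepFun (fun ω => F fun i => x i ω) (x k) P :=
  indepFun_of_finset_of_notMem h.meas h.indep (t := {k}) (by simpa using hk) hF hs
    (F' := fun y => y k) (measurable_pi_apply k) (fun y y' h => h k (by simp))

theorem IsStdFamily.linear (h : IsStdFamily P x) (a : ι → ℂ) (s : Finset ι) :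
    MemLp (fun ω => ∑ i ∈ s, a i * x i ω) 2 P ∧
      ∫ ω, ‖∑ i ∈ s, a i * x i ω‖ ^ 2 ∂P = ∑ i ∈ s, ‖a i‖ ^ 2 := by
  classical
  have hmem : ∀ s : Finset ι, MemLp (fun ω => ∑ i ∈ s, a i * x i ω) 2 P := fun s =>
    memLp_finsetSum s fun i _ => (h.memLp i).const_mul (a i)
  refine ⟨hmem s, ?_⟩
  induction s using Finset.induction with
  | empty => simp
  | insert k s hk ih =>
    simp_rw [Finset.sum_insert hk, add_comm (a k * x k _)]
    rw [integral_norm_sq_add_of_orthogonal (hmem s) ((h.memLp k).const_mul (a k)), ih, add_comm]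
    · congr 1
      simp_rw [norm_mul, mul_pow]
      rw [integral_const_mul, h.var, mul_one]
    · have hI := h.indepFun hk (F := fun y => star (∑ i ∈ s, a i * y i) * a k) (by fun_prop)
        (fun y y' hy => by
          rw [Finset.sum_congr rfl fun i hi => by rw [hy i hi]])
      have e : (fun ω => star (∑ i ∈ s, a i * x i ω) * (a k * x k ω)) =
          fun ω => star (∑ i ∈ s, a i * x i ω) * a k * x k ω := by funext ω; ring
      rw [e, hI.integral_fun_mul_eq_mul_integral, h.mean, mul_zero]
      · exact ((memLp_two_star (hmem s)).1).mul_const _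
      · exact (h.memLp k).1

/-- Adding one index `k` changes the centred form by `D = L1 · star x_k + L2 · x_k + B k k (|x_k|² -
1)`, where `L1` and `L2` are linear in the earlier variables. This increment is orthogonal to the
earlier form, so second moments add up. The three terms are estimated separately, whence the factor
`3`; no value of `E x²` is needed. -/
theorem IsStdFamily.quadratic (h : IsStdFamily P x) {M : ℝ} (hM1 : 1 ≤ M)
    (h4 : ∀ i, Integrable (fun ω => ‖x i ω‖ ^ 4) P) (hM : ∀ i, ∫ ω, ‖x i ω‖ ^ 4 ∂P ≤ M)
    (B : ι → ι → ℂ) (s : Finset ι) :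
    MemLp (fun ω => ∑ i ∈ s, ∑ j ∈ s, star (x i ω) * B i j * x j ω - ∑ i ∈ s, B i i) 2 P ∧
      ∫ ω, ‖∑ i ∈ s, ∑ j ∈ s, star (x i ω) * B i j * x j ω - ∑ i ∈ s, B i i‖ ^ 2 ∂P ≤
        3 * M * ∑ i ∈ s, ∑ j ∈ s, ‖B i j‖ ^ 2 := by
  classical
  induction s using Finset.induction with
  | empty => simp
  | insert k s hk ih =>
    obtain ⟨ihm, ihb⟩ := ih
    set Q : Ω → ℂ := fun ω => ∑ i ∈ s, ∑ j ∈ s, star (x i ω) * B i j * x j ω - ∑ i ∈ s, B i i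
      with hQ
    let q : (ι → ℂ) → ℂ := fun y => ∑ i ∈ s, ∑ j ∈ s, star (y i) * B i j * y j - ∑ i ∈ s, B i i
    let l1 : (ι → ℂ) → ℂ := fun y => ∑ j ∈ s, B k j * y j
    let l2 : (ι → ℂ) → ℂ := fun y => star (∑ i ∈ s, star (B i k) * y i)
    have qm : Measurable q := by fun_prop
    have l1m : Measurable l1 := by fun_prop
    have l2m : Measurable l2 := by fun_prop
    have qs : ∀ y y', (∀ i ∈ s, y i = y' i) → q y = q y' := fun y y' hy => by
      simp only [q]
      congr 1
      exact Finset.sum_congr rfl fun i hi => Finset.sum_congr rfl fun j hj => by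
        rw [hy i hi, hy j hj]
    have l1s : ∀ y y', (∀ i ∈ s, y i = y' i) → l1 y = l1 y' := fun y y' hy =>
      Finset.sum_congr rfl fun i hi => by rw [hy i hi]
    have l2s : ∀ y y', (∀ i ∈ s, y i = y' i) → l2 y = l2 y' := fun y y' hy =>
      congrArg star (Finset.sum_congr rfl fun i hi => by rw [hy i hi])
    set L1 : Ω → ℂ := fun ω => l1 fun i => x i ω with hL1
    set L2 : Ω → ℂ := fun ω => l2 fun i => x i ω with hL2
    have L1p := h.linear (fun j => B k j) s
    have L2p := h.linear (fun i => star (B i k)) s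
    have L1mem : MemLp L1 2 P := L1p.1
    have L2mem : MemLp L2 2 P := memLp_two_star L2p.1
    have L1v : ∫ ω, ‖L1 ω‖ ^ 2 ∂P = ∑ j ∈ s, ‖B k j‖ ^ 2 := L1p.2
    have L2v : ∫ ω, ‖L2 ω‖ ^ 2 ∂P = ∑ i ∈ s, ‖B i k‖ ^ 2 := by
      have := L2p.2
      simp only [norm_star] at this
      simp only [L2, l2, norm_star]
      exact this
    have cm : Measurable (star : ℂ → ℂ) := measurable_complex_star
    have I1 : IndepFun L1 (fun ω => star (x k ω)) P :=
      (h.indepFun hk l1m l1s).comp measurable_id cm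
    have I2 : IndepFun L2 (x k) P := h.indepFun hk l2m l2s
    have xs := memLp_two_star (h.memLp k)
    have D1 := memLp_two_mul_of_indepFun L1mem xs I1
    have D2 := memLp_two_mul_of_indepFun L2mem (h.memLp k) I2
    set T : Ω → ℂ := fun ω => B k k * (((‖x k ω‖ ^ 2 - 1 : ℝ)) : ℂ) with hT
    have ixk := MemLp.integrable_norm_sq_two (h.memLp k)
    have eT : ∀ ω, ‖T ω‖ ^ 2 = ‖B k k‖ ^ 2 * (‖x k ω‖ ^ 4 - 2 * ‖x k ω‖ ^ 2 + 1) := by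
      intro ω
      simp only [T]
      rw [norm_mul, mul_pow, Complex.norm_real, Real.norm_eq_abs, sq_abs]
      ring
    have Tint : Integrable (fun ω => ‖T ω‖ ^ 2) P := by
      simp_rw [eT]
      exact (((h4 k).sub (ixk.const_mul 2)).add (integrable_const 1)).const_mul _
    have Tm : Measurable T := by
      have := h.meas k
      fun_prop
    have Tmem : MemLp T 2 P := memLp_two_of_norm_sq Tm.aestronglyMeasurable Tint
    have Tv : ∫ ω, ‖T ω‖ ^ 2 ∂P ≤ ‖B k k‖ ^ 2 * M := by
      simp_rw [eT]
      have e4 : ∫ ω, ‖x k ω‖ ^ 4 - 2 * ‖x k ω‖ ^ 2 + 1 ∂P = ∫ ω, ‖x k ω‖ ^ 4 ∂P +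
          ∫ ω, -2 * ‖x k ω‖ ^ 2 ∂P + ∫ ω, 1 ∂P := by
        rw [← integral_add₃ (h4 k) (ixk.const_mul (-2)) (integrable_const 1)]
        congr 1; funext ω; ring
      rw [integral_const_mul, e4, integral_const_mul, h.var]
      simp only [integral_const, probReal_univ, smul_eq_mul]
      refine mul_le_mul_of_nonneg_left ?_ (by positivity)
      linarith [hM k]
    set D : Ω → ℂ := fun ω => L1 ω * star (x k ω) + L2 ω * x k ω + T ω with hD
    have Dmem : MemLp D 2 P := (D1.1.add D2.1).add Tmem
    have Dv : ∫ ω, ‖D ω‖ ^ 2 ∂P ≤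
        3 * M * (∑ j ∈ s, ‖B k j‖ ^ 2 + ∑ i ∈ s, ‖B i k‖ ^ 2 + ‖B k k‖ ^ 2) := by
      have i1 := MemLp.integrable_norm_sq_two D1.1
      have i2 := MemLp.integrable_norm_sq_two D2.1
      have hle : ∫ ω, ‖D ω‖ ^ 2 ∂P ≤
          ∫ ω, 3 * (‖L1 ω * star (x k ω)‖ ^ 2 + ‖L2 ω * x k ω‖ ^ 2 + ‖T ω‖ ^ 2) ∂P := by
        refine integral_mono (MemLp.integrable_norm_sq_two Dmem) (((i1.add i2).add Tint).const_mul 3)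
          fun ω => ?_
        have t1 := norm_add₃_le (a := L1 ω * star (x k ω)) (b := L2 ω * x k ω) (c := T ω)
        simp only [D]
        set u := ‖L1 ω * star (x k ω)‖
        set v := ‖L2 ω * x k ω‖
        set w := ‖T ω‖
        have : ‖L1 ω * star (x k ω) + L2 ω * x k ω + T ω‖ ^ 2 ≤ (u + v + w) ^ 2 := by gcongr
        nlinarith [sq_nonneg (u - v), sq_nonneg (u - w), sq_nonneg (v - w)]
      refine hle.trans ?_
      rw [integral_const_mul, integral_add₃ i1 i2 Tint, D1.2, D2.2, L1v,
        L2v]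
      simp only [norm_star, h.var]
      have p1 : 0 ≤ ∑ j ∈ s, ‖B k j‖ ^ 2 := Finset.sum_nonneg fun _ _ => by positivity
      have p2 : 0 ≤ ∑ i ∈ s, ‖B i k‖ ^ 2 := Finset.sum_nonneg fun _ _ => by positivity
      nlinarith
    have Qe : (fun ω => ∑ i ∈ insert k s, ∑ j ∈ insert k s, star (x i ω) * B i j * x j ω -
        ∑ i ∈ insert k s, B i i) = fun ω => Q ω + D ω := by
      funext ω
      have hn : ((‖x k ω‖ ^ 2 - 1 : ℝ) : ℂ) = star (x k ω) * x k ω - 1 := by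
        rw [RCLike.star_def, Complex.conj_mul']; push_cast; rfl
      simp only [Q, D, L1, L2, l1, l2, T, hn, Finset.sum_insert hk, Finset.sum_add_distrib,
        star_sum, star_mul', star_star, Finset.sum_mul]
      have r1 : ∑ j ∈ s, star (x k ω) * B k j * x j ω = ∑ j ∈ s, B k j * x j ω * star (x k ω) :=
        Finset.sum_congr rfl fun _ _ => by ring
      have r2 : ∑ i ∈ s, star (x i ω) * B i k * x k ω = ∑ i ∈ s, B i k * star (x i ω) * x k ω :=
        Finset.sum_congr rfl fun _ _ => by ring
      rw [r1, r2]
      ring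
    have Qm : Measurable Q := qm.comp (measurable_pi_lambda _ h.meas)
    -- Each product is a function of the variables in `s` times a centred function of `x k`.
    have orth : ∫ ω, star (Q ω) * D ω ∂P = 0 := by
      have Qs := memLp_two_star ihm
      have q1 := Qs.integrable_mul L1mem
      have q2 := Qs.integrable_mul L2mem
      have J1 : IndepFun (fun ω => star (Q ω) * L1 ω) (fun ω => star (x k ω)) P :=
        (h.indepFun hk (F := fun y => star (q y) * l1 y) (by fun_prop)
          (fun y y' hy => by rw [qs y y' hy, l1s y y' hy])).comp measurable_id cm
      have J2 : IndepFun (fun ω => star (Q ω) * L2 ω) (x k) P :=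
        h.indepFun hk (F := fun y => star (q y) * l2 y) (by fun_prop)
          (fun y y' hy => by rw [qs y y' hy, l2s y y' hy])
      have J3 : IndepFun (fun ω => star (Q ω)) T P :=
        (h.indepFun hk (F := fun y => star (q y)) (by fun_prop)
          (fun y y' hy => by rw [qs y y' hy])).comp measurable_id
          (ψ := fun w : ℂ => B k k * (((‖w‖ ^ 2 - 1 : ℝ)) : ℂ)) (by fun_prop)
      have xi := (h.memLp k).integrable one_le_two
      have xsi := xs.integrable one_le_two
      have Ti := Tmem.integrable one_le_two
      have e : (fun ω => star (Q ω) * D ω) = fun ω => star (Q ω) * L1 ω * star (x k ω) +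
          star (Q ω) * L2 ω * x k ω + star (Q ω) * T ω := by
        funext ω; simp only [D]; ring
      have k1 : ∫ ω, star (x k ω) ∂P = 0 := by
        have : ∫ ω, star (x k ω) ∂P = star (∫ ω, x k ω ∂P) := integral_conj
        rw [this, h.mean, star_zero]
      have k3 : ∫ ω, T ω ∂P = 0 := by
        simp only [T]
        rw [integral_const_mul, integral_complex_ofReal, integral_sub ixk (integrable_const 1), h.var]
        simp
      rw [e, integral_add₃, J1.integral_fun_mul_eq_mul_integral q1.1 xsi.1,
        J2.integral_fun_mul_eq_mul_integral q2.1 xi.1,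
        J3.integral_fun_mul_eq_mul_integral Qs.1 Ti.1, k1, h.mean, k3]
      · simp
      · exact J1.integrable_mul q1 xsi
      · exact J2.integrable_mul q2 xi
      · exact J3.integrable_mul (Qs.integrable one_le_two) Ti
    have Qe' := fun ω => congrFun Qe ω
    rw [Qe]
    simp_rw [Qe']
    refine ⟨ihm.add Dmem, ?_⟩
    rw [integral_norm_sq_add_of_orthogonal ihm Dmem orth]
    refine (add_le_add ihb Dv).trans (le_of_eq ?_)
    simp only [Finset.sum_insert hk, Finset.sum_add_distrib]
    ring

end QuadraticForm

/-! ### The bounded differences inequality -/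

section BoundedDifferences

variable {E : Type*} [MeasurableSpace E]

theorem integrable_of_measurable_bounded {Ω : Type*} [MeasurableSpace Ω] {P : Measure Ω}
    [IsFiniteMeasure P] {F : Type*} [NormedAddCommGroup F] [MeasurableSpace F] [BorelSpace F]
    [SecondCountableTopology F] {f : Ω → F} (hf : Measurable f) {B : ℝ}
    (hB : ∀ x, ‖f x‖ ≤ B) : Integrable f P :=
  Integrable.of_bound hf.aestronglyMeasurable B (Eventually.of_forall hB)

/-- Hoeffding's lemma on the interval of radius `c` around `f x₀`. Its length `2c` gives `c² / 2`;
this is not optimal, but the constant plays no role. -/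
theorem integral_exp_le_of_oscillation {ν : Measure E} [IsProbabilityMeasure ν] {f : E → ℝ}
    (hf : Measurable f) {c : ℝ} (hc : 0 ≤ c) (hosc : ∀ x y, |f x - f y| ≤ c) :
    ∫ x, Real.exp (f x) ∂ν ≤ Real.exp (∫ x, f x ∂ν + c ^ 2 / 2) := by
  obtain ⟨x₀⟩ : Nonempty E := by
    by_contra h
    rw [not_nonempty_iff] at h
    exact (IsProbabilityMeasure.ne_zero ν) (Measure.eq_zero_of_isEmpty ν)
  have hmem : ∀ᵐ x ∂ν, f x ∈ Set.Icc (f x₀ - c) (f x₀ + c) := Eventually.of_forall fun x => by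
    have := abs_le.mp (hosc x x₀)
    constructor <;> linarith
  have h := (hasSubgaussianMGF_of_mem_Icc hf.aemeasurable hmem).mgf_le 1
  have e : (((‖f x₀ + c - (f x₀ - c)‖₊ / 2) ^ 2 : NNReal) : ℝ) = c ^ 2 := by
    have : f x₀ + c - (f x₀ - c) = 2 * c := by ring
    rw [this]
    push_cast
    rw [Real.norm_eq_abs, abs_of_nonneg (by positivity)]
    ring
  rw [e, mgf] at h
  simp only [one_mul, one_pow, mul_one, Real.exp_sub] at h
  rw [integral_div, div_le_iff₀ (Real.exp_pos _), ← Real.exp_add] at h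
  rwa [add_comm]

/-- Integrate out one coordinate at a time: the inner integral costs `c² / 2` by the oscillation
bound, and the partial mean `g` has the same bounded differences in the remaining coordinates. -/
theorem integral_exp_le_of_boundedDiff (n : ℕ) : ∀ (ν : Fin n → Measure E)
    [∀ k, IsProbabilityMeasure (ν k)] (f : (Fin n → E) → ℝ), Measurable f →
    ∀ B : ℝ, (∀ x, |f x| ≤ B) → ∀ c : ℝ, 0 ≤ c →
    (∀ x k y, |f (Function.update x k y) - f x| ≤ c) →
    ∫ x, Real.exp (f x) ∂(Measure.pi ν) ≤
      Real.exp (∫ x, f x ∂(Measure.pi ν) + n * (c ^ 2 / 2)) := by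
  induction n with
  | zero =>
    intro ν _ f _ B _ c _ _
    have hc : f = fun _ => f Fin.elim0 := by funext x; congr 1; funext i; exact i.elim0
    rw [hc]
    simp
  | succ n ih =>
    intro ν _ f hf B hB c hc hd
    let ν' : Fin n → Measure E := fun j => ν (Fin.succAbove 0 j)
    have mp := measurePreserving_piFinSuccAbove ν 0
    have mps := mp.symm
    have hsymm : ∀ q, (MeasurableEquiv.piFinSuccAbove (fun _ : Fin (n + 1) => E) 0).symm q =
        Fin.cons q.1 q.2 := fun q => by
      simp [MeasurableEquiv.piFinSuccAbove_symm_apply, Fin.insertNthEquiv]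
    have hcons : Measurable fun q : E × (Fin n → E) => (Fin.cons q.1 q.2 : Fin (n + 1) → E) := by
      simp_rw [← hsymm]
      exact MeasurableEquiv.measurable _
    let F : E × (Fin n → E) → ℝ := fun q => f (Fin.cons q.1 q.2)
    have Fm : Measurable F := hf.comp hcons
    have FB : ∀ q, |F q| ≤ B := fun q => hB _
    have tr : ∀ g : ℝ → ℝ, ∫ x, g (f x) ∂(Measure.pi ν) =
        ∫ q, g (F q) ∂((ν 0).prod (Measure.pi ν')) := fun g => by
      rw [← mps.integral_comp' (g := fun x => g (f x))]
      simp only [hsymm, F, ν']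
    have Fi : Integrable F ((ν 0).prod (Measure.pi ν')) := integrable_of_measurable_bounded Fm FB
    have eB : ∀ t : ℝ, |t| ≤ B → ‖Real.exp t‖ ≤ Real.exp B := fun t ht => by
      rw [Real.norm_eq_abs, Real.abs_exp]
      exact Real.exp_le_exp.mpr ((le_abs_self t).trans ht)
    have eFi : Integrable (fun q => Real.exp (F q)) ((ν 0).prod (Measure.pi ν')) :=
      integrable_of_measurable_bounded Fm.exp fun q => eB _ (FB q)
    let g : (Fin n → E) → ℝ := fun y => ∫ x, F (x, y) ∂(ν 0)
    have gm : Measurable g :=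
      (Fm.stronglyMeasurable.integral_prod_left' (μ := ν 0)).measurable
    have gB : ∀ y, |g y| ≤ B := fun y => by
      have := norm_integral_le_of_norm_le_const (μ := ν 0) (f := fun x => F (x, y)) (C := B)
        (Eventually.of_forall fun x => FB _)
      simpa using this
    have Fyi : ∀ y, Integrable (fun x => F (x, y)) (ν 0) := fun y =>
      integrable_of_measurable_bounded (Fm.comp measurable_prodMk_right) fun x => FB _
    have gd : ∀ y k v, |g (Function.update y k v) - g y| ≤ c := by
      intro y k v
      have e : g (Function.update y k v) - g y =
          ∫ x, (F (x, Function.update y k v) - F (x, y)) ∂(ν 0) :=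
        (integral_sub (Fyi _) (Fyi _)).symm
      have := norm_integral_le_of_norm_le_const (μ := ν 0)
        (f := fun x => F (x, Function.update y k v) - F (x, y)) (C := c)
        (Eventually.of_forall fun x => by
          simp only [F, Real.norm_eq_abs, Fin.cons_update]
          exact hd _ _ _)
      rw [e]
      simpa using this
    have inner : ∀ y, ∫ x, Real.exp (F (x, y)) ∂(ν 0) ≤ Real.exp (g y + c ^ 2 / 2) := fun y =>
      integral_exp_le_of_oscillation (Fm.comp measurable_prodMk_right) hc fun x x' => by
        have := hd (Fin.cons x' y) 0 x
        rwa [Fin.update_cons_zero] at this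
    have h1 : ∫ x, Real.exp (f x) ∂(Measure.pi ν) ≤
        ∫ y, Real.exp (g y) * Real.exp (c ^ 2 / 2) ∂(Measure.pi ν') := by
      rw [tr Real.exp, integral_prod_symm _ eFi]
      refine integral_mono eFi.integral_prod_right ?_ fun y => ?_
      · exact (integrable_of_measurable_bounded gm.exp fun y => eB _ (gB y)).mul_const _
      · simp only [← Real.exp_add]; exact inner y
    have h2 : ∫ x, f x ∂(Measure.pi ν) = ∫ y, g y ∂(Measure.pi ν') := by
      have := tr id
      simp only [id] at this
      rw [this, integral_prod_symm _ Fi]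
    rw [integral_mul_const] at h1
    refine h1.trans ?_
    rw [h2]
    calc _ ≤ Real.exp (∫ y, g y ∂(Measure.pi ν') + n * (c ^ 2 / 2)) * Real.exp (c ^ 2 / 2) := by
          gcongr; exact ih ν' g gm B gB c hc gd
      _ = _ := by rw [← Real.exp_add]; push_cast; ring_nf

/-- A function of independent variables which changes by at most `c` when one of them changes is
sub-Gaussian around its mean. -/
theorem hasSubgaussianMGF_of_boundedDiff {Ω : Type*} [MeasurableSpace Ω] {P : Measure Ω}
    [IsProbabilityMeasure P] {n : ℕ} {X : Fin n → Ω → E} (hX : ∀ k, Measurable (X k))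
    (hi : iIndepFun X P) {f : (Fin n → E) → ℝ} (hf : Measurable f) {B : ℝ} (hB : ∀ x, |f x| ≤ B)
    {c : ℝ} (hc : 0 ≤ c) (hd : ∀ x k y, |f (Function.update x k y) - f x| ≤ c) :
    HasSubgaussianMGF (fun ω => f (fun k => X k ω) - ∫ ω, f (fun k => X k ω) ∂P)
      (n * c.toNNReal ^ 2) P := by
  have Xm : Measurable fun ω => fun k => X k ω := measurable_pi_lambda _ hX
  have : ∀ k, IsProbabilityMeasure (P.map (X k)) := fun k =>
    Measure.isProbabilityMeasure_map (hX k).aemeasurable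
  have hlaw := (iIndepFun_iff_map_fun_eq_pi_map (fun k => (hX k).aemeasurable)).mp hi
  have tr : ∀ g : (Fin n → E) → ℝ, Measurable g → ∫ ω, g (fun k => X k ω) ∂P =
      ∫ x, g x ∂(Measure.pi fun k => P.map (X k)) := fun g hg => by
    rw [← hlaw, integral_map Xm.aemeasurable hg.aestronglyMeasurable]
  set m := ∫ ω, f (fun k => X k ω) ∂P with hm
  constructor
  · intro t
    refine integrable_of_measurable_bounded (B := Real.exp (|t| * (B + |m|)))
      (((hf.comp Xm).sub_const m).const_mul t).exp fun ω => ?_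
    rw [Real.norm_eq_abs, Real.abs_exp]
    refine Real.exp_le_exp.mpr ((le_abs_self _).trans ?_)
    rw [abs_mul]
    refine mul_le_mul_of_nonneg_left ?_ (abs_nonneg t)
    exact (abs_sub _ _).trans (by gcongr; exact hB _)
  · intro t
    have h := integral_exp_le_of_boundedDiff n (fun k => P.map (X k)) (fun x => t * f x)
      (hf.const_mul t) (|t| * B) (fun x => by rw [abs_mul]; gcongr; exact hB x) (|t| * c)
      (by positivity) (fun x k y => by
        rw [← mul_sub, abs_mul]; gcongr; exact hd x k y)
    rw [← tr _ (hf.const_mul t).exp, ← tr _ (hf.const_mul t), integral_const_mul, ← hm] at h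
    rw [mgf]
    simp only [mul_sub, Real.exp_sub]
    rw [integral_div, div_le_iff₀ (Real.exp_pos _), ← Real.exp_add]
    refine h.trans (le_of_eq ?_)
    congr 1
    push_cast
    rw [Real.coe_toNNReal c hc, mul_pow, sq_abs]
    ring

theorem measureReal_abs_ge_le_of_boundedDiff {Ω : Type*} [MeasurableSpace Ω] {P : Measure Ω}
    [IsProbabilityMeasure P] {n : ℕ} {X : Fin n → Ω → E} (hX : ∀ k, Measurable (X k))
    (hi : iIndepFun X P) {f : (Fin n → E) → ℝ} (hf : Measurable f) {B : ℝ} (hB : ∀ x, |f x| ≤ B)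
    {c : ℝ} (hc : 0 ≤ c) (hd : ∀ x k y, |f (Function.update x k y) - f x| ≤ c) {ε : ℝ}
    (hε : 0 ≤ ε) :
    P.real {ω | ε ≤ |f (fun k => X k ω) - ∫ ω, f (fun k => X k ω) ∂P|} ≤
      2 * Real.exp (-ε ^ 2 / (2 * (n * c ^ 2))) := by
  have h := hasSubgaussianMGF_of_boundedDiff hX hi hf hB hc hd
  have h1 := h.measure_ge_le hε
  have h2 := h.neg.measure_ge_le hε
  have e : ((n * c.toNNReal ^ 2 : NNReal) : ℝ) = n * c ^ 2 := by
    push_cast; rw [Real.coe_toNNReal c hc]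
  rw [e] at h1 h2
  set Y := fun ω => f (fun k => X k ω) - ∫ ω, f (fun k => X k ω) ∂P
  have hsub : {ω | ε ≤ |Y ω|} ⊆ {ω | ε ≤ Y ω} ∪ {ω | ε ≤ (-Y) ω} := fun ω hω => by
    rcases le_abs.mp (show ε ≤ |Y ω| from hω) with h | h
    · exact Or.inl h
    · exact Or.inr h
  calc P.real {ω | ε ≤ |Y ω|} ≤ P.real ({ω | ε ≤ Y ω} ∪ {ω | ε ≤ (-Y) ω}) :=
        measureReal_mono hsub
    _ ≤ _ := measureReal_union_le _ _
    _ ≤ _ := by linarith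

end BoundedDifferences

/-! ### The cubic equation of the limit -/

section Cubic

/-- `m` solves the limiting equation at `z`. -/
def IsSol (c : ℝ) (z m : ℂ) : Prop := (1 + z * m) * (1 - c ^ 2 * m ^ 2) + 2 * c * m ^ 2 = 0

/-- The solutions which are boundary values of Stieltjes transforms. -/
structure Admissible (c : ℝ) (z m : ℂ) : Prop where
  sol : IsSol c z m
  im_nonneg : 0 ≤ m.im
  weight_le : c * (‖m / (1 + c * m)‖ ^ 2 + ‖m / (1 - c * m)‖ ^ 2) ≤ 1

variable {c : ℝ} {z m : ℂ}

theorem IsSol.ne_zero (h : IsSol c z m) : m ≠ 0 := by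
  rintro rfl
  simp [IsSol] at h

theorem IsSol.one_add_ne_zero (hc : 0 < c) (h : IsSol c z m) : 1 + c * m ≠ 0 := by
  intro h0
  have h1 : (1 : ℂ) - c ^ 2 * m ^ 2 = 0 := by linear_combination (1 - c * m) * h0
  have h2 : (2 : ℂ) * c * m ^ 2 = 0 := by
    have := h
    rw [IsSol, h1, mul_zero, zero_add] at this
    exact this
  have := h.ne_zero
  simp_all [hc.ne']

theorem IsSol.one_sub_ne_zero (hc : 0 < c) (h : IsSol c z m) : 1 - c * m ≠ 0 := by
  intro h0
  have h1 : (1 : ℂ) - c ^ 2 * m ^ 2 = 0 := by linear_combination (1 + c * m) * h0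
  have h2 : (2 : ℂ) * c * m ^ 2 = 0 := by
    have := h
    rw [IsSol, h1, mul_zero, zero_add] at this
    exact this
  have := h.ne_zero
  simp_all [hc.ne']

/-- Partial fractions express `z` as an explicit function of `m`. Its imaginary part and its divided
difference yield the two identities behind uniqueness. -/
theorem IsSol.eq_sum (hc : 0 < c) (h : IsSol c z m) :
    z = -m⁻¹ + (1 + c * m)⁻¹ - (1 - c * m)⁻¹ := by
  have h0 := h.ne_zero
  have h1 := h.one_add_ne_zero hc
  have h2 := h.one_sub_ne_zero hc
  rw [IsSol] at h
  rw [mul_comm (c : ℂ) m] at h1 h2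
  field_simp
  linear_combination h

/-- The imaginary part of the partial fraction form is `Im z · |m|² = Im m · (1 - c(|m/(1 + c m)|² +
|m/(1 - c m)|²))`. Real `z` is allowed, which later identifies boundary values. -/
theorem IsSol.admissible (hc : 0 < c) (h : IsSol c z m) (hm : 0 < m.im) (hz : 0 ≤ z.im) :
    Admissible c z m := by
  refine ⟨h, hm.le, ?_⟩
  have h0 := h.ne_zero
  have h1 := h.one_add_ne_zero hc
  have h2 := h.one_sub_ne_zero hc
  have hi := congrArg Complex.im (h.eq_sum hc)
  simp only [Complex.add_im, Complex.sub_im, Complex.neg_im, Complex.inv_im,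
    Complex.normSq_eq_norm_sq, Complex.one_im, Complex.mul_im, Complex.ofReal_re,
    Complex.ofReal_im, zero_mul, add_zero, zero_add, zero_sub, neg_neg] at hi
  have p0 : 0 < ‖m‖ ^ 2 := by positivity
  have p1 : 0 < ‖1 + (c : ℂ) * m‖ ^ 2 := by positivity
  have p2 : 0 < ‖1 - (c : ℂ) * m‖ ^ 2 := by positivity
  rw [norm_div, norm_div, div_pow, div_pow]
  set A := ‖m‖ ^ 2
  set B := ‖1 + (c : ℂ) * m‖ ^ 2
  set D := ‖1 - (c : ℂ) * m‖ ^ 2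
  have e : z.im * A = m.im * (1 - c * (A / B + A / D)) := by
    rw [hi]; field_simp; ring
  have hA : 0 ≤ z.im * A := by positivity
  rw [e] at hA
  have := nonneg_of_mul_nonneg_right hA hm
  linarith

/-- Subtract the two partial fraction expressions for the same `z` and cancel `m - m'`. -/
theorem IsSol.sum_eq_of_ne (hc : 0 < c) {m' : ℂ} (h : IsSol c z m) (h' : IsSol c z m')
    (hne : m ≠ m') :
    c * (m / (1 + c * m) * (m' / (1 + c * m')) + m / (1 - c * m) * (m' / (1 - c * m'))) = 1 := by
  have e := (h.eq_sum hc).symm.trans (h'.eq_sum hc)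
  have h0 := h.ne_zero
  have h1 := h.one_add_ne_zero hc
  have h2 := h.one_sub_ne_zero hc
  have h0' := h'.ne_zero
  have h1' := h'.one_add_ne_zero hc
  have h2' := h'.one_sub_ne_zero hc
  have hs : m - m' ≠ 0 := sub_ne_zero.mpr hne
  rw [← mul_right_inj' hs, ← sub_eq_zero]
  have key : (m - m') * (c * (m / (1 + c * m) * (m' / (1 + c * m')) +
      m / (1 - c * m) * (m' / (1 - c * m')))) - (m - m') * 1 =
      -(m * m') * ((-m⁻¹ + (1 + c * m)⁻¹ - (1 - c * m)⁻¹) -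
        (-m'⁻¹ + (1 + c * m')⁻¹ - (1 - c * m')⁻¹)) := by
    rw [mul_comm (c : ℂ) m] at h1 h2
    rw [mul_comm (c : ℂ) m'] at h1' h2'
    field_simp
    ring
  rw [key, e, sub_self, mul_zero]

/-- There is at most one admissible solution. -/
theorem Admissible.unique (hc : 0 < c) {m' : ℂ} (h : Admissible c z m) (h' : Admissible c z m') :
    m = m' := by
  by_contra hne
  have key := h.sol.sum_eq_of_ne hc h'.sol hne
  have h1 := h.sol.one_add_ne_zero hc
  have h1' := h'.sol.one_add_ne_zero hc
  have w := h.weight_le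
  have w' := h'.weight_le
  set p := m / (1 + c * m) with hp
  set q := m / (1 - c * m)
  set p' := m' / (1 + c * m') with hp'
  set q' := m' / (1 - c * m')
  have hk : c * ((p * p').re + (q * q').re) = 1 := by
    have := congrArg Complex.re key
    simpa using this
  have e1 : ‖p' - star p‖ ^ 2 = ‖p‖ ^ 2 + ‖p'‖ ^ 2 - 2 * (p * p').re := by
    simp only [← Complex.normSq_eq_norm_sq, Complex.normSq_apply, Complex.sub_re, Complex.sub_im,
      Complex.mul_re, RCLike.star_def, Complex.conj_re, Complex.conj_im]
    ring
  have e2 : ‖q' - star q‖ ^ 2 = ‖q‖ ^ 2 + ‖q'‖ ^ 2 - 2 * (q * q').re := by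
    simp only [← Complex.normSq_eq_norm_sq, Complex.normSq_apply, Complex.sub_re, Complex.sub_im,
      Complex.mul_re, RCLike.star_def, Complex.conj_re, Complex.conj_im]
    ring
  -- Equality case of Cauchy–Schwarz: the two weights are at most `1` while `c Re(p p' + q q') = 1`,
  -- so `p'` and `q'` are the conjugates of `p` and `q`.
  have hz : c * ‖p' - star p‖ ^ 2 ≤ 0 := by
    have : 0 ≤ c * ‖q' - star q‖ ^ 2 := by positivity
    have : c * ‖p' - star p‖ ^ 2 + c * ‖q' - star q‖ ^ 2 ≤ 0 := by
      rw [e1, e2]; linarith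
    linarith
  have hpp : p' = star p := by
    have : ‖p' - star p‖ ^ 2 ≤ 0 := nonpos_of_mul_nonpos_right hz hc
    have : ‖p' - star p‖ = 0 := by
      have := sq_nonneg ‖p' - star p‖
      exact pow_eq_zero_iff two_ne_zero |>.mp (le_antisymm ‹_› this)
    exact sub_eq_zero.mp (norm_eq_zero.mp this)
  have hpi : 1 - c * p = (1 + c * m)⁻¹ := by
    refine eq_inv_of_mul_eq_one_left ?_
    rw [hp, ← mul_div_assoc, sub_mul, div_mul_cancel₀ _ h1]
    ring
  have hpi' : 1 - c * p' = (1 + c * m')⁻¹ := by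
    refine eq_inv_of_mul_eq_one_left ?_
    rw [hp', ← mul_div_assoc, sub_mul, div_mul_cancel₀ _ h1']
    ring
  have hm : m * (1 - c * p) = p := by rw [hpi, hp, div_eq_mul_inv]
  have hm' : m' * (1 - c * p') = p' := by rw [hpi', hp', div_eq_mul_inv]
  have h1p : 1 - c * p' ≠ 0 := by
    rw [hpi']; exact inv_ne_zero h1'
  -- The map `m ↦ m / (1 + c m)` is injective, so conjugate images come from conjugate roots; since
  -- both imaginary parts are nonnegative, the roots are real and equal.
  have hmm : m' = star m := by
    have e := congrArg star hm
    simp only [star_mul', star_sub, star_one, ← hpp] at e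
    have hcs : star (c : ℂ) = c := by simp
    rw [hcs] at e
    exact mul_right_cancel₀ h1p (hm'.trans e.symm)
  have i1 := h.im_nonneg
  have i2 := h'.im_nonneg
  rw [hmm] at i2
  simp only [RCLike.star_def, Complex.conj_im] at i2
  have i3 : m.im = 0 := by linarith
  apply hne
  rw [hmm]
  exact (Complex.conj_eq_iff_im.mpr i3).symm

theorem IsSol.im_ne_zero (hc : 0 < c) (h : IsSol c z m) (hz : z.im ≠ 0) : m.im ≠ 0 := by
  intro h0
  have h1 := h.one_add_ne_zero hc
  have h2 := h.one_sub_ne_zero hc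
  have h3 := h.ne_zero
  have hm : m = (m.re : ℂ) := by apply Complex.ext <;> simp [h0]
  rw [hm] at h1 h2 h3
  have h1r : 1 + c * m.re ≠ 0 := by exact_mod_cast h1
  have h2r : 1 - c * m.re ≠ 0 := by exact_mod_cast h2
  have h3r : m.re ≠ 0 := by exact_mod_cast h3
  have hi := congrArg Complex.im h
  rw [hm] at hi
  have e : ((1 + z * (m.re : ℂ)) * (1 - (c : ℂ) ^ 2 * (m.re : ℂ) ^ 2) +
      2 * (c : ℂ) * (m.re : ℂ) ^ 2) = (1 + z * (m.re : ℂ)) * ((1 - c ^ 2 * m.re ^ 2 : ℝ) : ℂ) +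
      ((2 * c * m.re ^ 2 : ℝ) : ℂ) := by push_cast; ring
  have hi' : z.im * m.re * (1 - c ^ 2 * m.re ^ 2) = 0 := by
    rw [e] at hi
    simpa only [Complex.add_im, Complex.im_mul_ofReal, Complex.one_im, Complex.ofReal_im,
      Complex.zero_im, zero_add, add_zero] using hi
  rcases mul_eq_zero.mp hi' with hi | hi
  · exact mul_ne_zero hz h3r hi
  · exact mul_ne_zero h1r h2r (by linear_combination hi)

theorem IsSol.admissible_of_im_pos (hc : 0 < c) (h : IsSol c z m) (hz : 0 < z.im)
    (hm : 0 ≤ m.im) : Admissible c z m :=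
  h.admissible hc (lt_of_le_of_ne hm (h.im_ne_zero hc hz.ne').symm) hz.le

/-- For `‖m‖ > 1` the leading term `c² z m³` is dominated by the quadratic scale. The bound
degenerates as `z → 0`, which is why `0` is treated separately. -/
theorem IsSol.norm_le (hc : 0 < c) (h : IsSol c z m) (hz : z ≠ 0) :
    ‖m‖ ≤ 1 + (|c ^ 2 - 2 * c| + ‖z‖ + 1) / (c ^ 2 * ‖z‖) := by
  have hzn : 0 < ‖z‖ := norm_pos_iff.mpr hz
  by_cases h1 : ‖m‖ ≤ 1
  · have : 0 ≤ (|c ^ 2 - 2 * c| + ‖z‖ + 1) / (c ^ 2 * ‖z‖) := by positivity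
    linarith
  · rw [not_le] at h1
    have e : c ^ 2 * z * m ^ 3 = -((c ^ 2 - 2 * c : ℝ) : ℂ) * m ^ 2 + z * m + 1 := by
      rw [IsSol] at h; push_cast; linear_combination -h
    have hn := congrArg norm e
    rw [norm_mul, norm_mul, norm_pow, norm_pow, Complex.norm_real, Real.norm_eq_abs, sq_abs] at hn
    have h2 : ‖-((c ^ 2 - 2 * c : ℝ) : ℂ) * m ^ 2 + z * m + 1‖ ≤
        |c ^ 2 - 2 * c| * ‖m‖ ^ 2 + ‖z‖ * ‖m‖ + 1 := by
      refine (norm_add₃_le).trans ?_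
      rw [norm_mul, norm_neg, norm_pow, norm_mul, Complex.norm_real, Real.norm_eq_abs, norm_one]
    rw [← hn] at h2
    have h3 : c ^ 2 * ‖z‖ * ‖m‖ * ‖m‖ ^ 2 ≤ (|c ^ 2 - 2 * c| + ‖z‖ + 1) * ‖m‖ ^ 2 := by
      have : ‖m‖ ≤ ‖m‖ ^ 2 := by nlinarith
      nlinarith
    have h4 : c ^ 2 * ‖z‖ * ‖m‖ ≤ |c ^ 2 - 2 * c| + ‖z‖ + 1 :=
      le_of_mul_le_mul_right h3 (by positivity)
    have h5 : ‖m‖ ≤ (|c ^ 2 - 2 * c| + ‖z‖ + 1) / (c ^ 2 * ‖z‖) := by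
      rw [le_div_iff₀ (by positivity)]; linarith
    linarith

/-- Since `|1 ± c m| ≤ 1 + c|m|`, the weight inequality alone gives `2c|m|² ≤ (1 + c|m|)²`. This
bounds `m`, uniformly in `z`, because `√(2c) > c` for `c < 2`. -/
theorem Admissible.norm_le_of_lt_two (hc : 0 < c) (hc2 : c < 2) (h : Admissible c z m) :
    ‖m‖ ≤ 1 / (√(2 * c) - c) := by
  have h1 := h.sol.one_add_ne_zero hc
  have h2 := h.sol.one_sub_ne_zero hc
  have hlt : c < √(2 * c) := Real.lt_sqrt_of_sq_lt (by nlinarith)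
  have n1 : ‖1 + c * m‖ ≤ 1 + c * ‖m‖ := by
    refine (norm_add_le _ _).trans (le_of_eq ?_)
    simp [abs_of_pos hc]
  have n2 : ‖1 - c * m‖ ≤ 1 + c * ‖m‖ := by
    refine (norm_sub_le _ _).trans (le_of_eq ?_)
    simp [abs_of_pos hc]
  have w := h.weight_le
  rw [norm_div, norm_div] at w
  have b1 : ‖m‖ / (1 + c * ‖m‖) ≤ ‖m‖ / ‖1 + c * m‖ := by gcongr
  have b2 : ‖m‖ / (1 + c * ‖m‖) ≤ ‖m‖ / ‖1 - c * m‖ := by gcongr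
  have w2 : 2 * c * (‖m‖ / (1 + c * ‖m‖)) ^ 2 ≤ 1 := by
    have := pow_le_pow_left₀ (by positivity) b1 2
    have := pow_le_pow_left₀ (by positivity) b2 2
    nlinarith
  rw [div_pow, ← mul_div_assoc, div_le_one (by positivity)] at w2
  have w3 : √(2 * c) * ‖m‖ ≤ 1 + c * ‖m‖ := by
    refine le_of_sq_le_sq ?_ (by positivity)
    rw [mul_pow, Real.sq_sqrt (by positivity)]
    exact w2
  rw [le_div_iff₀ (by linarith)]
  linarith

/-- Bounded values have limits along ultrafilters, admissibility is a closed condition, and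
uniqueness makes all these limits equal. No root is followed analytically. -/
theorem Admissible.tendsto (hc : 0 < c) {α : Type*} {F : Filter α} [F.NeBot] {u s : α → ℂ} {z₀ : ℂ}
    (h : ∀ᶠ a in F, Admissible c (u a) (s a)) (hu : Tendsto u F (𝓝 z₀)) {K : ℝ}
    (hK : ∀ᶠ a in F, ‖s a‖ ≤ K) : ∃ m₀, Admissible c z₀ m₀ ∧ Tendsto s F (𝓝 m₀) := by
  have key : ∀ U : Ultrafilter α, (U : Filter α) ≤ F →
      ∃ m₀, Admissible c z₀ m₀ ∧ Tendsto s U (𝓝 m₀) := by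
    intro U hU
    have hb : ∀ᶠ a in (U : Filter α), s a ∈ Metric.closedBall (0 : ℂ) K :=
      (hK.filter_mono hU).mono fun a ha => by simpa using ha
    obtain ⟨m₀, -, hm₀⟩ := (isCompact_closedBall (0 : ℂ) K).ultrafilter_le_nhds (U.map s)
      (by rw [le_principal_iff]; exact hb)
    have hs : Tendsto s U (𝓝 m₀) := hm₀
    have huU : Tendsto u U (𝓝 z₀) := hu.mono_left hU
    have hadm : ∀ᶠ a in (U : Filter α), Admissible c (u a) (s a) := h.filter_mono hU
    have hsol : IsSol c z₀ m₀ := by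
      have ht : Tendsto (fun a => (1 + u a * s a) * (1 - (c : ℂ) ^ 2 * (s a) ^ 2) +
          2 * c * (s a) ^ 2) U (𝓝 ((1 + z₀ * m₀) * (1 - (c : ℂ) ^ 2 * m₀ ^ 2) + 2 * c * m₀ ^ 2)) :=
        ((tendsto_const_nhds.add (huU.mul hs)).mul
          (tendsto_const_nhds.sub (tendsto_const_nhds.mul (hs.pow 2)))).add
          (tendsto_const_nhds.mul (hs.pow 2))
      exact tendsto_nhds_unique (ht.congr' (hadm.mono fun a ha => ha.sol)) tendsto_const_nhds
    refine ⟨m₀, ⟨hsol, ?_, ?_⟩, hs⟩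
    · exact ge_of_tendsto ((Complex.continuous_im.tendsto _).comp hs)
        (hadm.mono fun a ha => ha.im_nonneg)
    · have h1 := hsol.one_add_ne_zero hc
      have h2 := hsol.one_sub_ne_zero hc
      have ht : Tendsto (fun a => c * (‖s a / (1 + c * s a)‖ ^ 2 + ‖s a / (1 - c * s a)‖ ^ 2)) U
          (𝓝 (c * (‖m₀ / (1 + c * m₀)‖ ^ 2 + ‖m₀ / (1 - c * m₀)‖ ^ 2))) :=
        tendsto_const_nhds.mul
          (((hs.div (tendsto_const_nhds.add (tendsto_const_nhds.mul hs)) h1).norm.pow 2).add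
          ((hs.div (tendsto_const_nhds.sub (tendsto_const_nhds.mul hs)) h2).norm.pow 2))
      exact le_of_tendsto ht (hadm.mono fun a ha => ha.weight_le)
  obtain ⟨m₀, hm₀, -⟩ := key (Ultrafilter.of F) (Ultrafilter.of_le F)
  refine ⟨m₀, hm₀, ?_⟩
  rw [tendsto_iff_ultrafilter]
  intro U hU
  obtain ⟨m₁, hm₁, ht⟩ := key U hU
  rw [hm₀.unique hc hm₁]
  exact ht

/-- The admissible solution at `z`. -/
def limitTransform (c : ℝ) (z : ℂ) : ℂ := by
  classical exact if h : ∃ m, Admissible c z m then h.choose else 0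

theorem Admissible.eq_limitTransform (hc : 0 < c) (h : Admissible c z m) :
    limitTransform c z = m := by
  have he : ∃ m, Admissible c z m := ⟨m, h⟩
  rw [limitTransform, dif_pos he]
  exact he.choose_spec.unique hc h

theorem admissible_limitTransform (h : ∃ m, Admissible c z m) :
    Admissible c z (limitTransform c z) := by
  rw [limitTransform, dif_pos h]
  exact h.choose_spec

/-- Solutions of nearby equations converge to the admissible solution. -/
theorem tendsto_of_approx_sol (hc : 0 < c) (hz : 0 < z.im) {s : ℕ → ℂ} {y : ℕ → ℝ}
    (hy : Tendsto y atTop (𝓝 c)) {K : ℝ} (hK : ∀ n, ‖s n‖ ≤ K) (him : ∀ n, 0 ≤ (s n).im)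
    (h : Tendsto (fun n => (1 + z * s n) * (1 - (y n : ℂ) ^ 2 * s n ^ 2) + 2 * y n * s n ^ 2)
      atTop (𝓝 0)) :
    Admissible c z (limitTransform c z) ∧ Tendsto s atTop (𝓝 (limitTransform c z)) := by
  have key : ∀ U : Ultrafilter ℕ, (U : Filter ℕ) ≤ atTop →
      ∃ m₀, Admissible c z m₀ ∧ Tendsto s U (𝓝 m₀) := by
    intro U hU
    obtain ⟨m₀, -, hm₀⟩ := (isCompact_closedBall (0 : ℂ) K).ultrafilter_le_nhds (U.map s)
      (by
        rw [le_principal_iff]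
        exact Eventually.of_forall (p := fun n => s n ∈ Metric.closedBall (0 : ℂ) K)
          fun n => by simpa using hK n)
    have hs : Tendsto s U (𝓝 m₀) := hm₀
    have hyU : Tendsto (fun n => (y n : ℂ)) U (𝓝 (c : ℂ)) :=
      ((Complex.continuous_ofReal.tendsto c).comp hy).mono_left hU
    have hsol : IsSol c z m₀ := by
      have ht : Tendsto (fun n => (1 + z * s n) * (1 - (y n : ℂ) ^ 2 * s n ^ 2) +
          2 * y n * s n ^ 2) U
          (𝓝 ((1 + z * m₀) * (1 - (c : ℂ) ^ 2 * m₀ ^ 2) + 2 * c * m₀ ^ 2)) :=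
        ((tendsto_const_nhds.add (tendsto_const_nhds.mul hs)).mul
          (tendsto_const_nhds.sub ((hyU.pow 2).mul (hs.pow 2)))).add
          ((tendsto_const_nhds.mul hyU).mul (hs.pow 2))
      exact tendsto_nhds_unique ht (h.mono_left hU)
    -- Because `Im z > 0`, a root with `Im m₀ ≥ 0` cannot be real, so the weight inequality comes
    -- for free.
    exact ⟨m₀, hsol.admissible_of_im_pos hc hz (ge_of_tendsto
      ((Complex.continuous_im.tendsto _).comp hs) (Eventually.of_forall him)), hs⟩
  obtain ⟨m₀, hm₀, -⟩ := key (Ultrafilter.of atTop) (Ultrafilter.of_le _)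
  refine ⟨admissible_limitTransform ⟨m₀, hm₀⟩, ?_⟩
  rw [tendsto_iff_ultrafilter]
  intro U hU
  obtain ⟨m₁, hm₁, ht⟩ := key U hU
  rw [hm₁.eq_limitTransform hc]
  exact ht

/-- The symmetry of the limit. -/
theorem Admissible.neg_star (h : Admissible c z m) : Admissible c (-star z) (-star m) := by
  have hcs : star (c : ℂ) = c := by simp
  refine ⟨?_, ?_, ?_⟩
  · have := congrArg star h.sol
    simp only [star_add, star_mul', star_sub, star_one, star_pow, hcs, star_zero] at this
    have h2 : star (2 : ℂ) = 2 := by simp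
    rw [h2] at this
    rw [IsSol]
    linear_combination this
  · simpa using h.im_nonneg
  · have e1 : -star m / (1 + c * -star m) = star (-(m / (1 - c * m))) := by
      simp [hcs]; ring
    have e2 : -star m / (1 - c * -star m) = star (-(m / (1 + c * m))) := by
      simp [hcs]; ring
    rw [e1, e2, norm_star, norm_star, norm_neg, norm_neg]
    linarith [h.weight_le]

/-- Points of the imaginary axis are fixed by `z ↦ -star z`, so by uniqueness the solution is fixed
as well. -/
theorem Admissible.re_eq_zero (hc : 0 < c) {t : ℝ} (h : Admissible c (Complex.I * t) m) :
    m.re = 0 := by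
  have h1 := h.neg_star
  have e : -star (Complex.I * t) = Complex.I * t := by simp
  rw [e] at h1
  have := congrArg Complex.re (h.unique hc h1)
  simp at this
  linarith

/-- On the imaginary axis the cubic becomes real. It serves for `t → ∞` (tightness), for `t = 0`
(the density at the origin) and for `t ↓ 0` with `c ≥ 2` (failure of differentiability). -/
theorem Admissible.imaginary_eq (hc : 0 < c) {t : ℝ} (h : Admissible c (Complex.I * t) m) :
    1 + (c ^ 2 - 2 * c) * m.im ^ 2 = t * m.im * (1 + c ^ 2 * m.im ^ 2) := by
  have h0 := h.re_eq_zero hc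
  have hm : m = Complex.I * m.im := by apply Complex.ext <;> simp [h0]
  have hs := h.sol
  rw [IsSol, hm] at hs
  have e : (1 + Complex.I * (t : ℂ) * (Complex.I * m.im)) * (1 - (c : ℂ) ^ 2 * (Complex.I * m.im) ^ 2)
      + 2 * c * (Complex.I * m.im) ^ 2 =
      (((1 - t * m.im) * (1 + c ^ 2 * m.im ^ 2) - 2 * c * m.im ^ 2 : ℝ) : ℂ) := by
    push_cast
    ring_nf
    rw [Complex.I_sq, Complex.I_pow_four]
    ring
  rw [e] at hs
  have hr : (1 - t * m.im) * (1 + c ^ 2 * m.im ^ 2) - 2 * c * m.im ^ 2 = 0 := by exact_mod_cast hs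
  linear_combination hr

theorem Admissible.im_at_zero (hc : 0 < c) (hc2 : c < 2) (h : Admissible c 0 m) :
    m.im = 1 / √(2 * c - c ^ 2) := by
  have h' : Admissible c (Complex.I * (0 : ℝ)) m := by simpa using h
  have e := h'.imaginary_eq hc
  have hp : 0 < 2 * c - c ^ 2 := by nlinarith
  have e2 : (m.im * √(2 * c - c ^ 2)) ^ 2 = 1 := by
    rw [mul_pow, Real.sq_sqrt hp.le]; linear_combination -e
  have hn : 0 ≤ m.im * √(2 * c - c ^ 2) := mul_nonneg h.im_nonneg (Real.sqrt_nonneg _)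
  have e3 : m.im * √(2 * c - c ^ 2) = 1 := by nlinarith
  rw [eq_div_iff (Real.sqrt_pos.mpr hp).ne', e3]

end Cubic

/-! ### The explicit density -/

section Density

variable {c x : ℝ}

/-- The radicand is a perfect cube in `4c + 1` over a square, hence positive: the two edges `R₋` and
`R₊` are real and distinct for every `c > 0`. -/
theorem discriminant_eq (hc : 0 < c) :
    √(d2 c ^ 2 - 4 * d0 c * d4 c) = √((4 * c + 1) ^ 3) / (27 * c ^ 6) := by
  have : d2 c ^ 2 - 4 * d0 c * d4 c = (4 * c + 1) ^ 3 / (27 * c ^ 6) ^ 2 := by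
    unfold d2 d0 d4; field_simp; ring
  rw [this, Real.sqrt_div' _ (by positivity), Real.sqrt_sq (by positivity)]

theorem Rplus_eq (hc : 0 < c) : Rplus c = (2 * c ^ 2 + 10 * c - 1 + √((4 * c + 1) ^ 3)) / 2 := by
  rw [Rplus, discriminant_eq hc, d2, d0]; field_simp

theorem Rminus_eq (hc : 0 < c) : Rminus c = (2 * c ^ 2 + 10 * c - 1 - √((4 * c + 1) ^ 3)) / 2 := by
  rw [Rminus, discriminant_eq hc, d2, d0]; field_simp

theorem d_eq (hc : 0 < c) (hx : x ≠ 0) :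
    d c x = (x ^ 2 - Rminus c) * (x ^ 2 - Rplus c) / (27 * c ^ 6 * x ^ 4) := by
  rw [Rplus_eq hc, Rminus_eq hc]
  have hS : √((4 * c + 1) ^ 3) ^ 2 = (4 * c + 1) ^ 3 := Real.sq_sqrt (by positivity)
  have e : (x ^ 2 - (2 * c ^ 2 + 10 * c - 1 - √((4 * c + 1) ^ 3)) / 2) *
      (x ^ 2 - (2 * c ^ 2 + 10 * c - 1 + √((4 * c + 1) ^ 3)) / 2) =
      x ^ 4 - (2 * c ^ 2 + 10 * c - 1) * x ^ 2 + c * (c - 2) ^ 3 := by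
    linear_combination -(1 / 4 : ℝ) * hS
  rw [e, d, d0, d2, d4]
  field_simp

theorem Rminus_lt_Rplus (hc : 0 < c) : Rminus c < Rplus c := by
  rw [Rplus_eq hc, Rminus_eq hc]
  have : 0 < √((4 * c + 1) ^ 3) := Real.sqrt_pos.mpr (by positivity)
  linarith

theorem mem_supportSet_iff (hc : 0 < c) (hx : x ≠ 0) : x ∈ supportSet c ↔ d c x < 0 := by
  -- Positivity of `x²` makes the truncation of `Rminus c` at `0` in `lowerEdge` harmless.
  have hx2 : 0 < x ^ 2 := by positivity
  have hL : lowerEdge c < |x| ↔ Rminus c < x ^ 2 := by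
    rw [lowerEdge, Real.sqrt_lt' (abs_pos.mpr hx), sq_abs, max_lt_iff]
    exact and_iff_left hx2
  have hU : |x| < upperEdge c ↔ x ^ 2 < Rplus c := by
    rw [upperEdge, Real.lt_sqrt (abs_nonneg x), sq_abs]
  have hL0 : 0 ≤ lowerEdge c := Real.sqrt_nonneg _
  have h1 : x ∈ supportSet c ↔ lowerEdge c < |x| ∧ |x| < upperEdge c := by
    rw [supportSet, Set.mem_union, Set.mem_Ioo, Set.mem_Ioo]
    rcases lt_or_gt_of_ne hx with h | h
    · rw [abs_of_neg h]
      constructor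
      · rintro (⟨a, b⟩ | ⟨a, b⟩)
        · constructor <;> linarith
        · linarith
      · rintro ⟨a, b⟩
        left; constructor <;> linarith
    · rw [abs_of_pos h]
      constructor
      · rintro (⟨a, b⟩ | ⟨a, b⟩)
        · linarith
        · exact ⟨a, b⟩
      · exact fun h => Or.inr h
  rw [h1, hL, hU, d_eq hc hx, div_neg_iff]
  have hp : 0 < 27 * c ^ 6 * x ^ 4 := by positivity
  have hlt := Rminus_lt_Rplus hc
  constructor
  · rintro ⟨a, b⟩
    right
    exact ⟨mul_neg_of_pos_of_neg (by linarith) (by linarith), hp⟩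
  · rintro (⟨_, b⟩ | ⟨a, _⟩)
    · linarith
    · rcases mul_neg_iff.mp a with ⟨h1, h2⟩ | ⟨h1, h2⟩
      · constructor <;> linarith
      · linarith

/-- The constant term of the depressed cubic. -/
def depQ (c x : ℝ) : ℝ := 2 * (c - 2) ^ 3 / (27 * c ^ 3 * x ^ 3) - 2 * (c + 1) / (3 * c ^ 3 * x)

/-- Minus one third of the linear coefficient of the depressed cubic. -/
def depP (c x : ℝ) : ℝ := 1 / (3 * c ^ 2) + ((c - 2) / (3 * c * x)) ^ 2

/-- On the imaginary axis `R` is purely imaginary, equal to `-i` times half the constant term of the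
depressed cubic. -/
theorem norm_r (hc : 0 < c) (hx : x ≠ 0) : ‖r c x‖ = |depQ c x| / 2 := by
  have hxc : (x : ℂ) ≠ 0 := by exact_mod_cast hx
  have hcc : (c : ℂ) ≠ 0 := by exact_mod_cast hc.ne'
  have e : r c x = -Complex.I * ((depQ c x / 2 : ℝ) : ℂ) := by
    have hI := Complex.I_ne_zero
    have hI2 := Complex.I_sq
    rw [r, R, r1, r3, depQ]
    push_cast
    field_simp
    have h3 : Complex.I ^ 3 = -Complex.I := Complex.I_pow_three
    have h4 : Complex.I ^ 4 = 1 := Complex.I_pow_four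
    ring_nf
    simp only [hI2, h4]
    ring
  rw [e, norm_mul, norm_neg, Complex.norm_I, one_mul, Complex.norm_real, Real.norm_eq_abs, abs_div,
    abs_two]

/-- Thus `-d` is the quantity under the square root in Cardano's formula, and `d < 0` means a pair
of nonreal roots. -/
theorem d_eq_dep (hc : 0 < c) (hx : x ≠ 0) : d c x = depP c x ^ 3 - (depQ c x / 2) ^ 2 := by
  rw [d, d0, d2, d4, depP, depQ]
  field_simp
  ring

/-- The real shift by `(c - 2)/(3 c x)` removes the quadratic term and leaves imaginary parts
unchanged. -/
theorem isSol_iff_depressed (hc : 0 < c) (hx : x ≠ 0) (w : ℂ) :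
    IsSol c x (w - ((c - 2) / (3 * c * x) : ℝ)) ↔
      w ^ 3 - 3 * depP c x * w + depQ c x = 0 := by
  have hxc : (x : ℂ) ≠ 0 := by exact_mod_cast hx
  have hcc : (c : ℂ) ≠ 0 := by exact_mod_cast hc.ne'
  have e : (1 + x * (w - ((c - 2) / (3 * c * x) : ℝ))) *
      (1 - (c : ℂ) ^ 2 * (w - ((c - 2) / (3 * c * x) : ℝ)) ^ 2) +
      2 * c * (w - ((c - 2) / (3 * c * x) : ℝ)) ^ 2 =
      -(c ^ 2 * x) * (w ^ 3 - 3 * depP c x * w + depQ c x) := by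
    rw [depP, depQ]
    push_cast
    field_simp
    ring
  rw [IsSol, e]
  have : -((c : ℂ) ^ 2 * x) ≠ 0 := neg_ne_zero.mpr (mul_ne_zero (pow_ne_zero 2 hcc) hxc)
  rw [mul_eq_zero, or_iff_right this]

/-- Where `d < 0`, Cardano's formula exhibits a root with imaginary part `(√3/2)(u - v) > 0`, where
`u³ = V₊` and `v³ = V₋`. Such a root is admissible, hence equal to `m`. Elsewhere, a nonreal `m`
would force `d < 0`. -/
theorem Admissible.im_eq_density (hc : 0 < c) (hx : x ≠ 0) {m : ℂ} (h : Admissible c x m) :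
    m.im = Real.pi * density c x := by
  have hd := d_eq_dep hc hx
  have hP : 0 < depP c x := by
    rw [depP]
    positivity
  by_cases hm : x ∈ supportSet c
  · have hneg := (mem_supportSet_iff hc hx).mp hm
    have hr := norm_r hc hx
    set q := depP c x
    set Q := depQ c x
    set s := √(-d c x) with hs
    have hs2 : s ^ 2 = -d c x := Real.sq_sqrt (by linarith)
    have hspos : 0 < s := Real.sqrt_pos.mpr (by linarith)
    have hVp : Vplus c x = |Q| / 2 + s := by rw [Vplus, hr]
    have hVm : Vminus c x = |Q| / 2 - s := by rw [Vminus, hr]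
    have hprod : Vplus c x * Vminus c x = q ^ 3 := by
      rw [hVp, hVm]
      have := sq_abs Q
      nlinarith
    have hVppos : 0 < Vplus c x := by rw [hVp]; positivity
    have hVmpos : 0 < Vminus c x := by
      have : 0 < Vplus c x * Vminus c x := by rw [hprod]; positivity
      exact (mul_pos_iff_of_pos_left hVppos).mp this
    set u := Vplus c x ^ (1 / 3 : ℝ) with hu
    set v := Vminus c x ^ (1 / 3 : ℝ) with hv
    have hupos : 0 < u := Real.rpow_pos_of_pos hVppos _
    have hvpos : 0 < v := Real.rpow_pos_of_pos hVmpos _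
    have cube : ∀ y : ℝ, 0 < y → (y ^ (1 / 3 : ℝ)) ^ 3 = y := fun y hy => by
      rw [← Real.rpow_natCast, ← Real.rpow_mul hy.le]; norm_num
    have hu3 : u ^ 3 = Vplus c x := cube _ hVppos
    have hv3 : v ^ 3 = Vminus c x := cube _ hVmpos
    have huv : u * v = q := by
      have : (u * v) ^ 3 = q ^ 3 := by rw [mul_pow, hu3, hv3, hprod]
      exact (pow_left_inj₀ (by positivity) hP.le three_ne_zero).mp this
    have hlt : v < u := by
      refine Real.rpow_lt_rpow hVmpos.le ?_ (by norm_num)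
      rw [hVp, hVm]; linarith
    -- The sign `σ` of `Q` undoes the absolute value hidden in `V₊` and `V₋`.
    obtain ⟨σ, hσ, hQσ⟩ : ∃ σ : ℝ, σ ^ 2 = 1 ∧ Q = σ * (u ^ 3 + v ^ 3) := by
      have e : u ^ 3 + v ^ 3 = |Q| := by rw [hu3, hv3, hVp, hVm]; ring
      rw [e]
      rcases abs_cases Q with ⟨h, _⟩ | ⟨h, _⟩
      · exact ⟨1, by norm_num, by rw [h]; ring⟩
      · exact ⟨-1, by norm_num, by rw [h]; ring⟩
    set w : ℂ := ((σ * (u + v) / 2 : ℝ) : ℂ) + Complex.I * ((√3 / 2 * (u - v) : ℝ) : ℂ) with hw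
    have h3 : (√3) ^ 2 = 3 := Real.sq_sqrt (by norm_num)
    have hroot : w ^ 3 - 3 * q * w + Q = 0 := by
      have re0 : (σ * (u + v) / 2) ^ 3 - 3 * (σ * (u + v) / 2) * (√3 / 2 * (u - v)) ^ 2
          - 3 * q * (σ * (u + v) / 2) + Q = 0 := by
        rw [hQσ, ← huv]
        linear_combination (σ * (u + v) ^ 3 / 8) * hσ - (3 * σ * (u + v) * (u - v) ^ 2 / 8) * h3
      have im0 : 3 * (σ * (u + v) / 2) ^ 2 * (√3 / 2 * (u - v)) - (√3 / 2 * (u - v)) ^ 3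
          - 3 * q * (√3 / 2 * (u - v)) = 0 := by
        rw [← huv]
        linear_combination (3 * √3 * (u + v) ^ 2 * (u - v) / 8) * hσ - (√3 * (u - v) ^ 3 / 8) * h3
      have e : ∀ A B : ℝ, ((A : ℂ) + Complex.I * B) ^ 3 - 3 * q * ((A : ℂ) + Complex.I * B) + Q =
          ((A ^ 3 - 3 * A * B ^ 2 - 3 * q * A + Q : ℝ) : ℂ) +
          Complex.I * ((3 * A ^ 2 * B - B ^ 3 - 3 * q * B : ℝ) : ℂ) := by
        intro A B
        push_cast
        linear_combination (3 * (A : ℂ) * B ^ 2 + Complex.I * B ^ 3) * Complex.I_sq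
      rw [hw, e, re0, im0]
      simp
    have hsol := (isSol_iff_depressed hc hx w).mpr hroot
    have him : (w - (((c - 2) / (3 * c * x) : ℝ) : ℂ)).im = √3 / 2 * (u - v) := by
      rw [Complex.sub_im, Complex.ofReal_im, hw, Complex.add_im, Complex.ofReal_im,
        Complex.mul_im, Complex.I_re, Complex.I_im, Complex.ofReal_re, Complex.ofReal_im]
      ring
    have hadm := hsol.admissible hc (by rw [him]; have := sub_pos.mpr hlt; positivity)
      (by simp)
    rw [h.unique hc hadm, him, density, Set.indicator_of_mem hm, ← hu, ← hv]
    have := Real.pi_pos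
    field_simp
  · rw [density, Set.indicator_of_notMem hm, mul_zero]
    by_contra hne
    apply hm
    rw [mem_supportSet_iff hc hx, hd]
    set q := depP c x
    set Q := depQ c x
    set w := m + (((c - 2) / (3 * c * x) : ℝ) : ℂ) with hw
    have hroot : w ^ 3 - 3 * q * w + Q = 0 := by
      refine (isSol_iff_depressed hc hx w).mp ?_
      rw [hw, add_sub_cancel_right]; exact h.sol
    have him : w.im = m.im := by rw [hw, Complex.add_im, Complex.ofReal_im, add_zero]
    have hb : w.im ≠ 0 := by rw [him]; exact hne
    have hre := congrArg Complex.re hroot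
    have him' := congrArg Complex.im hroot
    simp only [pow_succ, pow_zero, one_mul, Complex.add_re, Complex.add_im, Complex.sub_re,
      Complex.sub_im, Complex.mul_re, Complex.mul_im, Complex.ofReal_re, Complex.ofReal_im,
      Complex.zero_re, Complex.zero_im] at hre him'
    norm_num at hre him'
    set a := w.re
    set b := w.im
    have hq : 3 * q = 3 * a ^ 2 - b ^ 2 := by
      have : b * (3 * q - (3 * a ^ 2 - b ^ 2)) = 0 := by linear_combination -him'
      rcases mul_eq_zero.mp this with h | h
      · exact absurd h hb
      · linarith
    have hQ : Q = 2 * a * (a ^ 2 + b ^ 2) := by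
      linear_combination hre + a * hq
    have hq' : q = a ^ 2 - b ^ 2 / 3 := by linarith
    -- The real and imaginary parts of the cubic at `a + i b`, `b ≠ 0`, determine `q` and `Q`, and
    -- with them `d` becomes minus a positive expression.
    have : q ^ 3 - (Q / 2) ^ 2 = -(b ^ 2 * (9 * a ^ 2 + b ^ 2) ^ 2 / 27) := by
      rw [hQ, hq']; ring
    rw [this]
    have : 0 < b ^ 2 * (9 * a ^ 2 + b ^ 2) ^ 2 / 27 := by positivity
    linarith

end Density

/-! ### Stieltjes transforms -/

section Stieltjes

/-- The Stieltjes transform of a measure on the line. -/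
def stieltjesTransform (μ : Measure ℝ) (z : ℂ) : ℂ := ∫ x : ℝ, ((x : ℂ) - z)⁻¹ ∂μ

variable {z : ℂ}

theorem ofReal_sub_ne_zero (hz : 0 < z.im) (x : ℝ) : (x : ℂ) - z ≠ 0 := fun h => by
  have := congrArg Complex.im h
  simp at this; exact hz.ne' this

theorem continuous_kernel (hz : 0 < z.im) : Continuous fun x : ℝ => ((x : ℂ) - z)⁻¹ :=
  (Complex.continuous_ofReal.sub continuous_const).inv₀ (ofReal_sub_ne_zero hz)

theorem norm_kernel_le (hz : 0 < z.im) (x : ℝ) : ‖((x : ℂ) - z)⁻¹‖ ≤ 1 / z.im := by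
  rw [norm_inv, ← one_div]
  refine one_div_le_one_div_of_le hz ?_
  have := Complex.abs_im_le_norm ((x : ℂ) - z)
  simpa [abs_of_pos hz] using this

theorem im_kernel (z : ℂ) (x : ℝ) :
    (((x : ℂ) - z)⁻¹).im = z.im / ((x - z.re) ^ 2 + z.im ^ 2) := by
  rw [Complex.inv_im, Complex.normSq_apply]
  simp
  ring

theorem integrable_kernel (μ : Measure ℝ) [IsFiniteMeasure μ] (hz : 0 < z.im) :
    Integrable (fun x : ℝ => ((x : ℂ) - z)⁻¹) μ :=
  Integrable.of_bound (continuous_kernel hz).aestronglyMeasurable (1 / z.im)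
    (Eventually.of_forall (norm_kernel_le hz))

theorem im_stieltjesTransform (μ : Measure ℝ) [IsFiniteMeasure μ] (hz : 0 < z.im) :
    (stieltjesTransform μ z).im = ∫ x : ℝ, z.im / ((x - z.re) ^ 2 + z.im ^ 2) ∂μ := by
  have := integral_im (integrable_kernel μ hz)
  simp only [← im_kernel]
  exact this.symm

theorem norm_stieltjesTransform_le (μ : Measure ℝ) [IsProbabilityMeasure μ] (hz : 0 < z.im) :
    ‖stieltjesTransform μ z‖ ≤ 1 / z.im := by
  have := norm_integral_le_of_norm_le_const (μ := μ) (Eventually.of_forall (norm_kernel_le hz))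
  simpa [stieltjesTransform] using this

theorem im_stieltjesTransform_nonneg (μ : Measure ℝ) [IsFiniteMeasure μ] (hz : 0 < z.im) :
    0 ≤ (stieltjesTransform μ z).im := by
  rw [im_stieltjesTransform μ hz]
  exact integral_nonneg fun x => by positivity

/-- The bound does not depend on `μ`. This equicontinuity later reduces convergence on the
half-plane to a countable dense set. -/
theorem norm_stieltjesTransform_sub_le (μ : Measure ℝ) [IsProbabilityMeasure μ] {w : ℂ}
    (hz : 0 < z.im) (hw : 0 < w.im) :
    ‖stieltjesTransform μ z - stieltjesTransform μ w‖ ≤ ‖z - w‖ / (z.im * w.im) := by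
  rw [stieltjesTransform, stieltjesTransform,
    ← integral_sub (integrable_kernel μ hz) (integrable_kernel μ hw)]
  have : ∀ x : ℝ, ‖((x : ℂ) - z)⁻¹ - ((x : ℂ) - w)⁻¹‖ ≤ ‖z - w‖ / (z.im * w.im) := fun x => by
    have e : ((x : ℂ) - z)⁻¹ - ((x : ℂ) - w)⁻¹ = (z - w) * (((x : ℂ) - z)⁻¹ * ((x : ℂ) - w)⁻¹) := by
      have h1 := ofReal_sub_ne_zero hz x
      have h2 := ofReal_sub_ne_zero hw x
      field_simp
      ring
    rw [e, norm_mul, norm_mul, div_eq_mul_one_div]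
    refine mul_le_mul_of_nonneg_left ?_ (norm_nonneg _)
    rw [← one_div_mul_one_div]
    exact mul_le_mul (norm_kernel_le hz x) (norm_kernel_le hw x) (norm_nonneg _) (by positivity)
  have := norm_integral_le_of_norm_le_const (μ := μ) (Eventually.of_forall this)
  simpa using this

theorem tendsto_stieltjesTransform {α : Type*} {F : Filter α} {μs : α → ProbabilityMeasure ℝ}
    {μ : ProbabilityMeasure ℝ} (h : Tendsto μs F (𝓝 μ)) (hz : 0 < z.im) :
    Tendsto (fun a => stieltjesTransform (μs a : Measure ℝ) z) F
      (𝓝 (stieltjesTransform (μ : Measure ℝ) z)) :=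
  (ProbabilityMeasure.tendsto_iff_forall_integral_rclike_tendsto ℂ).mp h
    (BoundedContinuousFunction.ofNormedAddCommGroup (fun x : ℝ => ((x : ℂ) - z)⁻¹)
      (continuous_kernel hz) (1 / z.im) (norm_kernel_le hz))

/-- Markov's inequality for `1 - T²/(x² + T²)`, which is at least `1/2` once `|x| ≥ T` and whose
mean is read off from the transform at `iT`. -/
theorem measure_norm_gt_le (μ : Measure ℝ) [IsProbabilityMeasure μ] {T : ℝ} (hT : 0 < T) :
    μ {x | T < ‖x‖} ≤ ENNReal.ofReal (2 * (1 - T * (stieltjesTransform μ (Complex.I * T)).im)) := by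
  have hz : 0 < (Complex.I * (T : ℂ)).im := by simpa using hT
  have hi : Integrable (fun x : ℝ => T / (x ^ 2 + T ^ 2)) μ := by
    have := (integrable_kernel μ hz).im
    refine this.congr (Eventually.of_forall fun x => ?_)
    have := im_kernel (Complex.I * (T : ℂ)) x
    simpa using this
  have hf : Integrable (fun x : ℝ => 1 - T * (T / (x ^ 2 + T ^ 2))) μ :=
    (integrable_const 1).sub (hi.const_mul T)
  have him : (stieltjesTransform μ (Complex.I * T)).im = ∫ x, T / (x ^ 2 + T ^ 2) ∂μ := by
    rw [im_stieltjesTransform μ hz]; simp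
  have hval : ∫ x : ℝ, (1 - T * (T / (x ^ 2 + T ^ 2))) ∂μ =
      1 - T * (stieltjesTransform μ (Complex.I * T)).im := by
    rw [integral_sub (integrable_const 1) (hi.const_mul T), integral_const_mul, him]; simp
  have hnn : ∀ x : ℝ, 0 ≤ 1 - T * (T / (x ^ 2 + T ^ 2)) := fun x => by
    rw [sub_nonneg, ← mul_div_assoc, div_le_one (by positivity)]
    nlinarith [sq_nonneg x]
  have mk := mul_meas_ge_le_integral_of_nonneg (μ := μ) (Eventually.of_forall hnn) hf (1 / 2)
  rw [hval] at mk
  have hsub : {x : ℝ | T < ‖x‖} ⊆ {x : ℝ | 1 / 2 ≤ 1 - T * (T / (x ^ 2 + T ^ 2))} := fun x hx => by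
    have hx : T < |x| := hx
    have h2 : T ^ 2 ≤ x ^ 2 := by rw [← sq_abs x]; gcongr
    change 1 / 2 ≤ 1 - T * (T / (x ^ 2 + T ^ 2))
    have : T * (T / (x ^ 2 + T ^ 2)) ≤ 1 / 2 := by
      rw [← mul_div_assoc, div_le_div_iff₀ (by positivity) (by norm_num)]
      nlinarith
    linarith
  have := measureReal_mono (μ := μ) hsub
  rw [← ofReal_measureReal]
  refine ENNReal.ofReal_le_ofReal ?_
  linarith

/-- Pointwise convergence of Stieltjes transforms to a function with the right behaviour at
infinity implies tightness. -/
theorem isTightMeasureSet_of_stieltjesTransform {μs : ℕ → ProbabilityMeasure ℝ} {m : ℂ → ℂ}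
    (h : ∀ z : ℂ, 0 < z.im →
      Tendsto (fun n => stieltjesTransform (μs n : Measure ℝ) z) atTop (𝓝 (m z)))
    (hm : Tendsto (fun T : ℝ => T * (m (Complex.I * T)).im) atTop (𝓝 1)) :
    IsTightMeasureSet (Set.range fun n => (μs n : Measure ℝ)) := by
  refine isTightMeasureSet_range_of_tendsto_limsup_measure_norm_gt ?_
  have hlim : Tendsto (fun T : ℝ => ENNReal.ofReal (2 * (1 - T * (m (Complex.I * T)).im))) atTop
      (𝓝 0) := by
    have := ENNReal.tendsto_ofReal ((hm.const_sub 1).const_mul 2)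
    simpa using this
  refine tendsto_of_tendsto_of_tendsto_of_le_of_le' tendsto_const_nhds hlim
    (Eventually.of_forall fun _ => zero_le) ?_
  filter_upwards [eventually_gt_atTop 0] with T hT
  have hz : 0 < (Complex.I * (T : ℂ)).im := by simpa using hT
  have hu : Tendsto (fun n => ENNReal.ofReal
      (2 * (1 - T * (stieltjesTransform (μs n : Measure ℝ) (Complex.I * T)).im))) atTop
      (𝓝 (ENNReal.ofReal (2 * (1 - T * (m (Complex.I * T)).im)))) :=
    ENNReal.tendsto_ofReal
      (((((Complex.continuous_im.tendsto _).comp (h _ hz)).const_mul T).const_sub 1).const_mul 2)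
  rw [← hu.limsup_eq]
  exact limsup_le_limsup (Eventually.of_forall fun n => measure_norm_gt_le _ hT)

/-- Every ultrafilter limit point of such a sequence exists and has the limit as its transform. -/
theorem exists_tendsto_of_stieltjesTransform {μs : ℕ → ProbabilityMeasure ℝ} {m : ℂ → ℂ}
    (h : ∀ z : ℂ, 0 < z.im →
      Tendsto (fun n => stieltjesTransform (μs n : Measure ℝ) z) atTop (𝓝 (m z)))
    (hm : Tendsto (fun T : ℝ => T * (m (Complex.I * T)).im) atTop (𝓝 1))
    (U : Ultrafilter ℕ) (hU : (U : Filter ℕ) ≤ atTop) :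
    ∃ μ : ProbabilityMeasure ℝ, Tendsto μs U (𝓝 μ) ∧
      ∀ z : ℂ, 0 < z.im → stieltjesTransform (μ : Measure ℝ) z = m z := by
  have ht := isTightMeasureSet_of_stieltjesTransform h hm
  have hS : IsTightMeasureSet {((μ : ProbabilityMeasure ℝ) : Measure ℝ) | μ ∈ Set.range μs} := by
    convert ht using 1
    ext ν
    simp
  have hc := isCompact_closure_of_isTightMeasureSet hS
  obtain ⟨μ, -, hμ⟩ := hc.ultrafilter_le_nhds (U.map μs) (by
    rw [le_principal_iff]
    exact Eventually.of_forall (p := fun n => μs n ∈ closure (Set.range μs))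
      fun n => subset_closure ⟨n, rfl⟩)
  have hμ' : Tendsto μs U (𝓝 μ) := hμ
  exact ⟨μ, hμ', fun z hz =>
    tendsto_nhds_unique (tendsto_stieltjesTransform hμ' hz) ((h z hz).mono_left hU)⟩

/-! ### Stieltjes inversion -/

theorem tendsto_arctan_div (s : ℝ) :
    Tendsto (fun ε : ℝ => Real.arctan (s / ε)) (𝓝[>] 0) (𝓝 (Real.pi / 2 * Real.sign s)) := by
  rcases lt_trichotomy s 0 with h | h | h
  · rw [Real.sign_of_neg h]
    have h1 : Tendsto (fun ε : ℝ => s / ε) (𝓝[>] 0) atBot := by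
      simp only [div_eq_mul_inv]
      exact tendsto_inv_nhdsGT_zero.const_mul_atTop_of_neg h
    have : Tendsto (fun ε : ℝ => Real.arctan (s / ε)) _ _ := (Real.tendsto_arctan_atBot.mono_right nhdsWithin_le_nhds).comp h1
    simpa using this
  · subst h
    simp
  · rw [Real.sign_of_pos h]
    have h1 : Tendsto (fun ε : ℝ => s / ε) (𝓝[>] 0) atTop := by
      simp only [div_eq_mul_inv]
      exact tendsto_inv_nhdsGT_zero.const_mul_atTop h
    have : Tendsto (fun ε : ℝ => Real.arctan (s / ε)) _ _ := (Real.tendsto_arctan_atTop.mono_right nhdsWithin_le_nhds).comp h1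
    simpa using this

theorem integral_poisson (a b t : ℝ) {ε : ℝ} (hε : 0 < ε) :
    ∫ x in a..b, ε / ((t - x) ^ 2 + ε ^ 2) =
      Real.arctan ((b - t) / ε) - Real.arctan ((a - t) / ε) := by
  have hd : ∀ x ∈ Set.uIcc a b, HasDerivAt (fun x => Real.arctan ((x - t) / ε))
      (ε / ((t - x) ^ 2 + ε ^ 2)) x := fun x _ => by
    have h1 : HasDerivAt (fun x : ℝ => (x - t) / ε) (1 / ε) x :=
      ((hasDerivAt_id x).sub_const t).div_const ε
    convert h1.arctan using 1
    field_simp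
    ring
  rw [intervalIntegral.integral_eq_sub_of_hasDerivAt hd]
  refine Continuous.intervalIntegrable ?_ _ _
  exact continuous_const.div (by fun_prop) fun x => by positivity

/-- Fubini exchanges the integrals, and the Poisson kernel has an arctangent primitive. -/
theorem integral_im_stieltjesTransform (μ : Measure ℝ) [IsProbabilityMeasure μ] {a b : ℝ}
    (hab : a ≤ b) {ε : ℝ} (hε : 0 < ε) :
    ∫ x in a..b, (stieltjesTransform μ (x + Complex.I * ε)).im =
      ∫ t, (Real.arctan ((b - t) / ε) - Real.arctan ((a - t) / ε)) ∂μ := by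
  have hz : ∀ x : ℝ, 0 < ((x : ℂ) + Complex.I * ε).im := fun x => by simpa using hε
  have e : ∀ x : ℝ, (stieltjesTransform μ (x + Complex.I * ε)).im =
      ∫ t : ℝ, ε / ((t - x) ^ 2 + ε ^ 2) ∂μ := fun x => by
    rw [im_stieltjesTransform μ (hz x)]; simp
  simp_rw [e, ← integral_poisson a b _ hε]
  rw [intervalIntegral.integral_of_le hab]
  simp_rw [intervalIntegral.integral_of_le hab]
  refine integral_integral_swap (f := fun x t : ℝ => ε / ((t - x) ^ 2 + ε ^ 2)) ?_
  refine Integrable.of_bound (C := 1 / ε) ?_ (Eventually.of_forall fun q => ?_)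
  · refine Continuous.aestronglyMeasurable ?_
    exact continuous_const.div (by fun_prop) fun x => by positivity
  · simp only [Function.uncurry]
    rw [Real.norm_eq_abs, abs_of_nonneg (by positivity), div_le_div_iff₀ (by positivity) hε]
    nlinarith [sq_nonneg (q.2 - q.1)]

theorem tendsto_integral_im_stieltjesTransform (μ : Measure ℝ) [IsProbabilityMeasure μ] {a b : ℝ}
    (hab : a ≤ b) :
    Tendsto (fun ε : ℝ => ∫ x in a..b, (stieltjesTransform μ (x + Complex.I * ε)).im) (𝓝[>] 0)
      (𝓝 (∫ t, (Real.pi / 2 * Real.sign (b - t) - Real.pi / 2 * Real.sign (a - t)) ∂μ)) := by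
  have h : Tendsto (fun ε : ℝ =>
      ∫ t, (Real.arctan ((b - t) / ε) - Real.arctan ((a - t) / ε)) ∂μ) (𝓝[>] 0)
      (𝓝 (∫ t, (Real.pi / 2 * Real.sign (b - t) - Real.pi / 2 * Real.sign (a - t)) ∂μ)) := by
    refine tendsto_integral_filter_of_dominated_convergence (fun _ => Real.pi) ?_ ?_
      (integrable_const _) ?_
    · refine Eventually.of_forall fun ε => Measurable.aestronglyMeasurable ?_
      fun_prop
    · refine Eventually.of_forall fun ε => Eventually.of_forall fun t => ?_
      rw [Real.norm_eq_abs, abs_le]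
      have h1 := Real.arctan_lt_pi_div_two ((b - t) / ε)
      have h2 := Real.neg_pi_div_two_lt_arctan ((b - t) / ε)
      have h3 := Real.arctan_lt_pi_div_two ((a - t) / ε)
      have h4 := Real.neg_pi_div_two_lt_arctan ((a - t) / ε)
      constructor <;> linarith
    · exact Eventually.of_forall fun t => (tendsto_arctan_div _).sub (tendsto_arctan_div _)
  refine h.congr' ?_
  filter_upwards [self_mem_nhdsWithin] with ε hε
  exact (integral_im_stieltjesTransform μ hab hε).symm

/-- Endpoints get half weight in the inversion formula, so the limit is known only between the open
and the closed interval until atoms are excluded. -/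
theorem sign_sub_bounds {a b : ℝ} (hab : a < b) (t : ℝ) :
    (Set.Ioo a b).indicator (fun _ => Real.pi) t ≤
      Real.pi / 2 * Real.sign (b - t) - Real.pi / 2 * Real.sign (a - t) ∧
    Real.pi / 2 * Real.sign (b - t) - Real.pi / 2 * Real.sign (a - t) ≤
      (Set.Icc a b).indicator (fun _ => Real.pi) t := by
  have hpi := Real.pi_pos
  rcases lt_trichotomy t a with h | h | h
  · rw [Real.sign_of_pos (by linarith), Real.sign_of_pos (by linarith),
      Set.indicator_of_notMem (by simp [h.le]), Set.indicator_of_notMem (by simp [h])]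
    constructor <;> linarith
  · subst h
    rw [Real.sign_of_pos (by linarith), sub_self, Real.sign_zero,
      Set.indicator_of_notMem (by simp), Set.indicator_of_mem (by simp [hab.le])]
    constructor <;> linarith
  · rw [Real.sign_of_neg (show a - t < 0 by linarith)]
    rcases lt_trichotomy t b with h' | h' | h'
    · rw [Real.sign_of_pos (by linarith), Set.indicator_of_mem (show t ∈ Set.Ioo a b from ⟨h, h'⟩),
        Set.indicator_of_mem (show t ∈ Set.Icc a b from ⟨h.le, h'.le⟩)]
      constructor <;> linarith
    · subst h'
      rw [sub_self, Real.sign_zero,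
        Set.indicator_of_notMem (by simp), Set.indicator_of_mem (by simp [hab.le])]
      constructor <;> linarith
    · rw [Real.sign_of_neg (by linarith),
        Set.indicator_of_notMem (by simp [h'.le]), Set.indicator_of_notMem (by simp [h'])]
      constructor <;> linarith

theorem measurable_realSign : Measurable Real.sign := by
  unfold Real.sign
  exact Measurable.ite measurableSet_Iio measurable_const
    (Measurable.ite measurableSet_Ioi measurable_const measurable_const)

theorem inversion_bounds (μ : Measure ℝ) [IsProbabilityMeasure μ] {a b : ℝ} (hab : a < b) {L : ℝ}
    (hL : Tendsto (fun ε : ℝ => ∫ x in a..b, (stieltjesTransform μ (x + Complex.I * ε)).im)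
      (𝓝[>] 0) (𝓝 (Real.pi * L))) : μ.real (Set.Ioo a b) ≤ L ∧ L ≤ μ.real (Set.Icc a b) := by
  have e := tendsto_nhds_unique hL (tendsto_integral_im_stieltjesTransform μ hab.le)
  have hi : Integrable (fun t =>
      Real.pi / 2 * Real.sign (b - t) - Real.pi / 2 * Real.sign (a - t)) μ := by
    refine Integrable.of_bound (C := Real.pi) (Measurable.aestronglyMeasurable ?_)
      (Eventually.of_forall fun t => ?_)
    · have := measurable_realSign
      fun_prop
    · have h := sign_sub_bounds hab t
      have hpi := Real.pi_pos
      have h1 : 0 ≤ (Set.Ioo a b).indicator (fun _ => Real.pi) t :=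
        Set.indicator_nonneg (fun _ _ => hpi.le) t
      have h2 : (Set.Icc a b).indicator (fun _ => Real.pi) t ≤ Real.pi :=
        Set.indicator_le_self' (fun _ _ => hpi.le) t
      rw [Real.norm_eq_abs, abs_of_nonneg (h1.trans h.1)]
      exact h.2.trans h2
  have hind : ∀ s : Set ℝ, MeasurableSet s →
      Integrable (s.indicator fun _ => Real.pi) μ ∧
        ∫ t, s.indicator (fun _ => Real.pi) t ∂μ = Real.pi * μ.real s := fun s hs => by
    refine ⟨(integrable_const _).indicator hs, ?_⟩
    rw [integral_indicator_const _ hs, smul_eq_mul, mul_comm]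
  obtain ⟨i1, e1⟩ := hind _ (measurableSet_Ioo (a := a) (b := b))
  obtain ⟨i2, e2⟩ := hind _ (measurableSet_Icc (a := a) (b := b))
  have l1 := integral_mono i1 hi fun t => (sign_sub_bounds hab t).1
  have l2 := integral_mono hi i2 fun t => (sign_sub_bounds hab t).2
  rw [e1, ← e] at l1
  rw [e2, ← e] at l2
  exact ⟨le_of_mul_le_mul_left l1 Real.pi_pos, le_of_mul_le_mul_left l2 Real.pi_pos⟩

/-- If the imaginary part of the Stieltjes transform has a continuous, locally bounded boundary
limit on the open set `U` then the measure has this density there. -/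
theorem measureReal_Ioc_eq_integral (μ : Measure ℝ) [IsProbabilityMeasure μ] {U : Set ℝ}
    (hU : IsOpen U) {g : ℝ → ℝ} (hg : ContinuousOn g U)
    (hlim : ∀ x ∈ U, Tendsto (fun ε : ℝ => (stieltjesTransform μ (x + Complex.I * ε)).im) (𝓝[>] 0)
      (𝓝 (Real.pi * g x)))
    (hbd : ∀ a b, Set.Icc a b ⊆ U → ∃ K, ∀ x ∈ Set.Icc a b, ∀ ε : ℝ, 0 < ε → ε ≤ 1 →
      (stieltjesTransform μ (x + Complex.I * ε)).im ≤ K) {a b : ℝ} (hab : a ≤ b)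
    (hsub : Set.Icc a b ⊆ U) : μ.real (Set.Ioc a b) = ∫ x in a..b, g x := by
  have key : ∀ a b, a < b → Set.Icc a b ⊆ U →
      μ.real (Set.Ioo a b) ≤ ∫ x in a..b, g x ∧ ∫ x in a..b, g x ≤ μ.real (Set.Icc a b) := by
    intro a b hab hs
    refine inversion_bounds μ hab ?_
    obtain ⟨K, hK⟩ := hbd a b hs
    rw [← intervalIntegral.integral_const_mul]
    refine intervalIntegral.tendsto_integral_filter_of_dominated_convergence (fun _ => K) ?_ ?_
      intervalIntegrable_const ?_
    · filter_upwards [self_mem_nhdsWithin] with ε hε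
      have hε : 0 < ε := hε
      refine ContinuousOn.aestronglyMeasurable (Continuous.continuousOn ?_) measurableSet_uIoc
      refine Complex.continuous_im.comp ?_
      rw [Metric.continuous_iff]
      intro x δ hδ
      -- Both points have imaginary part `ε`, so the Lipschitz constant of the transform is `1/ε²`.
      refine ⟨δ * (ε * ε), by positivity, fun y hy => ?_⟩
      rw [dist_eq_norm]
      have hz : ∀ x : ℝ, 0 < ((x : ℂ) + Complex.I * ε).im := fun x => by simpa using hε
      refine (norm_stieltjesTransform_sub_le μ (hz y) (hz x)).trans_lt ?_
      have e1 : ((y : ℂ) + Complex.I * ε) - (x + Complex.I * ε) = ((y - x : ℝ) : ℂ) := by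
        push_cast; ring
      rw [e1, Complex.norm_real, ← dist_eq_norm]
      simp only [Complex.add_im, Complex.ofReal_im, Complex.I_mul_im, Complex.ofReal_re, zero_add]
      rw [div_lt_iff₀ (by positivity)]
      exact hy
    · have h1 : ∀ᶠ ε : ℝ in 𝓝[>] 0, ε ≤ 1 := nhdsWithin_le_nhds (eventually_le_nhds one_pos)
      filter_upwards [self_mem_nhdsWithin, h1] with ε hε hε1
      have hε : 0 < ε := hε
      refine Eventually.of_forall fun x hx => ?_
      rw [Set.uIoc_of_le hab.le] at hx
      have hz : 0 < ((x : ℂ) + Complex.I * ε).im := by simpa using hε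
      rw [Real.norm_eq_abs, abs_of_nonneg (im_stieltjesTransform_nonneg μ hz)]
      exact hK x ⟨hx.1.le, hx.2⟩ ε hε hε1
    · refine Eventually.of_forall fun x hx => ?_
      rw [Set.uIoc_of_le hab.le] at hx
      exact hlim x (hs ⟨hx.1.le, hx.2⟩)
  -- The open-interval bound on shrinking intervals around `x`, with `g` locally bounded.
  have atoms : ∀ x ∈ U, μ.real {x} = 0 := by
    intro x hx
    have hc : ContinuousAt g x := hg.continuousAt (hU.mem_nhds hx)
    have h1 : ∀ᶠ y in 𝓝 x, y ∈ U ∧ ‖g y‖ < ‖g x‖ + 1 :=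
      Filter.Eventually.and (hU.mem_nhds hx) (hc.norm.eventually_lt_const (lt_add_one _))
    obtain ⟨δ, hδ, hball⟩ := Metric.eventually_nhds_iff.mp h1
    have hle : ∀ η : ℝ, 0 < η → η < δ → μ.real {x} ≤ (‖g x‖ + 1) * (2 * η) := by
      intro η hη hηδ
      have hin : ∀ y ∈ Set.Icc (x - η) (x + η), y ∈ U ∧ ‖g y‖ < ‖g x‖ + 1 := fun y hy => by
        refine hball ?_
        rw [Real.dist_eq, abs_lt]
        constructor <;> linarith [hy.1, hy.2]
      have k1 := (key (x - η) (x + η) (by linarith) fun y hy => (hin y hy).1).1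
      have k2 := intervalIntegral.norm_integral_le_of_norm_le_const (a := x - η) (b := x + η)
        (f := g) (C := ‖g x‖ + 1) fun y hy => by
          rw [Set.uIoc_of_le (by linarith)] at hy
          exact (hin y ⟨hy.1.le, hy.2⟩).2.le
      have k3 : μ.real {x} ≤ μ.real (Set.Ioo (x - η) (x + η)) := measureReal_mono (by
        rw [Set.singleton_subset_iff]; constructor <;> linarith)
      have e : |x + η - (x - η)| = 2 * η := by
        rw [abs_of_pos (by linarith)]; ring
      rw [e] at k2
      exact k3.trans (k1.trans ((le_abs_self _).trans k2))
    have ht : Tendsto (fun η : ℝ => (‖g x‖ + 1) * (2 * η)) (𝓝[>] 0) (𝓝 0) := by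
      have : Continuous fun η : ℝ => (‖g x‖ + 1) * (2 * η) := by fun_prop
      have := this.tendsto 0
      simp only [mul_zero] at this
      exact this.mono_left nhdsWithin_le_nhds
    have hδ' : ∀ᶠ η : ℝ in 𝓝[>] 0, η < δ := nhdsWithin_le_nhds (eventually_lt_nhds hδ)
    refine le_antisymm (ge_of_tendsto ht ?_) measureReal_nonneg
    filter_upwards [self_mem_nhdsWithin, hδ'] with η h1 h2 using hle η h1 h2
  rcases hab.eq_or_lt with h | h
  · subst h; simp
  · obtain ⟨k1, k2⟩ := key a b h hsub
    have ha := atoms a (hsub ⟨le_rfl, hab⟩)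
    have hb := atoms b (hsub ⟨hab, le_rfl⟩)
    refine le_antisymm ?_ ?_
    · rw [← Set.Ioo_union_right h]
      exact (measureReal_union_le _ _).trans (by rw [hb]; linarith)
    · refine k2.trans ?_
      rw [← Set.Ioc_union_left hab]
      exact (measureReal_union_le _ _).trans (by rw [ha]; linarith)

end Stieltjes

/-! ### The limiting distribution -/

section LimitLaw

variable {c : ℝ}

/-- The real points near which the admissible solution stays bounded. -/
def regularSet (c : ℝ) : Set ℝ := {x | x ≠ 0 ∨ c < 2}

theorem isOpen_regularSet (c : ℝ) : IsOpen (regularSet c) :=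
  isOpen_ne.union isOpen_const

/-- The density of the limit, as a boundary value. -/
def boundaryDensity (c x : ℝ) : ℝ := (limitTransform c x).im / Real.pi

/-- Boundedness comes from the leading coefficient when `x ≠ 0` and from the weight inequality when
`c < 2`. The approach may be from the upper half-plane or along the real line. -/
theorem Admissible.tendsto_limitTransform (hc : 0 < c) {x : ℝ} (hx : x ∈ regularSet c)
    {α : Type*} {F : Filter α} [F.NeBot] {u s : α → ℂ} (h : ∀ᶠ a in F, Admissible c (u a) (s a))
    (hu : Tendsto u F (𝓝 (x : ℂ))) :
    Admissible c x (limitTransform c x) ∧ Tendsto s F (𝓝 (limitTransform c x)) := by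
  have hb : ∃ K, ∀ᶠ a in F, ‖s a‖ ≤ K := by
    rcases hx with hx | hc2
    · have hx' : (x : ℂ) ≠ 0 := by exact_mod_cast hx
      let φ : ℂ → ℝ := fun z => 1 + (|c ^ 2 - 2 * c| + ‖z‖ + 1) / (c ^ 2 * ‖z‖)
      have hφ : ContinuousAt φ (x : ℂ) := by
        refine continuousAt_const.add (ContinuousAt.div (by fun_prop) (by fun_prop) ?_)
        have := norm_pos_iff.mpr hx'
        positivity
      have h1 := (hφ.tendsto.comp hu).eventually_le_const (lt_add_one _)
      have h2 := hu.eventually_ne hx'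
      refine ⟨φ x + 1, ?_⟩
      filter_upwards [h, h1, h2] with a ha h1 h2
      exact (ha.sol.norm_le hc h2).trans h1
    · exact ⟨_, h.mono fun a ha => ha.norm_le_of_lt_two hc hc2⟩
  obtain ⟨K, hK⟩ := hb
  obtain ⟨m₀, hm₀, ht⟩ := Admissible.tendsto hc h hu hK
  rw [hm₀.eq_limitTransform hc]
  exact ⟨hm₀, ht⟩

theorem boundaryDensity_eq_density (hc : 0 < c) {x : ℝ} (hx : x ≠ 0)
    (h : Admissible c x (limitTransform c x)) : boundaryDensity c x = density c x := by
  rw [boundaryDensity, h.im_eq_density hc hx, mul_div_cancel_left₀ _ Real.pi_ne_zero]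

theorem boundaryDensity_zero (hc : 0 < c) (hc2 : c < 2)
    (h : Admissible c ((0 : ℝ) : ℂ) (limitTransform c ((0 : ℝ) : ℂ))) :
    boundaryDensity c 0 = 1 / (Real.pi * √(2 * c - c ^ 2)) := by
  have h0 : Admissible c 0 (limitTransform c ((0 : ℝ) : ℂ)) := by simpa using h
  rw [boundaryDensity, h0.im_at_zero hc hc2, div_div, mul_comm]

/-- The Stieltjes transform of `μ` solves the limiting equation. -/
def IsLimitLaw (c : ℝ) (μ : Measure ℝ) : Prop :=
  ∀ z : ℂ, 0 < z.im → Admissible c z (stieltjesTransform μ z)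

variable {μ : Measure ℝ} [IsProbabilityMeasure μ]

omit [IsProbabilityMeasure μ] in
-- The vertical approach produces an admissible solution at the real point itself; its existence
-- there is not assumed.
theorem IsLimitLaw.boundary (hc : 0 < c) (h : IsLimitLaw c μ) {x : ℝ} (hx : x ∈ regularSet c) :
    Admissible c x (limitTransform c x) ∧
      Tendsto (fun ε : ℝ => stieltjesTransform μ (x + Complex.I * ε)) (𝓝[>] 0)
        (𝓝 (limitTransform c x)) := by
  refine Admissible.tendsto_limitTransform hc hx ?_ ?_ (u := fun ε : ℝ => (x : ℂ) + Complex.I * ε)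
  · filter_upwards [self_mem_nhdsWithin] with ε hε
    exact h _ (by simpa using hε)
  · have : Continuous fun ε : ℝ => (x : ℂ) + Complex.I * ε := by fun_prop
    have := this.tendsto 0
    simp only [Complex.ofReal_zero, mul_zero, add_zero] at this
    exact this.mono_left nhdsWithin_le_nhds

omit [IsProbabilityMeasure μ] in
theorem IsLimitLaw.continuousOn (hc : 0 < c) (h : IsLimitLaw c μ) :
    ContinuousOn (boundaryDensity c) (regularSet c) := by
  intro x hx
  have ht : Tendsto (fun y : ℝ => limitTransform c y) (𝓝 x) (𝓝 (limitTransform c x)) :=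
    (Admissible.tendsto_limitTransform hc hx (u := fun y : ℝ => (y : ℂ))
      (Filter.Eventually.mono ((isOpen_regularSet c).mem_nhds hx)
        fun y hy => (h.boundary hc hy).1)
      (Complex.continuous_ofReal.tendsto x)).2
  exact (((Complex.continuous_im.tendsto _).comp ht).div_const Real.pi).mono_left
    nhdsWithin_le_nhds

omit [IsProbabilityMeasure μ] in
theorem IsLimitLaw.bound (hc : 0 < c) (h : IsLimitLaw c μ) (a b : ℝ)
    (hs : Set.Icc a b ⊆ regularSet c) : ∃ K, ∀ x ∈ Set.Icc a b, ∀ ε : ℝ, 0 < ε → ε ≤ 1 →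
      (stieltjesTransform μ (x + Complex.I * ε)).im ≤ K := by
  have hz : ∀ (x : ℝ) {ε : ℝ}, 0 < ε → 0 < ((x : ℂ) + Complex.I * ε).im := fun x ε hε => by
    simpa using hε
  by_cases hc2 : c < 2
  · exact ⟨_, fun x _ ε hε _ => (Complex.im_le_norm _).trans
      ((h _ (hz x hε)).norm_le_of_lt_two hc hc2)⟩
  -- For `c ≥ 2` the regular set excludes `0`, so a compact interval inside it stays at a positive
  -- distance from `0`.
  have hδ : ∃ δ > 0, ∀ x ∈ Set.Icc a b, δ ≤ |x| := by
    by_cases hab : a ≤ b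
    · rcases lt_or_ge 0 a with ha | ha
      · exact ⟨a, ha, fun x hx => hx.1.trans (le_abs_self x)⟩
      · rcases lt_or_ge b 0 with hb | hb
        · exact ⟨-b, by linarith, fun x hx => (neg_le_neg hx.2).trans (neg_le_abs x)⟩
        · rcases hs ⟨ha, hb⟩ with h0 | h0
          · exact absurd rfl h0
          · exact absurd h0 hc2
    · exact ⟨1, one_pos, fun x hx => absurd (hx.1.trans hx.2) hab⟩
  obtain ⟨δ, hδ, hδx⟩ := hδ
  refine ⟨1 + ((|c ^ 2 - 2 * c| + 1) / (c ^ 2 * δ) + 1 / c ^ 2), fun x hx ε hε _ => ?_⟩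
  set z : ℂ := (x : ℂ) + Complex.I * ε with hzdef
  have hre : z.re = x := by simp [z]
  have hn : δ ≤ ‖z‖ := by
    have := Complex.abs_re_le_norm z
    rw [hre] at this
    exact (hδx x hx).trans this
  have hn0 : 0 < ‖z‖ := hδ.trans_le hn
  refine (Complex.im_le_norm _).trans (((h z (hz x hε)).sol.norm_le hc
    (norm_pos_iff.mp hn0)).trans ?_)
  have e : (|c ^ 2 - 2 * c| + ‖z‖ + 1) / (c ^ 2 * ‖z‖) =
      (|c ^ 2 - 2 * c| + 1) / (c ^ 2 * ‖z‖) + 1 / c ^ 2 := by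
    field_simp
    ring
  rw [e]
  gcongr

theorem IsLimitLaw.measureReal_Ioc (hc : 0 < c) (h : IsLimitLaw c μ) {a b : ℝ} (hab : a ≤ b)
    (hs : Set.Icc a b ⊆ regularSet c) :
    μ.real (Set.Ioc a b) = ∫ x in a..b, boundaryDensity c x := by
  refine measureReal_Ioc_eq_integral μ (isOpen_regularSet c) (h.continuousOn hc)
    (fun x hx => ?_) (h.bound hc) hab hs
  rw [boundaryDensity, mul_div_cancel₀ _ Real.pi_ne_zero]
  exact (Complex.continuous_im.tendsto _).comp (h.boundary hc hx).2

theorem IsLimitLaw.hasDerivAt_cdf (hc : 0 < c) (h : IsLimitLaw c μ) {x : ℝ}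
    (hx : x ∈ regularSet c) :
    HasDerivAt (fun t => cdf μ t) (boundaryDensity c x) x := by
  obtain ⟨δ, hδ, hball⟩ := Metric.isOpen_iff.mp (isOpen_regularSet c) x hx
  set a := x - δ / 2 with ha
  have hsub : ∀ t ∈ Set.Ioo a (x + δ / 2), Set.Icc a t ⊆ regularSet c := fun t ht y hy => by
    apply hball
    rw [Metric.mem_ball, Real.dist_eq, abs_lt]
    constructor <;> linarith [hy.1, hy.2, ht.2]
  have hxm : x ∈ Set.Ioo a (x + δ / 2) := by constructor <;> linarith
  have hcont := h.continuousOn hc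
  have hint : IntervalIntegrable (boundaryDensity c) volume a x := by
    refine ContinuousOn.intervalIntegrable (hcont.mono ?_)
    rw [Set.uIcc_of_le hxm.1.le]
    exact hsub x hxm
  have hca : ContinuousAt (boundaryDensity c) x :=
    hcont.continuousAt ((isOpen_regularSet c).mem_nhds hx)
  have hsm : StronglyMeasurableAtFilter (boundaryDensity c) (𝓝 x) :=
    hcont.stronglyMeasurableAtFilter (isOpen_regularSet c) x hx
  have hd := (intervalIntegral.integral_hasDerivAt_right hint hsm hca).const_add (cdf μ a)
  refine hd.congr_of_eventuallyEq ?_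
  filter_upwards [isOpen_Ioo.mem_nhds hxm] with t ht
  rw [← h.measureReal_Ioc hc ht.1.le (hsub t ht), cdf_eq_real, cdf_eq_real,
    ← Set.Iic_union_Ioc_eq_Iic ht.1.le, measureReal_union _ measurableSet_Ioc]
  exact Set.Iic_disjoint_Ioc le_rfl

theorem density_nonneg (hc : 0 < c) (h : IsLimitLaw c μ) {x : ℝ} (hx : x ≠ 0) :
    0 ≤ density c x := by
  have := (h.boundary hc (Or.inl hx : x ∈ regularSet c)).1
  rw [← boundaryDensity_eq_density hc hx this]
  exact div_nonneg this.im_nonneg Real.pi_pos.le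

theorem IsLimitLaw.measure_Ioc (hc : 0 < c) (h : IsLimitLaw c μ) {a b : ℝ} (hab : a ≤ b)
    (hs : Set.Icc a b ⊆ {0}ᶜ) :
    μ (Set.Ioc a b) = (volume.withDensity fun x => ENNReal.ofReal (density c x)) (Set.Ioc a b) := by
  have hs' : Set.Icc a b ⊆ regularSet c := fun x hx => Or.inl (hs hx)
  have he : Set.EqOn (boundaryDensity c) (density c) (Set.Icc a b) := fun x hx =>
    boundaryDensity_eq_density hc (hs hx) (h.boundary hc (hs' hx)).1
  have hcont : ContinuousOn (density c) (Set.Icc a b) :=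
    ((h.continuousOn hc).mono hs').congr he.symm
  have hint : IntegrableOn (density c) (Set.Ioc a b) :=
    (hcont.integrableOn_Icc).mono_set Set.Ioc_subset_Icc_self
  have hnn : 0 ≤ᵐ[volume.restrict (Set.Ioc a b)] density c := by
    refine (ae_restrict_iff' measurableSet_Ioc).mpr (Eventually.of_forall fun x hx => ?_)
    exact density_nonneg hc h (hs (Set.Ioc_subset_Icc_self hx))
  rw [withDensity_apply _ measurableSet_Ioc, ← ofReal_integral_eq_lintegral_ofReal hint hnn,
    ← ofReal_measureReal, h.measureReal_Ioc hc hab hs', intervalIntegral.integral_of_le hab]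
  congr 1
  exact setIntegral_congr_fun measurableSet_Ioc fun x hx => he (Set.Ioc_subset_Icc_self hx)

theorem IsLimitLaw.restrict_Ioc (hc : 0 < c) (h : IsLimitLaw c μ) {a b : ℝ} (hab : a ≤ b)
    (hs : Set.Icc a b ⊆ {0}ᶜ) :
    μ.restrict (Set.Ioc a b) =
      (volume.withDensity fun x => ENNReal.ofReal (density c x)).restrict (Set.Ioc a b) := by
  refine Measure.ext_of_Ioc_finite _ _ ?_ fun a' b' _ => ?_
  · rw [Measure.restrict_apply_univ, Measure.restrict_apply_univ]
    exact h.measure_Ioc hc hab hs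
  · rw [Measure.restrict_apply measurableSet_Ioc, Measure.restrict_apply measurableSet_Ioc,
      Set.Ioc_inter_Ioc]
    by_cases hle : a' ⊔ a ≤ b' ⊓ b
    · exact h.measure_Ioc hc hle
        ((Set.Icc_subset_Icc le_sup_right inf_le_right).trans hs)
    · rw [Set.Ioc_eq_empty (fun hlt => hle hlt.le)]
      simp

/-- Away from `0` the limit is absolutely continuous with the explicit density. -/
theorem IsLimitLaw.restrict_compl_zero (hc : 0 < c) (h : IsLimitLaw c μ) :
    μ.restrict {0}ᶜ = volume.withDensity fun x => ENNReal.ofReal (density c x) := by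
  -- A countable exhaustion of the punctured line by intervals whose closures avoid `0`.
  have hU : (⋃ k : ℕ, (Set.Ioc (1 / ((k : ℝ) + 1)) (k + 1) ∪
      Set.Ioc (-((k : ℝ) + 1)) (-(1 / ((k : ℝ) + 1))))) = ({0}ᶜ : Set ℝ) := by
    ext x
    simp only [Set.mem_iUnion, Set.mem_union, Set.mem_Ioc, Set.mem_compl_iff,
      Set.mem_singleton_iff]
    constructor
    · rintro ⟨k, ⟨h1, -⟩ | ⟨-, h2⟩⟩ rfl
      · have : 0 < 1 / ((k : ℝ) + 1) := by positivity
        linarith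
      · have : 0 < 1 / ((k : ℝ) + 1) := by positivity
        linarith
    · intro hx
      obtain ⟨k1, hk1⟩ := exists_nat_one_div_lt (abs_pos.mpr hx)
      obtain ⟨k2, hk2⟩ := exists_nat_gt |x|
      set k := max k1 k2
      have h1 : 1 / ((k : ℝ) + 1) < |x| := by
        refine lt_of_le_of_lt ?_ hk1
        have : (k1 : ℝ) ≤ k := by exact_mod_cast le_max_left _ _
        gcongr
      have h2 : |x| < (k : ℝ) + 1 := by
        have : (k2 : ℝ) ≤ k := by exact_mod_cast le_max_right _ _
        linarith
      refine ⟨k, ?_⟩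
      rcases abs_cases x with ⟨he, _⟩ | ⟨he, _⟩
      · left; rw [he] at h1 h2; exact ⟨h1, h2.le⟩
      · right; rw [he] at h1 h2; constructor <;> linarith
  have hr : (volume.withDensity fun x => ENNReal.ofReal (density c x)).restrict {0}ᶜ =
      volume.withDensity fun x => ENNReal.ofReal (density c x) := by
    rw [restrict_withDensity (measurableSet_singleton 0).compl, restrict_compl_singleton]
  rw [← hr, ← hU, Measure.restrict_iUnion_congr]
  intro k
  have hk : 0 < 1 / ((k : ℝ) + 1) := by positivity
  have hk1 : 1 / ((k : ℝ) + 1) ≤ k + 1 := by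
    have hk0 : (0 : ℝ) ≤ k := Nat.cast_nonneg k
    rw [div_le_iff₀ (by positivity)]
    nlinarith
  refine Measure.restrict_union_congr.mpr ⟨h.restrict_Ioc hc hk1 ?_, h.restrict_Ioc hc (by linarith) ?_⟩
  · rintro x hx rfl
    linarith [hx.1]
  · rintro x hx rfl
    linarith [hx.2]

/-- The limiting equation determines the measure. -/
theorem IsLimitLaw.unique (hc : 0 < c) (h : IsLimitLaw c μ) {ν : Measure ℝ}
    [IsProbabilityMeasure ν] (h' : IsLimitLaw c ν) : μ = ν := by
  have e : μ.restrict {0}ᶜ = ν.restrict {0}ᶜ :=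
    (h.restrict_compl_zero hc).trans (h'.restrict_compl_zero hc).symm
  have hm : MeasurableSet ({0} : Set ℝ) := measurableSet_singleton 0
  have e1 : μ ({0}ᶜ) = ν ({0}ᶜ) := by
    rw [← Measure.restrict_apply_univ, e, Measure.restrict_apply_univ]
  -- The equation says nothing directly about an atom at `0`; its mass is what the density leaves of
  -- total mass `1`.
  have e0 : μ {0} = ν {0} := by
    have h1 := prob_compl_eq_one_sub (μ := μ) hm.compl
    have h2 := prob_compl_eq_one_sub (μ := ν) hm.compl
    rw [compl_compl] at h1 h2
    rw [h1, h2, e1]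
  rw [← Measure.restrict_add_restrict_compl (μ := μ) hm,
    ← Measure.restrict_add_restrict_compl (μ := ν) hm, e, Measure.restrict_singleton,
    Measure.restrict_singleton, e0]

-- Take the least `k` with `|x| ≤ 2^k ε`. If `k ≥ 1` then `|x| > 2^(k-1) ε`, so the kernel is at
-- most `4/(4^k ε)`, and one term of the series suffices.
omit [IsProbabilityMeasure μ] in
theorem poisson_le_tsum {ε : ℝ} (hε : 0 < ε) (x : ℝ) :
    ENNReal.ofReal (ε / (x ^ 2 + ε ^ 2)) ≤
      ∑' k : ℕ, (Set.Icc (-(2 ^ k * ε)) (2 ^ k * ε)).indicator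
        (fun _ => ENNReal.ofReal (4 / (4 ^ k * ε))) x := by
  have hex : ∃ k : ℕ, |x| ≤ 2 ^ k * ε := by
    obtain ⟨k, hk⟩ := pow_unbounded_of_one_lt (|x| / ε) (one_lt_two)
    exact ⟨k, by rw [div_lt_iff₀ hε] at hk; exact hk.le⟩
  classical
  obtain ⟨k, hk, hmin⟩ : ∃ k : ℕ, |x| ≤ 2 ^ k * ε ∧ ∀ j < k, ¬ |x| ≤ 2 ^ j * ε :=
    ⟨Nat.find hex, Nat.find_spec hex, fun j hj => Nat.find_min hex hj⟩
  refine le_trans ?_ (ENNReal.le_tsum k)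
  rw [Set.indicator_of_mem (show x ∈ Set.Icc (-(2 ^ k * ε)) (2 ^ k * ε) from abs_le.mp hk)]
  refine ENNReal.ofReal_le_ofReal ?_
  rw [div_le_div_iff₀ (by positivity) (by positivity)]
  cases k with
  | zero => nlinarith [sq_nonneg x]
  | succ j =>
    have hj : 2 ^ j * ε < |x| := not_le.mp (hmin j (Nat.lt_succ_self j))
    have h2 : (2 ^ j * ε) ^ 2 ≤ x ^ 2 := by rw [← sq_abs x]; gcongr
    have h4 : (2 ^ j * ε) ^ 2 = 4 ^ j * ε ^ 2 := by
      rw [mul_pow, ← pow_mul, mul_comm j 2, pow_mul]; norm_num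
    rw [h4] at h2
    rw [pow_succ]
    nlinarith [sq_nonneg ε]

/-- Differentiability of the distribution function at `0` bounds the Stieltjes transform along the
imaginary axis. -/
theorem im_stieltjesTransform_le_of_differentiableAt
    (h : DifferentiableAt ℝ (fun t => cdf μ t) 0) :
    ∃ K, ∀ ε : ℝ, 0 < ε → (stieltjesTransform μ (Complex.I * ε)).im ≤ K := by
  obtain ⟨C, hC⟩ := h.hasDerivAt.isBigO_sub.bound
  obtain ⟨δ, hδ, hball⟩ := Metric.eventually_nhds_iff.mp hC
  set F := fun t : ℝ => cdf μ t
  -- The constant `max C 0` serves for `|t| < δ`. Farther out, the trivial bound `1` on differences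
  -- of the distribution function is at most `|t|/δ`.
  set D := max (max C 0) (1 / δ) with hD
  have hD0 : 0 ≤ D := (le_max_right C 0).trans (le_max_left _ _)
  have hF : ∀ t, |F t - F 0| ≤ D * |t| := by
    intro t
    by_cases ht : |t| < δ
    · have := hball (y := t) (by simpa [Real.dist_eq] using ht)
      simp only [sub_zero, Real.norm_eq_abs] at this
      refine this.trans (mul_le_mul_of_nonneg_right ?_ (abs_nonneg t))
      exact (le_max_left C 0).trans (le_max_left _ _)
    · rw [not_lt] at ht
      have h1 : |F t - F 0| ≤ 1 := by
        rw [abs_le]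
        have a1 := cdf_nonneg μ t
        have a2 := cdf_nonneg μ 0
        have a3 := cdf_le_one μ t
        have a4 := cdf_le_one μ 0
        constructor <;> simp only [F] <;> linarith
      refine h1.trans ?_
      calc (1 : ℝ) = 1 / δ * δ := by field_simp
        _ ≤ D * |t| := by gcongr; exact le_max_right _ _
  have hI : ∀ t : ℝ, 0 < t → μ (Set.Icc (-t) t) ≤ ENNReal.ofReal (3 * D * t) := by
    intro t ht
    -- Doubling the left endpoint keeps a possible atom at `-t` inside the half-open interval; the
    -- cost is the factor `3 = 1 + 2`.
    have hsub : Set.Icc (-t) t ⊆ Set.Ioc (-(2 * t)) t := fun x hx => ⟨by linarith [hx.1], hx.2⟩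
    have e : μ.real (Set.Ioc (-(2 * t)) t) = F t - F (-(2 * t)) := by
      simp only [F]
      rw [cdf_eq_real, cdf_eq_real, ← Set.Iic_union_Ioc_eq_Iic (show -(2 * t) ≤ t by linarith),
        measureReal_union (Set.Iic_disjoint_Ioc le_rfl) measurableSet_Ioc]
      ring
    rw [← ofReal_measureReal]
    refine ENNReal.ofReal_le_ofReal ((measureReal_mono hsub).trans ?_)
    rw [e]
    have h1 := hF t
    have h2 := hF (-(2 * t))
    rw [abs_of_pos ht] at h1
    rw [abs_neg, abs_of_pos (by linarith : (0 : ℝ) < 2 * t)] at h2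
    linarith [(abs_le.mp h1).2, (abs_le.mp h2).1]
  -- The dyadic series is `∑ 4/(4^k ε) · 3D · 2^k ε = ∑ 12D / 2^k`.
  refine ⟨24 * D, fun ε hε => ?_⟩
  have hz : 0 < (Complex.I * (ε : ℂ)).im := by simpa using hε
  rw [im_stieltjesTransform μ hz]
  simp only [Complex.mul_im, Complex.I_re, Complex.I_im, Complex.ofReal_re, Complex.ofReal_im,
    Complex.mul_re, zero_mul, one_mul, zero_add, sub_zero, mul_zero]
  have hcont : Continuous fun x : ℝ => ε / (x ^ 2 + ε ^ 2) :=
    continuous_const.div (by fun_prop) fun x => by positivity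
  rw [integral_eq_lintegral_of_nonneg_ae (Eventually.of_forall fun x => by positivity)
    hcont.aestronglyMeasurable]
  refine ENNReal.toReal_le_of_le_ofReal (by positivity) ?_
  calc ∫⁻ x, ENNReal.ofReal (ε / (x ^ 2 + ε ^ 2)) ∂μ
      ≤ ∫⁻ x, ∑' k : ℕ, (Set.Icc (-(2 ^ k * ε)) (2 ^ k * ε)).indicator
        (fun _ => ENNReal.ofReal (4 / (4 ^ k * ε))) x ∂μ :=
        lintegral_mono fun x => poisson_le_tsum hε x
    _ = ∑' k : ℕ, ENNReal.ofReal (4 / (4 ^ k * ε)) * μ (Set.Icc (-(2 ^ k * ε)) (2 ^ k * ε)) := by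
        rw [lintegral_tsum fun k => (measurable_const.indicator measurableSet_Icc).aemeasurable]
        congr 1
        funext k
        rw [lintegral_indicator_const measurableSet_Icc]
    _ ≤ ∑' k : ℕ, ENNReal.ofReal (12 * D * (1 / 2) ^ k) := by
        refine ENNReal.tsum_le_tsum fun k => ?_
        refine (mul_le_mul_right (hI (2 ^ k * ε) (by positivity)) _).trans (le_of_eq ?_)
        rw [← ENNReal.ofReal_mul (by positivity)]
        congr 1
        have h4 : (4 : ℝ) ^ k = 2 ^ k * 2 ^ k := by rw [← mul_pow]; norm_num
        rw [h4, one_div, inv_pow]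
        field_simp
        ring
    _ = ENNReal.ofReal (24 * D) := by
        rw [← ENNReal.ofReal_tsum_of_nonneg (fun k => by positivity)
          (summable_geometric_two.mul_left _), tsum_mul_left, tsum_geometric_two]
        congr 1
        ring

/-- For `c ≥ 2` the left side of `Admissible.imaginary_eq` is at least `1`, while a bound on `Im
m(iε)` would send its right side to `0` with `ε`. -/
theorem IsLimitLaw.not_differentiableAt_zero (hc : 2 ≤ c) (h : IsLimitLaw c μ) :
    ¬ DifferentiableAt ℝ (fun t => cdf μ t) 0 := by
  intro hd
  have hc0 : 0 < c := by linarith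
  obtain ⟨K, hK⟩ := im_stieltjesTransform_le_of_differentiableAt hd
  have key : ∀ ε : ℝ, 0 < ε → 1 ≤ ε * (K * (1 + c ^ 2 * K ^ 2)) := by
    intro ε hε
    have hz : 0 < (Complex.I * (ε : ℂ)).im := by simpa using hε
    have ha := h _ hz
    have e := ha.imaginary_eq hc0
    set y := (stieltjesTransform μ (Complex.I * ε)).im
    have hy : 0 ≤ y := ha.im_nonneg
    have hyK : y ≤ K := hK ε hε
    have h1 : 0 ≤ (c ^ 2 - 2 * c) * y ^ 2 := by
      have : 0 ≤ c ^ 2 - 2 * c := by nlinarith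
      positivity
    have hK0 : 0 ≤ K := hy.trans hyK
    calc (1 : ℝ) ≤ ε * y * (1 + c ^ 2 * y ^ 2) := by linarith
      _ = ε * (y * (1 + c ^ 2 * y ^ 2)) := by ring
      _ ≤ ε * (K * (1 + c ^ 2 * K ^ 2)) := by gcongr
  have ht : Tendsto (fun ε : ℝ => ε * (K * (1 + c ^ 2 * K ^ 2))) (𝓝[>] 0) (𝓝 0) := by
    have : Continuous fun ε : ℝ => ε * (K * (1 + c ^ 2 * K ^ 2)) := by fun_prop
    have := this.tendsto 0
    simp only [zero_mul] at this
    exact this.mono_left nhdsWithin_le_nhds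
  have := ge_of_tendsto ht (Filter.Eventually.mono self_mem_nhdsWithin fun ε hε => key ε hε)
  linarith

/-- Differentiability at `0` forces `c < 2`, so every point of differentiability is regular, where
the derivative is the continuous boundary density. -/
theorem IsLimitLaw.continuousOn_deriv (hc : 0 < c) (h : IsLimitLaw c μ) :
    ContinuousOn (deriv fun t => cdf μ t) {x | DifferentiableAt ℝ (fun t => cdf μ t) x} := by
  have hsub : {x | DifferentiableAt ℝ (fun t => cdf μ t) x} ⊆ regularSet c := by
    intro x hx
    by_cases hx0 : x = 0
    · subst hx0
      right
      by_contra hc2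
      exact h.not_differentiableAt_zero (not_lt.mp hc2) hx
    · exact Or.inl hx0
  exact ((h.continuousOn hc).mono hsub).congr fun x hx => (h.hasDerivAt_cdf hc (hsub hx)).deriv

/-- Convergence of Stieltjes transforms to the admissible solution gives weak convergence. -/
theorem exists_limitLaw_of_tendsto (hc : 0 < c) {μs : ℕ → ProbabilityMeasure ℝ}
    (h : ∀ z : ℂ, 0 < z.im → Admissible c z (limitTransform c z) ∧
      Tendsto (fun n => stieltjesTransform (μs n : Measure ℝ) z) atTop (𝓝 (limitTransform c z))) :
    ∃ μ : ProbabilityMeasure ℝ, IsLimitLaw c (μ : Measure ℝ) ∧ Tendsto μs atTop (𝓝 μ) := by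
  have hm : Tendsto (fun T : ℝ => T * (limitTransform c (Complex.I * T)).im) atTop (𝓝 1) := by
    set y : ℝ → ℝ := fun T => (limitTransform c (Complex.I * T)).im with hy
    have hy0 : Tendsto y atTop (𝓝 0) := by
      refine squeeze_zero_norm' ?_ (tendsto_inv_atTop_zero (𝕜 := ℝ))
      filter_upwards [eventually_gt_atTop 0] with T hT
      have hz : 0 < (Complex.I * (T : ℂ)).im := by simpa using hT
      have h1 : ‖limitTransform c (Complex.I * T)‖ ≤ 1 / (Complex.I * (T : ℂ)).im :=
        le_of_tendsto (h _ hz).2.norm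
          (Eventually.of_forall fun n => norm_stieltjesTransform_le _ hz)
      refine (Complex.abs_im_le_norm _).trans (h1.trans (le_of_eq ?_))
      simp
    -- On the imaginary axis the cubic gives `T y = (1 + (c² - 2c) y²)/(1 + c² y²)`, and `y → 0`.
    have h1 : Tendsto (fun T => (1 + (c ^ 2 - 2 * c) * y T ^ 2) / (1 + c ^ 2 * y T ^ 2)) atTop
        (𝓝 ((1 + (c ^ 2 - 2 * c) * 0 ^ 2) / (1 + c ^ 2 * 0 ^ 2))) :=
      (((hy0.pow 2).const_mul _).const_add 1).div (((hy0.pow 2).const_mul _).const_add 1)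
        (by norm_num)
    have e0 : (1 + (c ^ 2 - 2 * c) * (0 : ℝ) ^ 2) / (1 + c ^ 2 * 0 ^ 2) = 1 := by norm_num
    rw [e0] at h1
    refine h1.congr' ?_
    filter_upwards [eventually_gt_atTop 0] with T hT
    have hz : 0 < (Complex.I * (T : ℂ)).im := by simpa using hT
    have e := (h _ hz).1.imaginary_eq hc
    rw [e, mul_div_assoc, div_self (by positivity), mul_one]
  have key := exists_tendsto_of_stieltjesTransform (fun z hz => (h z hz).2) hm
  have law : ∀ μ : ProbabilityMeasure ℝ,
      (∀ z : ℂ, 0 < z.im → stieltjesTransform (μ : Measure ℝ) z = limitTransform c z) →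
      IsLimitLaw c (μ : Measure ℝ) := fun μ hμ z hz => by rw [hμ z hz]; exact (h z hz).1
  obtain ⟨μ, -, hμ⟩ := key (Ultrafilter.of atTop) (Ultrafilter.of_le _)
  refine ⟨μ, law μ hμ, ?_⟩
  rw [tendsto_iff_ultrafilter]
  intro U hU
  obtain ⟨ν, hν, hν'⟩ := key U hU
  have e : (μ : Measure ℝ) = (ν : Measure ℝ) := (law μ hμ).unique hc (law ν hν')
  have : μ = ν := Subtype.ext e
  rw [this]
  exact hν

end LimitLaw

/-! ### Resolvents of sums of random blocks -/

section BlockSum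

variable {ι : Type*} [Fintype ι] [DecidableEq ι] {κ : Type*} [Fintype κ] [DecidableEq κ]

theorem blockSum_isHermitian (s : ℝ) (x : κ → (ι → ℂ) × (ι → ℂ)) :
    (blockSum s x).IsHermitian := isHermitian_sum_block Finset.univ s x

theorem block_zero (s : ℝ) : block s (0 : ι → ℂ) 0 = 0 := by
  simp [block]

/-- A zero pair contributes a zero block, so removing a column becomes an update that keeps the
index type. -/
theorem blockSum_eq_update_add (s : ℝ) (x : κ → (ι → ℂ) × (ι → ℂ)) (k : κ) :
    blockSum s x = blockSum s (Function.update x k 0) + block s (x k).1 (x k).2 := by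
  unfold blockSum
  rw [← Finset.sum_erase_add _ _ (Finset.mem_univ k),
    ← Finset.sum_erase_add (a := k) Finset.univ
      (fun j => block s (Function.update x k 0 j).1 (Function.update x k 0 j).2)
      (Finset.mem_univ k)]
  simp only [Function.update_self, Prod.fst_zero, Prod.snd_zero, block_zero, add_zero]
  congr 1
  refine Finset.sum_congr rfl fun j hj => ?_
  rw [Function.update_of_ne (Finset.ne_of_mem_erase hj)]

/-- Compare both configurations with the one where the pair is zero; each comparison costs `2 / Im
z`, whatever the size of the entries. -/
theorem norm_trace_res_update_sub_le (s : ℝ) {z : ℂ} (hz : 0 < z.im)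
    (x : κ → (ι → ℂ) × (ι → ℂ)) (k : κ) (y : (ι → ℂ) × (ι → ℂ)) :
    ‖(res (blockSum s (Function.update x k y)) z).trace - (res (blockSum s x) z).trace‖ ≤
      4 / z.im := by
  have h1 := norm_trace_res_add_block_le (blockSum_isHermitian s (Function.update x k 0)) hz s
    (x k).1 (x k).2
  have h2 := norm_trace_res_add_block_le (blockSum_isHermitian s (Function.update x k 0)) hz s
    y.1 y.2
  rw [← blockSum_eq_update_add] at h1
  have e := blockSum_eq_update_add s (Function.update x k y) k
  rw [Function.update_idem, Function.update_self] at e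
  rw [← e] at h2
  rw [norm_sub_rev] at h1
  refine (norm_sub_le_norm_sub_add_norm_sub _
    (res (blockSum s (Function.update x k 0)) z).trace _).trans ?_
  have : 4 / z.im = 2 / z.im + 2 / z.im := by ring
  linarith

theorem continuous_res_blockSum (s : ℝ) {z : ℂ} (hz : z.im ≠ 0) :
    Continuous fun x : κ → (ι → ℂ) × (ι → ℂ) => res (blockSum s x) z := by
  have hH : Continuous fun x : κ → (ι → ℂ) × (ι → ℂ) => blockSum s x - z • 1 := by
    unfold blockSum block
    fun_prop
  have hdet : ∀ x : κ → (ι → ℂ) × (ι → ℂ), (blockSum s x - z • 1).det ≠ 0 := fun x =>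
    (isUnit_det_sub_smul (blockSum_isHermitian s x) hz).ne_zero
  unfold res
  simp_rw [Matrix.inv_def, Ring.inverse_eq_inv']
  exact (hH.matrix_det.inv₀ hdet).smul hH.matrix_adjugate

theorem measurable_res_blockSum (s : ℝ) {z : ℂ} (hz : z.im ≠ 0) (i j : ι) :
    Measurable fun x : κ → (ι → ℂ) × (ι → ℂ) => res (blockSum s x) z i j :=
  ((continuous_res_blockSum s hz).matrix_elem i j).measurable

theorem measurable_trace_res_blockSum (s : ℝ) {z : ℂ} (hz : z.im ≠ 0) :
    Measurable fun x : κ → (ι → ℂ) × (ι → ℂ) => (res (blockSum s x) z).trace :=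
  (continuous_res_blockSum s hz).matrix_trace.measurable

end BlockSum

/-! ### Independence of column families and conditioning on an independent variable. -/

section Independence

variable {Ω : Type*} [MeasurableSpace Ω] {P : Measure Ω}

/-- Independence says that the joint law is a product measure; currying a product over `κ × J` gives
a product over `κ` of products over `J`. -/
theorem iIndepFun_curry [IsProbabilityMeasure P] {κ J γ : Type*} [Countable κ] [Countable J]
    [MeasurableSpace γ]
    {x : κ × J → Ω → γ} (hx : ∀ t, Measurable (x t)) (h : iIndepFun x P) :
    iIndepFun (fun k ω j => x (k, j) ω) P := by
  have hm : ∀ k, Measurable fun ω j => x (k, j) ω := fun k =>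
    measurable_pi_lambda _ fun j => hx _
  rw [iIndepFun_iff_map_fun_eq_infinitePi_map hm]
  have hp : ∀ t, IsProbabilityMeasure (P.map (x t)) := fun t =>
    Measure.isProbabilityMeasure_map (hx t).aemeasurable
  have e1 := h.map_fun_eq_infinitePi_map hx
  have e2 : ∀ k, P.map (fun ω j => x (k, j) ω) = Measure.infinitePi fun j => P.map (x (k, j)) :=
    fun k => (h.precomp (g := fun j : J => (k, j)) fun a b hab =>
      (Prod.mk.inj hab).2).map_fun_eq_infinitePi_map fun j => hx _
  simp_rw [e2]
  rw [← Measure.infinitePi_map_curry (fun k j => P.map (x (k, j)))]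
  have e3 : (Measure.infinitePi fun p : κ × J => P.map (x (p.1, p.2))) =
      P.map (fun ω t => x t ω) := e1.symm
  rw [e3, Measure.map_map (MeasurableEquiv.measurable _) (measurable_pi_lambda _ fun t => hx t)]
  rfl

/-- Freezing one of two independent variables. -/
theorem integrable_and_integral_le_of_indepFun [IsProbabilityMeasure P] {E F : Type*}
    [MeasurableSpace E] [MeasurableSpace F] {X : Ω → E} {Y : Ω → F} (hX : Measurable X)
    (hY : Measurable Y) (hi : IndepFun X Y P) {f : E → F → ℝ}
    (hf : Measurable (Function.uncurry f)) (h0 : ∀ x y, 0 ≤ f x y) {C : ℝ}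
    (hint : ∀ x, Integrable (fun ω => f x (Y ω)) P) (hC : ∀ x, ∫ ω, f x (Y ω) ∂P ≤ C) :
    Integrable (fun ω => f (X ω) (Y ω)) P ∧ ∫ ω, f (X ω) (Y ω) ∂P ≤ C := by
  have hC0 : 0 ≤ C := by
    have : Nonempty Ω := P.nonempty_of_neZero
    exact (integral_nonneg fun ω => h0 _ _).trans (hC (X (Classical.arbitrary Ω)))
  have hXY : Measurable fun ω => f (X ω) (Y ω) := hf.comp (hX.prodMk hY)
  have hp : IsProbabilityMeasure (P.map Y) := Measure.isProbabilityMeasure_map hY.aemeasurable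
  have hp' : IsProbabilityMeasure (P.map X) := Measure.isProbabilityMeasure_map hX.aemeasurable
  have key : ∫⁻ ω, ENNReal.ofReal (f (X ω) (Y ω)) ∂P ≤ ENNReal.ofReal C := by
    have e : ∫⁻ ω, ENNReal.ofReal (f (X ω) (Y ω)) ∂P =
        ∫⁻ q : E × F, ENNReal.ofReal (Function.uncurry f q) ∂(P.map fun ω => (X ω, Y ω)) := by
      rw [lintegral_map hf.ennreal_ofReal (hX.prodMk hY)]
      rfl
    rw [e, hi.map_prod_eq_prod_map_map hX.aemeasurable hY.aemeasurable,
      lintegral_prod _ hf.ennreal_ofReal.aemeasurable]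
    calc ∫⁻ x, ∫⁻ y, ENNReal.ofReal (Function.uncurry f (x, y)) ∂(P.map Y) ∂(P.map X)
        ≤ ∫⁻ _, ENNReal.ofReal C ∂(P.map X) := by
          refine lintegral_mono fun x => ?_
          have hfx : Measurable fun y => ENNReal.ofReal (Function.uncurry f (x, y)) :=
            hf.ennreal_ofReal.comp measurable_prodMk_left
          rw [lintegral_map hfx hY]
          have := ofReal_integral_eq_lintegral_ofReal (hint x)
            (Eventually.of_forall fun ω => h0 x (Y ω))
          exact this.symm.le.trans (ENNReal.ofReal_le_ofReal (hC x))
      _ = ENNReal.ofReal C := by simp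
  have hI : Integrable (fun ω => f (X ω) (Y ω)) P := by
    refine ⟨hXY.aestronglyMeasurable, ?_⟩
    rw [hasFiniteIntegral_iff_ofReal (Eventually.of_forall fun ω => h0 _ _)]
    exact key.trans_lt ENNReal.ofReal_lt_top
  refine ⟨hI, ?_⟩
  rw [← ofReal_integral_eq_lintegral_ofReal hI (Eventually.of_forall fun ω => h0 _ _)] at key
  exact (ENNReal.ofReal_le_ofReal_iff hC0).mp key

end Independence

/-! ### The approximate cubic equation -/

section ApproximateEquation

variable {ι : Type*}

/-- The two vectors of a pair, indexed by the Booleans. -/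
def leg (u : Bool) (x : (ι → ℂ) × (ι → ℂ)) : ι → ℂ := bif u then x.1 else x.2

@[fun_prop]
theorem measurable_leg (u : Bool) : Measurable (leg u : (ι → ℂ) × (ι → ℂ) → ι → ℂ) := by
  cases u
  · exact measurable_snd
  · exact measurable_fst

variable {Ω : Type*} [MeasurableSpace Ω] {P : Measure Ω} [IsProbabilityMeasure P]

/-- A pair of random vectors with independent, centred, normalized entries whose fourth moments
are bounded by `M`. -/
structure IsStdPair (P : Measure Ω) (M : ℝ) (X : Ω → (ι → ℂ) × (ι → ℂ)) : Prop where
  std : IsStdFamily P fun (t : Bool × ι) ω => leg t.1 (X ω) t.2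
  integrable_fourth : ∀ t : Bool × ι, Integrable (fun ω => ‖leg t.1 (X ω) t.2‖ ^ 4) P
  fourth_le : ∀ t : Bool × ι, ∫ ω, ‖leg t.1 (X ω) t.2‖ ^ 4 ∂P ≤ M

variable [Fintype ι]

/-- The centred quadratic form of the two vectors of a pair. -/
def centredForm (G : Matrix ι ι ℂ) (u w : Bool) (x : (ι → ℂ) × (ι → ℂ)) : ℂ :=
  star (leg u x) ⬝ᵥ (G *ᵥ leg w x) - if u = w then G.trace else 0

/-- All four forms are quadratic forms in the concatenated family over `Bool × ι`, with `G` placed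
in the block `(u, w)`. Only diagonal blocks contribute a trace. -/
theorem IsStdPair.centredForm_bound {M : ℝ} (hM : 1 ≤ M) {X : Ω → (ι → ℂ) × (ι → ℂ)}
    (h : IsStdPair P M X) (G : Matrix ι ι ℂ) (u w : Bool) :
    Integrable (fun ω => ‖centredForm G u w (X ω)‖ ^ 2) P ∧
      ∫ ω, ‖centredForm G u w (X ω)‖ ^ 2 ∂P ≤ 3 * M * ∑ i, ∑ j, ‖G i j‖ ^ 2 := by
  have key := h.std.quadratic hM h.integrable_fourth h.fourth_le
    (fun t t' => if t.1 = u ∧ t'.1 = w then G t.2 t'.2 else 0) Finset.univ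
  have e1 : ∀ ω, ∑ i : Bool × ι, ∑ j : Bool × ι, star (leg i.1 (X ω) i.2) *
      (if i.1 = u ∧ j.1 = w then G i.2 j.2 else 0) * leg j.1 (X ω) j.2 -
        ∑ i : Bool × ι, (if i.1 = u ∧ i.1 = w then G i.2 i.2 else 0) =
      centredForm G u w (X ω) := by
    intro ω
    simp only [Fintype.sum_prod_type, Fintype.sum_bool, centredForm, dotProduct, mulVec,
      Matrix.trace, Matrix.diag, Finset.mul_sum, Pi.star_apply]
    cases u <;> cases w <;> simp [mul_assoc]
  have e2 : ∑ i : Bool × ι, ∑ j : Bool × ι,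
      ‖(if i.1 = u ∧ j.1 = w then G i.2 j.2 else 0 : ℂ)‖ ^ 2 = ∑ i, ∑ j, ‖G i j‖ ^ 2 := by
    simp only [Fintype.sum_prod_type, Fintype.sum_bool]
    cases u <;> cases w <;> simp
  simp_rw [e1, e2] at key
  exact ⟨MemLp.integrable_norm_sq_two key.1, key.2⟩

/-- The total squared length of a pair of vectors. -/
def pairNormSq (x : (ι → ℂ) × (ι → ℂ)) : ℝ := normSq x.1 + normSq x.2

theorem pairNormSq_nonneg (x : (ι → ℂ) × (ι → ℂ)) : 0 ≤ pairNormSq x :=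
  add_nonneg (normSq_nonneg _) (normSq_nonneg _)

theorem pairNormSq_eq (x : (ι → ℂ) × (ι → ℂ)) :
    pairNormSq x = ∑ t : Bool × ι, ‖leg t.1 x t.2‖ ^ 2 := by
  simp [pairNormSq, normSq, Fintype.sum_prod_type, leg]

theorem IsStdPair.pairNormSq_bound {M : ℝ} {X : Ω → (ι → ℂ) × (ι → ℂ)} (h : IsStdPair P M X) :
    Integrable (fun ω => pairNormSq (X ω) ^ 2) P ∧
      ∫ ω, pairNormSq (X ω) ^ 2 ∂P ≤ 4 * (Fintype.card ι : ℝ) ^ 2 * M := by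
  have hcard : ((Finset.univ : Finset (Bool × ι)).card : ℝ) = 2 * Fintype.card ι := by
    simp
  have hle : ∀ ω, pairNormSq (X ω) ^ 2 ≤
      2 * Fintype.card ι * ∑ t : Bool × ι, ‖leg t.1 (X ω) t.2‖ ^ 4 := by
    intro ω
    rw [pairNormSq_eq, ← hcard]
    refine (sq_sum_le_card_mul_sum_sq).trans (le_of_eq ?_)
    congr 1
    exact Finset.sum_congr rfl fun t _ => by ring
  have hI : Integrable (fun ω => 2 * (Fintype.card ι : ℝ) *
      ∑ t : Bool × ι, ‖leg t.1 (X ω) t.2‖ ^ 4) P :=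
    (integrable_finsetSum _ fun t _ => h.integrable_fourth t).const_mul _
  have hm : AEStronglyMeasurable (fun ω => pairNormSq (X ω) ^ 2) P := by
    simp_rw [pairNormSq_eq]
    have := h.std.meas
    exact (Measurable.pow_const (Finset.measurable_sum _ fun t _ =>
      ((this t).norm.pow_const 2)) 2).aestronglyMeasurable
  have hI' : Integrable (fun ω => pairNormSq (X ω) ^ 2) P :=
    hI.mono' hm (Eventually.of_forall fun ω => by
      rw [Real.norm_of_nonneg (sq_nonneg _)]; exact hle ω)
  refine ⟨hI', (integral_mono hI' hI hle).trans ?_⟩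
  rw [integral_const_mul, integral_finsetSum _ fun t _ => h.integrable_fourth t]
  calc 2 * (Fintype.card ι : ℝ) * ∑ t : Bool × ι, ∫ ω, ‖leg t.1 (X ω) t.2‖ ^ 4 ∂P
      ≤ 2 * (Fintype.card ι : ℝ) * ∑ t : Bool × ι, M := by
        gcongr with t
        exact h.fourth_le t
    _ = 4 * (Fintype.card ι : ℝ) ^ 2 * M := by
        rw [Finset.sum_const, nsmul_eq_mul, hcard]; ring

/-- If `α = β = τ` and `γ = δ = 0`, the system gives `Y(1 - τ²) = -iτ²` and `W(1 - τ²) = iτ²`, so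
the left side vanishes. Never dividing by `1 - τ²` avoids any need for a lower bound on it. -/
theorem norm_pair_equation_le {α β γ δ X Y W V τ : ℂ} {T K : ℝ}
    (hX : X = α + Complex.I * (α * Y - γ * X)) (hY : Y = δ + Complex.I * (δ * Y - β * X))
    (hW : W = γ + Complex.I * (α * V - γ * W)) (hV : V = β + Complex.I * (δ * V - β * W))
    (hT : ‖τ‖ ≤ T) (kX : 1 + ‖X‖ ≤ K) (kY : 1 + ‖Y‖ ≤ K) (kW : 1 + ‖W‖ ≤ K)
    (kV : 1 + ‖V‖ ≤ K) :
    ‖-Complex.I * (Y - W) * (1 - τ ^ 2) + 2 * τ ^ 2‖ ≤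
      (1 + T) * ((‖α - τ‖ + ‖β - τ‖ + ‖γ‖ + ‖δ‖) * K) := by
  set e1 := δ * (1 + Complex.I * Y) - Complex.I * (β - τ) * X with he1
  set e2 := (α - τ) * (1 + Complex.I * Y) - Complex.I * γ * X with he2
  set f1 := γ * (1 - Complex.I * W) + Complex.I * (α - τ) * V with hf1
  set f2 := (β - τ) * (1 - Complex.I * W) + Complex.I * δ * V with hf2
  have hI2 : Complex.I ^ 2 = -1 := Complex.I_sq
  have eX : X = τ + Complex.I * τ * Y + e2 := by linear_combination hX
  have eY : Y = e1 - Complex.I * τ * X := by linear_combination hY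
  have eW : W = Complex.I * τ * V + f1 := by linear_combination hW
  have eV : V = τ - Complex.I * τ * W + f2 := by linear_combination hV
  have h1 : Y * (1 - τ ^ 2) + Complex.I * τ ^ 2 = e1 - Complex.I * τ * e2 := by
    linear_combination eY - Complex.I * τ * eX - τ ^ 2 * Y * hI2
  have h2 : W * (1 - τ ^ 2) - Complex.I * τ ^ 2 = f1 + Complex.I * τ * f2 := by
    linear_combination eW + Complex.I * τ * eV - τ ^ 2 * W * hI2
  have e : -Complex.I * (Y - W) * (1 - τ ^ 2) + 2 * τ ^ 2 =
      -Complex.I * ((e1 - Complex.I * τ * e2) - (f1 + Complex.I * τ * f2)) := by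
    linear_combination -Complex.I * (h1 - h2) + 2 * τ ^ 2 * hI2
  have n1 : ∀ u v : ℂ, 1 + ‖u‖ ≤ K → 1 + ‖v‖ ≤ K → ∀ a b : ℂ, ∀ σ : ℂ, ‖σ‖ = 1 →
      ∀ σ' : ℂ, ‖σ'‖ = 1 → ‖a * (1 + σ * u) + σ' * b * v‖ ≤ (‖a‖ + ‖b‖) * K := by
    intro u v hu hv a b σ hσ σ' hσ'
    have h1 : ‖1 + σ * u‖ ≤ K := by
      refine (norm_add_le _ _).trans ?_
      rw [norm_mul, hσ, norm_one, one_mul]; exact hu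
    have h2 : ‖v‖ ≤ K := by linarith
    calc ‖a * (1 + σ * u) + σ' * b * v‖ ≤ ‖a * (1 + σ * u)‖ + ‖σ' * b * v‖ := norm_add_le _ _
      _ = ‖a‖ * ‖1 + σ * u‖ + ‖b‖ * ‖v‖ := by simp [hσ']
      _ ≤ ‖a‖ * K + ‖b‖ * K := by gcongr
      _ = _ := by ring
  have b1 : ‖e1‖ ≤ (‖δ‖ + ‖β - τ‖) * K := by
    have := n1 Y X kY kX δ (β - τ) Complex.I (by simp) (-Complex.I) (by simp)
    rwa [show δ * (1 + Complex.I * Y) + -Complex.I * (β - τ) * X = e1 by rw [he1]; ring] at this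
  have b2 : ‖e2‖ ≤ (‖α - τ‖ + ‖γ‖) * K := by
    have := n1 Y X kY kX (α - τ) γ Complex.I (by simp) (-Complex.I) (by simp)
    rwa [show (α - τ) * (1 + Complex.I * Y) + -Complex.I * γ * X = e2 by rw [he2]; ring] at this
  have b3 : ‖f1‖ ≤ (‖γ‖ + ‖α - τ‖) * K := by
    have := n1 W V kW kV γ (α - τ) (-Complex.I) (by simp) Complex.I (by simp)
    rwa [show γ * (1 + -Complex.I * W) + Complex.I * (α - τ) * V = f1 by rw [hf1]; ring] at this
  have b4 : ‖f2‖ ≤ (‖β - τ‖ + ‖δ‖) * K := by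
    have := n1 W V kW kV (β - τ) δ (-Complex.I) (by simp) Complex.I (by simp)
    rwa [show (β - τ) * (1 + -Complex.I * W) + Complex.I * δ * V = f2 by rw [hf2]; ring] at this
  have hT0 : 0 ≤ T := (norm_nonneg _).trans hT
  rw [e, norm_mul, norm_neg, Complex.norm_I, one_mul]
  calc ‖(e1 - Complex.I * τ * e2) - (f1 + Complex.I * τ * f2)‖
      ≤ ‖e1 - Complex.I * τ * e2‖ + ‖f1 + Complex.I * τ * f2‖ := norm_sub_le _ _
    _ ≤ (‖e1‖ + ‖Complex.I * τ * e2‖) + (‖f1‖ + ‖Complex.I * τ * f2‖) :=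
        add_le_add (norm_sub_le _ _) (norm_add_le _ _)
    _ = (‖e1‖ + ‖f1‖) + ‖τ‖ * (‖e2‖ + ‖f2‖) := by
        simp only [norm_mul, Complex.norm_I, one_mul]; ring
    _ ≤ ((‖δ‖ + ‖β - τ‖) * K + (‖γ‖ + ‖α - τ‖) * K) +
        T * ((‖α - τ‖ + ‖γ‖) * K + (‖β - τ‖ + ‖δ‖) * K) := by gcongr
    _ = _ := by ring

end ApproximateEquation

/-! ### The approximate equation contributed by a single column pair. -/

section ColumnEquation

variable {ι : Type*} [Fintype ι] [DecidableEq ι] {κ : Type*} [Fintype κ] [DecidableEq κ]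

theorem norm_form_res_le_pairNormSq {H : Matrix ι ι ℂ} (hH : H.IsHermitian) {z : ℂ}
    (hz : 0 < z.im) (u w : Bool) (x : (ι → ℂ) × (ι → ℂ)) :
    ‖star (leg u x) ⬝ᵥ (res H z *ᵥ leg w x)‖ ≤ pairNormSq x / z.im := by
  have h := norm_form_res_sq_le hH hz (leg u x) (leg w x)
  have h1 := normSq_nonneg x.1
  have h2 := normSq_nonneg x.2
  have hl : ∀ u : Bool, normSq (leg u x) ≤ pairNormSq x := by
    intro u
    unfold pairNormSq
    cases u <;> simp [leg, h1, h2]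
  refine abs_le_of_sq_le_sq' ?_ (div_nonneg (pairNormSq_nonneg x) hz.le) |>.2
  refine h.trans ?_
  rw [div_pow, sq (pairNormSq x)]
  gcongr
  · exact normSq_nonneg _
  · exact pairNormSq_nonneg _
  · exact hl u
  · exact hl w

/-- The size of the centred forms of the `k`-th pair in the resolvent without that pair. -/
def formDefect (s : ℝ) (z : ℂ) (k : κ) (x : κ → (ι → ℂ) × (ι → ℂ)) : ℝ :=
  ∑ u, ∑ w, ‖centredForm (res (blockSum s (Function.update x k 0)) z) u w (x k)‖ ^ 2

theorem norm_column_equation_le {s : ℝ} (hs : 0 ≤ s) {z : ℂ} (hz : 0 < z.im)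
    (x : κ → (ι → ℂ) × (ι → ℂ)) (k : κ) {θ : ℝ} (hθ : 0 < θ) :
    ‖-Complex.I * s * (star (x k).2 ⬝ᵥ (res (blockSum s x) z *ᵥ (x k).1) -
        star (x k).1 ⬝ᵥ (res (blockSum s x) z *ᵥ (x k).2)) *
          (1 - (s * (res (blockSum s x) z).trace) ^ 2) +
        2 * (s * (res (blockSum s x) z).trace) ^ 2‖ ≤
      (1 + s * Fintype.card ι / z.im) / 2 *
        (θ * (8 * s ^ 2 * formDefect s z k x + 32 * s ^ 4 * pairNormSq (x k) ^ 2 / z.im ^ 4) +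
          (2 + 2 * s ^ 2 * pairNormSq (x k) ^ 2 / z.im ^ 2) / θ) := by
  set H := blockSum s (Function.update x k 0) with hHdef
  have hH : H.IsHermitian := blockSum_isHermitian s _
  have hR : (blockSum s x).IsHermitian := blockSum_isHermitian s _
  have hblock : blockSum s x = H + block s (x k).1 (x k).2 := blockSum_eq_update_add s x k
  have hform := fun y w => form_res_add_block hH hz s (x k).1 (x k).2 y w
  have htr := norm_trace_res_add_block_sub_le hH hz hs (x k).1 (x k).2
  have hTr := norm_trace_res_le hR hz
  rw [← hblock] at htr
  simp_rw [← hblock] at hform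
  set R := res (blockSum s x) z
  set G := res H z
  set a := (x k).1
  set b := (x k).2
  set v := z.im
  set N := pairNormSq (x k) with hN
  have hN0 : 0 ≤ N := pairNormSq_nonneg _
  have hb : ∀ u w : Bool, ‖(s : ℂ) * (star (leg u (x k)) ⬝ᵥ (R *ᵥ leg w (x k)))‖ ≤ s * N / v := by
    intro u w
    rw [norm_mul, Complex.norm_real, Real.norm_of_nonneg hs, mul_div_assoc]
    gcongr
    exact norm_form_res_le_pairNormSq hR hz u w (x k)
  have hT : ‖(s : ℂ) * R.trace‖ ≤ s * Fintype.card ι / v := by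
    rw [norm_mul, Complex.norm_real, Real.norm_of_nonneg hs, mul_div_assoc]
    gcongr
  have key := norm_pair_equation_le (α := s * (star a ⬝ᵥ (G *ᵥ a)))
    (β := s * (star b ⬝ᵥ (G *ᵥ b))) (γ := s * (star a ⬝ᵥ (G *ᵥ b)))
    (δ := s * (star b ⬝ᵥ (G *ᵥ a))) (X := s * (star a ⬝ᵥ (R *ᵥ a)))
    (Y := s * (star b ⬝ᵥ (R *ᵥ a))) (W := s * (star a ⬝ᵥ (R *ᵥ b)))
    (V := s * (star b ⬝ᵥ (R *ᵥ b))) (τ := s * R.trace)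
    (K := 1 + s * N / v)
    (by linear_combination s * hform a a) (by linear_combination s * hform b a)
    (by linear_combination s * hform a b) (by linear_combination s * hform b b) hT
    (add_le_add le_rfl (hb true true)) (add_le_add le_rfl (hb false true))
    (add_le_add le_rfl (hb true false)) (add_le_add le_rfl (hb false false))
  rw [← mul_sub, ← mul_assoc] at key
  refine key.trans ?_
  set D := ‖(s : ℂ) * (star a ⬝ᵥ (G *ᵥ a)) - s * R.trace‖ +
    ‖(s : ℂ) * (star b ⬝ᵥ (G *ᵥ b)) - s * R.trace‖ + ‖(s : ℂ) * (star a ⬝ᵥ (G *ᵥ b))‖ +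
    ‖(s : ℂ) * (star b ⬝ᵥ (G *ᵥ a))‖ with hD
  set K := 1 + s * N / v with hK
  have hT0 : 0 ≤ s * Fintype.card ι / v := by positivity
  have htr2 : ‖(s : ℂ) * (G.trace - R.trace)‖ ^ 2 ≤ (s * (s * N / v ^ 2)) ^ 2 := by
    rw [norm_mul, Complex.norm_real, Real.norm_of_nonneg hs, norm_sub_rev]
    gcongr
    exact htr
  have hdiag : ∀ q : ℂ, ‖(s : ℂ) * q - s * R.trace‖ ^ 2 ≤
      2 * s ^ 2 * ‖q - G.trace‖ ^ 2 + 2 * (s * (s * N / v ^ 2)) ^ 2 := by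
    intro q
    have e : (s : ℂ) * q - s * R.trace = s * (q - G.trace) + s * (G.trace - R.trace) := by ring
    have h1 : ‖(s : ℂ) * (q - G.trace)‖ ^ 2 = s ^ 2 * ‖q - G.trace‖ ^ 2 := by
      rw [norm_mul, Complex.norm_real, Real.norm_of_nonneg hs, mul_pow]
    have h2 : ‖(s : ℂ) * q - s * R.trace‖ ^ 2 ≤
        (‖(s : ℂ) * (q - G.trace)‖ + ‖(s : ℂ) * (G.trace - R.trace)‖) ^ 2 := by
      rw [e]; gcongr; exact norm_add_le _ _
    nlinarith [sq_nonneg (‖(s : ℂ) * (q - G.trace)‖ - ‖(s : ℂ) * (G.trace - R.trace)‖)]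
  have hoff : ∀ q : ℂ, ‖(s : ℂ) * q‖ ^ 2 ≤
      2 * s ^ 2 * ‖q‖ ^ 2 + 2 * (s * (s * N / v ^ 2)) ^ 2 := by
    intro q
    rw [norm_mul, Complex.norm_real, Real.norm_of_nonneg hs, mul_pow]
    nlinarith [mul_nonneg (sq_nonneg s) (sq_nonneg ‖q‖), sq_nonneg (s * (s * N / v ^ 2))]
  have hS : formDefect s z k x = ‖star a ⬝ᵥ (G *ᵥ a) - G.trace‖ ^ 2 +
      ‖star a ⬝ᵥ (G *ᵥ b)‖ ^ 2 + (‖star b ⬝ᵥ (G *ᵥ a)‖ ^ 2 +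
        ‖star b ⬝ᵥ (G *ᵥ b) - G.trace‖ ^ 2) := by
    simp [formDefect, centredForm, leg, G, H, a, b]
  have hD2 : D ^ 2 ≤ 8 * s ^ 2 * formDefect s z k x + 32 * s ^ 4 * N ^ 2 / v ^ 4 := by
    have h4 : ∀ p q r t : ℝ, (p + q + r + t) ^ 2 ≤ 4 * (p ^ 2 + q ^ 2 + r ^ 2 + t ^ 2) := by
      intro p q r t
      nlinarith [sq_nonneg (p - q), sq_nonneg (p - r), sq_nonneg (p - t), sq_nonneg (q - r),
        sq_nonneg (q - t), sq_nonneg (r - t)]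
    have e : 32 * s ^ 4 * N ^ 2 / v ^ 4 = 32 * (s * (s * N / v ^ 2)) ^ 2 := by
      have : v ≠ 0 := hz.ne'
      field_simp
    rw [hD, hS, e]
    refine (h4 _ _ _ _).trans ?_
    linarith [hdiag (star a ⬝ᵥ (G *ᵥ a)), hdiag (star b ⬝ᵥ (G *ᵥ b)),
      hoff (star a ⬝ᵥ (G *ᵥ b)), hoff (star b ⬝ᵥ (G *ᵥ a))]
  have hK2 : K ^ 2 ≤ 2 + 2 * s ^ 2 * N ^ 2 / v ^ 2 := by
    have e : 2 * s ^ 2 * N ^ 2 / v ^ 2 = 2 * (s * N / v) ^ 2 := by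
      have : v ≠ 0 := hz.ne'
      field_simp
    rw [hK, e]
    nlinarith [sq_nonneg (1 - s * N / v)]
  -- Weighted arithmetic-geometric mean: only second moments of `D` and `K` are then needed, and `θ`
  -- stays free to balance their sizes.
  have hDK : D * K ≤ (θ * D ^ 2 + K ^ 2 / θ) / 2 := by
    have e : θ * D ^ 2 + K ^ 2 / θ - 2 * (D * K) = (θ * D - K) ^ 2 / θ := by
      field_simp
      ring
    have : 0 ≤ (θ * D - K) ^ 2 / θ := by positivity
    linarith
  calc (1 + s * Fintype.card ι / v) * (D * K)
      ≤ (1 + s * Fintype.card ι / v) * ((θ * D ^ 2 + K ^ 2 / θ) / 2) := by gcongr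
    _ ≤ (1 + s * Fintype.card ι / v) * ((θ * (8 * s ^ 2 * formDefect s z k x +
        32 * s ^ 4 * N ^ 2 / v ^ 4) + (2 + 2 * s ^ 2 * N ^ 2 / v ^ 2) / θ) / 2) := by gcongr
    _ = _ := by ring

variable {Ω : Type*} [MeasurableSpace Ω] {P : Measure Ω} [IsProbabilityMeasure P]

/-- The resolvent without pair `k` is independent of that pair, so it may be frozen; its squared
Frobenius norm is at most `p/(Im z)²`. Four forms with constant `3M` give `12M`. -/
theorem formDefect_bound {s : ℝ} {z : ℂ} (hz : 0 < z.im) {M : ℝ} (hM : 1 ≤ M)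
    {X : κ → Ω → (ι → ℂ) × (ι → ℂ)} (hX : ∀ k, Measurable (X k)) (hi : iIndepFun X P)
    (h : ∀ k, IsStdPair P M (X k)) (k : κ) :
    Integrable (fun ω => formDefect s z k fun j => X j ω) P ∧
      ∫ ω, formDefect s z k (fun j => X j ω) ∂P ≤ 12 * M * (Fintype.card ι / z.im ^ 2) := by
  have hXm : Measurable fun ω j => X j ω := measurable_pi_lambda _ hX
  have hupd : Measurable fun x : κ → (ι → ℂ) × (ι → ℂ) => Function.update x k 0 := by
    fun_prop
  have hind : IndepFun (fun ω => Function.update (fun j => X j ω) k 0) (X k) P := by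
    refine indepFun_of_finset_of_notMem hX hi (s := {k}ᶜ) (t := {k}) ?_
      (F := fun x => Function.update x k 0) (F' := fun x => x k) hupd ?_
      (measurable_pi_apply k) ?_
    · exact disjoint_compl_left
    · intro y y' hy
      funext j
      by_cases hj : j = k
      · subst hj; simp
      · simp [hj, hy j (by simpa using hj)]
    · intro y y' hy
      exact hy k (by simp)
  have key : ∀ u w : Bool,
      Integrable (fun ω => ‖centredForm (res (blockSum s
        (Function.update (fun j => X j ω) k 0)) z) u w (X k ω)‖ ^ 2) P ∧
      ∫ ω, ‖centredForm (res (blockSum s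
        (Function.update (fun j => X j ω) k 0)) z) u w (X k ω)‖ ^ 2 ∂P ≤
          3 * M * (Fintype.card ι / z.im ^ 2) := by
    intro u w
    refine integrable_and_integral_le_of_indepFun (hupd.comp hXm) (hX k) hind
      (f := fun x y => ‖centredForm (res (blockSum s x) z) u w y‖ ^ 2) ?_
      (fun x y => sq_nonneg _) (fun x => ((h k).centredForm_bound hM _ u w).1)
      (fun x => ((h k).centredForm_bound hM _ u w).2.trans ?_)
    · have hr := fun i j => measurable_res_blockSum (ι := ι) (κ := κ) s hz.ne' i j
      have ht := measurable_trace_res_blockSum (ι := ι) (κ := κ) s hz.ne'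
      have hleg : ∀ u i, Measurable fun q : (κ → (ι → ℂ) × (ι → ℂ)) × ((ι → ℂ) × (ι → ℂ)) =>
          leg u q.2 i := fun u i =>
        (measurable_pi_apply i).comp ((measurable_leg u).comp measurable_snd)
      unfold centredForm dotProduct mulVec dotProduct
      refine Measurable.pow_const (Measurable.norm (Measurable.sub ?_ ?_)) 2
      · refine Finset.measurable_sum _ fun i _ => ?_
        refine (measurable_complex_star.comp (hleg u i)).mul
          (Finset.measurable_sum _ fun j _ => ?_)
        exact ((hr i j).comp measurable_fst).mul (hleg w j)
      · by_cases huw : u = w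
        · simp only [huw, if_true]; exact ht.comp measurable_fst
        · simp only [huw, if_false]; exact measurable_const
    · gcongr
      exact sum_norm_res_sq_le (blockSum_isHermitian s x) hz
  unfold formDefect
  refine ⟨integrable_finsetSum _ fun u _ => integrable_finsetSum _ fun w _ => (key u w).1, ?_⟩
  rw [integral_finsetSum _ fun u _ => integrable_finsetSum _ fun w _ => (key u w).1]
  simp_rw [integral_finsetSum _ fun w _ => (key _ w).1]
  calc _ ≤ ∑ u : Bool, ∑ w : Bool, 3 * M * (Fintype.card ι / z.im ^ 2) :=
        Finset.sum_le_sum fun u _ => Finset.sum_le_sum fun w _ => (key u w).2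
    _ = _ := by simp; ring

end ColumnEquation

/-! ### The approximate cubic for the normalized trace, in mean. -/

section MeanEquation

/-- The normalized trace of the resolvent of the Hermitian matrix built from the columns `x`. -/
def traceMean {ι : Type*} [Fintype ι] [DecidableEq ι] {n : ℕ} (z : ℂ)
    (x : Fin n → (ι → ℂ) × (ι → ℂ)) : ℂ :=
  (Fintype.card ι : ℂ)⁻¹ * (res (blockSum ((n : ℝ)⁻¹) x) z).trace

/-- The left-hand side of the cubic equation. -/
def cubicDefect (y : ℝ) (z m : ℂ) : ℂ := (1 + z * m) * (1 - (y : ℂ) ^ 2 * m ^ 2) + 2 * y * m ^ 2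

theorem norm_cubicDefect_sub_le {y Y : ℝ} (hy : |y| ≤ Y) (z : ℂ) {m m' : ℂ} {K : ℝ}
    (hm : ‖m‖ ≤ K) (hm' : ‖m'‖ ≤ K) :
    ‖cubicDefect y z m - cubicDefect y z m'‖ ≤
      ‖m - m'‖ * (‖z‖ + 2 * Y ^ 2 * K + 3 * ‖z‖ * Y ^ 2 * K ^ 2 + 4 * Y * K) := by
  have e : cubicDefect y z m - cubicDefect y z m' = (m - m') * (z - (y : ℂ) ^ 2 * (m + m') -
      z * (y : ℂ) ^ 2 * (m ^ 2 + m * m' + m' ^ 2) + 2 * y * (m + m')) := by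
    unfold cubicDefect; ring
  have hK : 0 ≤ K := (norm_nonneg _).trans hm
  have hY : 0 ≤ Y := (abs_nonneg _).trans hy
  have h1 : ‖m + m'‖ ≤ 2 * K := (norm_add_le _ _).trans (by linarith)
  have h2 : ‖m ^ 2 + m * m' + m' ^ 2‖ ≤ 3 * K ^ 2 := by
    refine (norm_add₃_le).trans ?_
    rw [norm_mul, norm_pow, norm_pow]
    have : ‖m‖ ^ 2 ≤ K ^ 2 := by gcongr
    have : ‖m'‖ ^ 2 ≤ K ^ 2 := by gcongr
    have : ‖m‖ * ‖m'‖ ≤ K * K := by gcongr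
    nlinarith
  have hyn : ‖(y : ℂ)‖ ≤ Y := by rw [Complex.norm_real]; exact hy
  rw [e, norm_mul]
  refine mul_le_mul_of_nonneg_left ?_ (norm_nonneg _)
  calc _ ≤ ‖z‖ + ‖(y : ℂ) ^ 2 * (m + m')‖ + ‖z * (y : ℂ) ^ 2 * (m ^ 2 + m * m' + m' ^ 2)‖ +
        ‖2 * (y : ℂ) * (m + m')‖ :=
        (norm_add_le _ _).trans (add_le_add ((norm_sub_le _ _).trans
          (add_le_add (norm_sub_le _ _) le_rfl)) le_rfl)
    _ = ‖z‖ + ‖(y : ℂ)‖ ^ 2 * ‖m + m'‖ + ‖z‖ * ‖(y : ℂ)‖ ^ 2 * ‖m ^ 2 + m * m' + m' ^ 2‖ +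
        2 * ‖(y : ℂ)‖ * ‖m + m'‖ := by simp only [norm_mul, norm_pow, Complex.norm_ofNat]
    _ ≤ ‖z‖ + Y ^ 2 * (2 * K) + ‖z‖ * Y ^ 2 * (3 * K ^ 2) + 2 * Y * (2 * K) := by gcongr
    _ = _ := by ring

variable {ι : Type*} [Fintype ι] [DecidableEq ι] {n : ℕ}

theorem norm_traceMean_le {z : ℂ} (hz : 0 < z.im) (x : Fin n → (ι → ℂ) × (ι → ℂ)) :
    ‖traceMean z x‖ ≤ 1 / z.im := by
  unfold traceMean
  rw [norm_mul, norm_inv, Complex.norm_natCast]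
  rcases (Fintype.card ι).eq_zero_or_pos with h | h
  · rw [h]; simp [hz.le]
  · have := norm_trace_res_le (blockSum_isHermitian ((n : ℝ)⁻¹) x) hz
    calc ((Fintype.card ι : ℝ))⁻¹ * ‖(res (blockSum ((n : ℝ)⁻¹) x) z).trace‖
        ≤ ((Fintype.card ι : ℝ))⁻¹ * (Fintype.card ι / z.im) := by gcongr
      _ = 1 / z.im := by
        have : (Fintype.card ι : ℝ) ≠ 0 := by positivity
        field_simp

theorem measurable_traceMean {z : ℂ} (hz : 0 < z.im) :
    Measurable fun x : Fin n → (ι → ℂ) × (ι → ℂ) => traceMean z x :=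
  (measurable_trace_res_blockSum _ hz.ne').const_mul _

theorem norm_traceMean_update_sub_le {z : ℂ} (hz : 0 < z.im) (x : Fin n → (ι → ℂ) × (ι → ℂ))
    (k : Fin n) (y : (ι → ℂ) × (ι → ℂ)) :
    ‖traceMean z (Function.update x k y) - traceMean z x‖ ≤ 4 / (z.im * Fintype.card ι) := by
  unfold traceMean
  rw [← mul_sub, norm_mul, norm_inv, Complex.norm_natCast]
  calc _ ≤ ((Fintype.card ι : ℝ))⁻¹ * (4 / z.im) := by
        gcongr
        exact norm_trace_res_update_sub_le _ hz x k y
    _ = _ := by rw [div_mul_eq_div_div_swap, div_eq_mul_inv, div_eq_mul_inv, div_eq_mul_inv]; ring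

/-- With `y = p/n` the product `y m` is `tr R / n`, so by the trace identity the `n` column
equations add up to `p` times the cubic. -/
theorem card_mul_cubicDefect_traceMean (hn : 0 < n) (hp : 0 < Fintype.card ι) {z : ℂ}
    (hz : 0 < z.im) (x : Fin n → (ι → ℂ) × (ι → ℂ)) :
    (Fintype.card ι : ℂ) * cubicDefect (Fintype.card ι / n) z (traceMean z x) =
      ∑ k, (-Complex.I * ((n : ℝ)⁻¹ : ℝ) *
        (star (x k).2 ⬝ᵥ (res (blockSum ((n : ℝ)⁻¹) x) z *ᵥ (x k).1) -
        star (x k).1 ⬝ᵥ (res (blockSum ((n : ℝ)⁻¹) x) z *ᵥ (x k).2)) *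
          (1 - (((n : ℝ)⁻¹ : ℝ) * (res (blockSum ((n : ℝ)⁻¹) x) z).trace) ^ 2) +
        2 * (((n : ℝ)⁻¹ : ℝ) * (res (blockSum ((n : ℝ)⁻¹) x) z).trace) ^ 2) := by
  have h := card_add_mul_trace_res ((n : ℝ)⁻¹) x hz
  rw [Finset.sum_add_distrib, ← Finset.sum_mul, ← h, Finset.sum_const, Finset.card_univ,
    Fintype.card_fin, nsmul_eq_mul]
  unfold cubicDefect traceMean
  have hn' : (n : ℂ) ≠ 0 := by exact_mod_cast hn.ne'
  have hp' : (Fintype.card ι : ℂ) ≠ 0 := by exact_mod_cast hp.ne'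
  push_cast
  field_simp

variable {Ω : Type*} [MeasurableSpace Ω] {P : Measure Ω} [IsProbabilityMeasure P]

theorem integral_norm_cubicDefect_le (hn : 0 < n) (hp : 0 < Fintype.card ι) {z : ℂ}
    (hz : 0 < z.im) {M : ℝ} (hM : 1 ≤ M) {X : Fin n → Ω → (ι → ℂ) × (ι → ℂ)}
    (hX : ∀ k, Measurable (X k)) (hi : iIndepFun X P) (h : ∀ k, IsStdPair P M (X k)) {y : ℝ}
    (hy : y = Fintype.card ι / n) :
    ∫ ω, ‖cubicDefect y z (traceMean z fun k => X k ω)‖ ∂P ≤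
      (1 + y / z.im) / (2 * y) * (96 * M * y / z.im ^ 2 + 128 * M * y ^ 2 / z.im ^ 4 * (n : ℝ)⁻¹ +
        2 + 8 * M * y ^ 2 / z.im ^ 2) * (√n)⁻¹ := by
  have hn' : (0 : ℝ) < n := by exact_mod_cast hn
  have hp' : (0 : ℝ) < Fintype.card ι := by exact_mod_cast hp
  have hθ : 0 < √(n : ℝ) := Real.sqrt_pos.mpr hn'
  set s : ℝ := (n : ℝ)⁻¹ with hs
  have hs0 : 0 ≤ s := by positivity
  set v := z.im with hv
  -- Here `θ = √n`: the mean squared defect is of order `1/n` and the other factor of order `1`, so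
  -- both terms are of order `n^(-1/2)`.
  let g : Fin n → Ω → ℝ := fun k ω => (1 + s * Fintype.card ι / v) / 2 *
        (√n * (8 * s ^ 2 * formDefect s z k (fun k => X k ω) +
          32 * s ^ 4 * pairNormSq (X k ω) ^ 2 / v ^ 4) +
          (2 + 2 * s ^ 2 * pairNormSq (X k ω) ^ 2 / v ^ 2) / √n)
  have hF := formDefect_bound (s := s) hz hM hX hi h
  have hN := fun k => (h k).pairNormSq_bound
  have hgi : ∀ k, Integrable (g k) P := by
    intro k
    have i1 := (hF k).1
    have i2 := (hN k).1
    exact (((((i1.const_mul _).add ((i2.const_mul _).div_const _)).const_mul _).add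
      (((integrable_const 2).add ((i2.const_mul _).div_const _)).div_const _)).const_mul _)
  have hgle : ∀ k, ∫ ω, g k ω ∂P ≤ (1 + s * Fintype.card ι / v) / 2 *
        (√n * (8 * s ^ 2 * (12 * M * (Fintype.card ι / v ^ 2)) +
          32 * s ^ 4 * (4 * (Fintype.card ι : ℝ) ^ 2 * M) / v ^ 4) +
          (2 + 2 * s ^ 2 * (4 * (Fintype.card ι : ℝ) ^ 2 * M) / v ^ 2) / √n) := by
    intro k
    have i1 := (hF k).1
    have i2 := (hN k).1
    have e : ∫ ω, g k ω ∂P = (1 + s * Fintype.card ι / v) / 2 *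
        (√n * (8 * s ^ 2 * (∫ ω, formDefect s z k (fun k => X k ω) ∂P) +
          32 * s ^ 4 * (∫ ω, pairNormSq (X k ω) ^ 2 ∂P) / v ^ 4) +
          (2 + 2 * s ^ 2 * (∫ ω, pairNormSq (X k ω) ^ 2 ∂P) / v ^ 2) / √n) := by
      simp only [g]
      rw [integral_const_mul, integral_add, integral_const_mul, integral_add, integral_const_mul,
        integral_div, integral_const_mul, integral_div, integral_add, integral_div,
        integral_const_mul]
      · simp
      · exact integrable_const _
      · exact (i2.const_mul _).div_const _
      · exact i1.const_mul _
      · exact (i2.const_mul _).div_const _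
      · exact ((i1.const_mul _).add ((i2.const_mul _).div_const _)).const_mul _
      · exact ((integrable_const 2).add ((i2.const_mul _).div_const _)).div_const _
    rw [e]
    have b1 := (hF k).2
    have b2 := (hN k).2
    gcongr
  have hpt : ∀ ω, ‖cubicDefect y z (traceMean z fun k => X k ω)‖ ≤
      (Fintype.card ι : ℝ)⁻¹ * ∑ k, g k ω := by
    intro ω
    have e := card_mul_cubicDefect_traceMean hn hp hz fun k => X k ω
    have e' : ‖cubicDefect y z (traceMean z fun k => X k ω)‖ = (Fintype.card ι : ℝ)⁻¹ *
        ‖(Fintype.card ι : ℂ) * cubicDefect (Fintype.card ι / n) z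
          (traceMean z fun k => X k ω)‖ := by
      rw [norm_mul, Complex.norm_natCast, hy, inv_mul_cancel_left₀ hp'.ne']
    rw [e', e]
    gcongr
    refine (norm_sum_le _ _).trans (Finset.sum_le_sum fun k _ => ?_)
    exact norm_column_equation_le hs0 hz (fun k => X k ω) k hθ
  have hI : Integrable (fun ω => (Fintype.card ι : ℝ)⁻¹ * ∑ k, g k ω) P :=
    (integrable_finsetSum _ fun k _ => hgi k).const_mul _
  refine (integral_mono_of_nonneg (Eventually.of_forall fun ω => norm_nonneg _) hI
    (Eventually.of_forall hpt)).trans ?_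
  rw [integral_const_mul, integral_finsetSum _ fun k _ => hgi k]
  refine (mul_le_mul_of_nonneg_left (Finset.sum_le_sum fun k _ => hgle k)
    (by positivity)).trans (le_of_eq ?_)
  rw [Finset.sum_const, Finset.card_univ, Fintype.card_fin, nsmul_eq_mul]
  have hsq : √(n : ℝ) ^ 2 = n := Real.sq_sqrt hn'.le
  have hv0 : v ≠ 0 := hz.ne'
  rw [hs, hy]
  generalize √(n : ℝ) = θ at *
  have hθ0 : θ ≠ 0 := hθ.ne'
  rw [← hsq]
  field_simp
  ring

end MeanEquation

/-! ### From the equation in mean to almost sure convergence of the traces. -/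

section Concentration

variable {Ω : Type*} [MeasurableSpace Ω] {P : Measure Ω} [IsProbabilityMeasure P]

/-- Exponentially small deviation probabilities imply almost sure convergence to zero. -/
theorem ae_tendsto_zero_of_measureReal_le {Y : ℕ → Ω → ℝ}
    (h : ∀ ε : ℝ, 0 < ε → ∃ a : ℝ, 0 < a ∧
      ∀ᶠ n : ℕ in atTop, P.real {ω | ε ≤ |Y n ω|} ≤ 2 * Real.exp (-(a * n))) :
    ∀ᵐ ω ∂P, Tendsto (fun n => Y n ω) atTop (𝓝 0) := by
  have key : ∀ j : ℕ, ∀ᵐ ω ∂P, ∀ᶠ n in atTop, |Y n ω| < 1 / ((j : ℝ) + 1) := by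
    intro j
    obtain ⟨a, ha, hn⟩ := h (1 / ((j : ℝ) + 1)) (by positivity)
    obtain ⟨N, hN⟩ := eventually_atTop.mp hn
    have hsum : Summable fun n : ℕ => 2 * Real.exp (-(a * ((n + N : ℕ) : ℝ))) := by
      have h1 : Summable fun n : ℕ => Real.exp (-a) ^ n :=
        summable_geometric_of_lt_one (Real.exp_pos _).le (by rw [Real.exp_lt_one_iff]; linarith)
      refine ((h1.comp_injective (add_left_injective N)).mul_left 2).congr fun n => ?_
      simp only [Function.comp_apply]
      rw [← Real.exp_nat_mul]
      congr 2
      ring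
    have hfin : ∑' n : ℕ, P {ω | 1 / ((j : ℝ) + 1) ≤ |Y (n + N) ω|} ≠ ⊤ := by
      refine ne_top_of_le_ne_top hsum.tsum_ofReal_ne_top (ENNReal.tsum_le_tsum fun n => ?_)
      rw [← ofReal_measureReal]
      exact ENNReal.ofReal_le_ofReal (hN (n + N) (by omega))
    filter_upwards [ae_eventually_notMem hfin] with ω hω
    obtain ⟨N', h⟩ := eventually_atTop.mp hω
    refine eventually_atTop.mpr ⟨N' + N, fun n hn => ?_⟩
    have := h (n - N) (by omega)
    rw [Nat.sub_add_cancel (by omega)] at this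
    exact not_le.mp this
  filter_upwards [ae_all_iff.mpr key] with ω hω
  rw [Metric.tendsto_atTop']
  intro ε hε
  obtain ⟨j, hj⟩ := exists_nat_one_div_lt hε
  obtain ⟨N, hN⟩ := eventually_atTop.mp (hω j)
  refine ⟨N, fun n hn => ?_⟩
  rw [Real.dist_eq, sub_zero]
  exact (hN n hn.le).trans hj

variable {p : ℕ → ℕ} {c : ℝ} {X : ∀ n : ℕ, Fin n → Ω → (Fin (p n) → ℂ) × (Fin (p n) → ℂ)}

theorem ae_tendsto_part_sub_integral (hc : 0 < c)
    (hp : Tendsto (fun n : ℕ => (p n : ℝ) / n) atTop (𝓝 c)) (hX : ∀ n k, Measurable (X n k))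
    (hi : ∀ n, iIndepFun (X n) P) {z : ℂ} (hz : 0 < z.im) {φ : ℂ → ℝ} (hφ : Measurable φ)
    (hφn : ∀ w, |φ w| ≤ ‖w‖) (hφs : ∀ w w', φ (w - w') = φ w - φ w') :
    ∀ᵐ ω ∂P, Tendsto (fun n => φ (traceMean z fun k => X n k ω) -
      ∫ ω, φ (traceMean z fun k => X n k ω) ∂P) atTop (𝓝 0) := by
  refine ae_tendsto_zero_of_measureReal_le fun ε hε => ?_
  -- The exponent is `ε² (Im z)² p²/(32 n)`, and `p ≥ c n/2` eventually; hence `128 = 32 · 4`.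
  refine ⟨ε ^ 2 * z.im ^ 2 * c ^ 2 / 128, by positivity, ?_⟩
  filter_upwards [hp.eventually_const_lt (show c / 2 < c by linarith), eventually_gt_atTop 0]
    with n hn hn0
  have hn' : (0 : ℝ) < n := by exact_mod_cast hn0
  have hpn : c / 2 * n < p n := (lt_div_iff₀ hn').mp hn
  have hpp : (0 : ℝ) < p n := lt_trans (by positivity) hpn
  have hcz : (0 : ℝ) < 4 / (z.im * p n) := by positivity
  refine (measureReal_abs_ge_le_of_boundedDiff (hX n) (hi n)
    (f := fun x => φ (traceMean z x)) (hφ.comp (measurable_traceMean hz)) (B := 1 / z.im)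
    (fun x => (hφn _).trans (norm_traceMean_le hz x)) hcz.le (fun x k y => ?_) hε.le).trans ?_
  · rw [← hφs]
    refine (hφn _).trans ((norm_traceMean_update_sub_le hz x k y).trans (le_of_eq ?_))
    rw [Fintype.card_fin]
  · gcongr
    rw [neg_div, neg_le_neg_iff]
    have e : ε ^ 2 / (2 * (n * (4 / (z.im * p n)) ^ 2)) =
        ε ^ 2 * z.im ^ 2 * (p n : ℝ) ^ 2 / (32 * n) := by
      have := hz.ne'
      field_simp
      norm_num
    rw [e, le_div_iff₀ (by positivity)]
    have h2 : (c / 2 * n) ^ 2 ≤ (p n : ℝ) ^ 2 := by gcongr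
    calc ε ^ 2 * z.im ^ 2 * c ^ 2 / 128 * n * (32 * n) =
          ε ^ 2 * z.im ^ 2 * (c / 2 * n) ^ 2 := by ring
      _ ≤ _ := by gcongr

theorem integrable_traceMean (hX : ∀ n k, Measurable (X n k)) {z : ℂ} (hz : 0 < z.im) (n : ℕ) :
    Integrable (fun ω => traceMean z fun k => X n k ω) P :=
  integrable_of_measurable_bounded
    ((measurable_traceMean hz).comp (measurable_pi_lambda _ (hX n)))
    fun _ => norm_traceMean_le hz _

theorem ae_tendsto_traceMean_sub_integral (hc : 0 < c)
    (hp : Tendsto (fun n : ℕ => (p n : ℝ) / n) atTop (𝓝 c)) (hX : ∀ n k, Measurable (X n k))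
    (hi : ∀ n, iIndepFun (X n) P) {z : ℂ} (hz : 0 < z.im) :
    ∀ᵐ ω ∂P, Tendsto (fun n => traceMean z (fun k => X n k ω) -
      ∫ ω, traceMean z (fun k => X n k ω) ∂P) atTop (𝓝 0) := by
  have hre := ae_tendsto_part_sub_integral hc hp hX hi hz Complex.measurable_re
    Complex.abs_re_le_norm Complex.sub_re
  have him := ae_tendsto_part_sub_integral hc hp hX hi hz Complex.measurable_im
    Complex.abs_im_le_norm Complex.sub_im
  filter_upwards [hre, him] with ω h1 h2
  have h3 := ((Complex.continuous_ofReal.tendsto 0).comp h1).add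
    (((Complex.continuous_ofReal.tendsto 0).comp h2).mul_const Complex.I)
  simp only [Complex.ofReal_zero, zero_mul, add_zero] at h3
  refine h3.congr fun n => ?_
  have hI := integrable_traceMean (P := P) hX hz n
  have e1 : ∫ ω, (traceMean z fun k => X n k ω).re ∂P =
      (∫ ω, traceMean z (fun k => X n k ω) ∂P).re := integral_re hI
  have e2 : ∫ ω, (traceMean z fun k => X n k ω).im ∂P =
      (∫ ω, traceMean z (fun k => X n k ω) ∂P).im := integral_im hI
  simp only [Function.comp_apply, e1, e2]
  apply Complex.ext <;> simp

theorem tendsto_integral_norm_cubicDefect (hc : 0 < c)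
    (hp : Tendsto (fun n : ℕ => (p n : ℝ) / n) atTop (𝓝 c)) (hX : ∀ n k, Measurable (X n k))
    (hi : ∀ n, iIndepFun (X n) P) {M : ℝ} (hM : 1 ≤ M) (h : ∀ n k, IsStdPair P M (X n k)) {z : ℂ}
    (hz : 0 < z.im) :
    Tendsto (fun n : ℕ => ∫ ω, ‖cubicDefect ((p n : ℝ) / n) z
      (traceMean z fun k => X n k ω)‖ ∂P) atTop (𝓝 0) := by
  have hinv : Tendsto (fun n : ℕ => ((n : ℝ))⁻¹) atTop (𝓝 0) := tendsto_inv_atTop_nhds_zero_nat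
  have hsq : Tendsto (fun n : ℕ => (√(n : ℝ))⁻¹) atTop (𝓝 0) :=
    tendsto_inv_atTop_zero.comp (Real.tendsto_sqrt_atTop.comp tendsto_natCast_atTop_atTop)
  have hlim := ((((hp.div_const z.im).const_add 1).div (hp.const_mul 2)
    (by positivity)).mul (((((hp.const_mul (96 * M)).div_const (z.im ^ 2)).add
      ((((hp.pow 2).const_mul (128 * M)).div_const (z.im ^ 4)).mul hinv)).add_const 2).add
        (((hp.pow 2).const_mul (8 * M)).div_const (z.im ^ 2)))).mul hsq
  rw [mul_zero] at hlim
  refine squeeze_zero' (Eventually.of_forall fun n => integral_nonneg fun ω => norm_nonneg _) ?_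
    hlim
  filter_upwards [hp.eventually_const_lt hc, eventually_gt_atTop 0] with n hn hn0
  have hpp : 0 < p n := by
    by_contra h0
    rw [Nat.eq_zero_of_not_pos h0] at hn
    simp at hn
  exact integral_norm_cubicDefect_le hn0 (by rwa [Fintype.card_fin]) hz hM (hX n) (hi n) (h n)
    (by rw [Fintype.card_fin])

theorem im_traceMean_nonneg {ι : Type*} [Fintype ι] [DecidableEq ι] {n : ℕ} {z : ℂ}
    (hz : 0 < z.im) (x : Fin n → (ι → ℂ) × (ι → ℂ)) : 0 ≤ (traceMean z x).im := by
  have h : ∀ i, 0 ≤ (res (blockSum ((n : ℝ)⁻¹) x) z i i).im := by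
    intro i
    have h1 := im_mul_normSq_res (blockSum_isHermitian ((n : ℝ)⁻¹) x) hz.ne' (Pi.single i 1)
    have h2 : star (Pi.single i (1 : ℂ)) ⬝ᵥ (res (blockSum ((n : ℝ)⁻¹) x) z *ᵥ Pi.single i 1) =
        res (blockSum ((n : ℝ)⁻¹) x) z i i := by
      rw [← Pi.single_star]
      simp
    rw [h2] at h1
    rw [← h1]
    exact mul_nonneg hz.le (normSq_nonneg _)
  unfold traceMean
  rw [show ((Fintype.card ι : ℂ))⁻¹ = (((Fintype.card ι : ℝ)⁻¹ : ℝ) : ℂ) by push_cast; rfl,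
    Complex.im_ofReal_mul]
  refine mul_nonneg (by positivity) ?_
  unfold Matrix.trace
  rw [Complex.im_sum]
  exact Finset.sum_nonneg fun i _ => h i

/-- The normalized traces of the resolvents converge almost surely. -/
theorem ae_tendsto_traceMean (hc : 0 < c)
    (hp : Tendsto (fun n : ℕ => (p n : ℝ) / n) atTop (𝓝 c)) (hX : ∀ n k, Measurable (X n k))
    (hi : ∀ n, iIndepFun (X n) P) {M : ℝ} (hM : 1 ≤ M) (h : ∀ n k, IsStdPair P M (X n k)) {z : ℂ}
    (hz : 0 < z.im) :
    Admissible c z (limitTransform c z) ∧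
      ∀ᵐ ω ∂P, Tendsto (fun n => traceMean z fun k => X n k ω) atTop
        (𝓝 (limitTransform c z)) := by
  set m : ℕ → Ω → ℂ := fun n ω => traceMean z fun k => X n k ω with hm
  set E : ℕ → ℂ := fun n => ∫ ω, m n ω ∂P with hE
  have hint : ∀ n, Integrable (m n) P := fun n => integrable_traceMean hX hz n
  have hmb : ∀ n ω, ‖m n ω‖ ≤ 1 / z.im := fun n ω => norm_traceMean_le hz _
  have hEb : ∀ n, ‖E n‖ ≤ 1 / z.im := fun n => by
    simpa using norm_integral_le_of_norm_le_const (μ := P) (Eventually.of_forall (hmb n))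
  have hconv : ∀ᵐ ω ∂P, Tendsto (fun n => m n ω - E n) atTop (𝓝 0) :=
    ae_tendsto_traceMean_sub_integral hc hp hX hi hz
  have hL1 : Tendsto (fun n => ∫ ω, ‖m n ω - E n‖ ∂P) atTop (𝓝 0) := by
    have := tendsto_integral_of_dominated_convergence (μ := P) (F := fun n ω => ‖m n ω - E n‖)
      (f := fun _ => 0) (fun _ => 1 / z.im + 1 / z.im)
      (fun n => ((hint n).sub (integrable_const _)).norm.aestronglyMeasurable)
      (integrable_const _)
      (fun n => Eventually.of_forall fun ω => by
        rw [norm_norm]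
        exact (norm_sub_le _ _).trans (add_le_add (hmb n ω) (hEb n)))
      (by
        filter_upwards [hconv] with ω hω
        simpa using hω.norm)
    simpa using this
  have hcub := tendsto_integral_norm_cubicDefect hc hp hX hi hM h hz
  set L : ℝ := ‖z‖ + 2 * (2 * c) ^ 2 * (1 / z.im) + 3 * ‖z‖ * (2 * c) ^ 2 * (1 / z.im) ^ 2 +
    4 * (2 * c) * (1 / z.im) with hL
  -- The cubic does not commute with expectation. It is Lipschitz on bounded sets, so the `L¹`
  -- distance of `m` to its mean controls the passage from the mean of the defect to the defect of
  -- the mean.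
  have hdef : Tendsto (fun n : ℕ => cubicDefect ((p n : ℝ) / n) z (E n)) atTop (𝓝 0) := by
    have hlim := hcub.add (hL1.mul_const L)
    rw [zero_mul, add_zero] at hlim
    refine squeeze_zero_norm' ?_ hlim
    filter_upwards [hp.eventually_lt_const (show c < 2 * c by linarith)] with n hn
    have hy : |(p n : ℝ) / n| ≤ 2 * c := by
      rw [abs_of_nonneg (by positivity)]; exact hn.le
    have hpt : ∀ ω, ‖cubicDefect ((p n : ℝ) / n) z (E n)‖ ≤
        ‖cubicDefect ((p n : ℝ) / n) z (m n ω)‖ + ‖m n ω - E n‖ * L := by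
      intro ω
      have h1 := norm_cubicDefect_sub_le hy z (hmb n ω) (hEb n)
      have h2 := norm_sub_norm_le (cubicDefect ((p n : ℝ) / n) z (E n))
        (cubicDefect ((p n : ℝ) / n) z (m n ω))
      rw [norm_sub_rev] at h2
      linarith
    have hI1 : Integrable (fun ω => ‖cubicDefect ((p n : ℝ) / n) z (m n ω)‖) P := by
      refine Integrable.norm ?_
      have hmm : Measurable (m n) :=
        (measurable_traceMean hz).comp (measurable_pi_lambda _ (hX n))
      refine integrable_of_measurable_bounded (B := ‖cubicDefect ((p n : ℝ) / n) z (E n)‖ +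
        (1 / z.im + 1 / z.im) * L) (by unfold cubicDefect; fun_prop) fun ω => ?_
      have h1 := norm_cubicDefect_sub_le hy z (hmb n ω) (hEb n)
      have h2 := norm_sub_norm_le (cubicDefect ((p n : ℝ) / n) z (m n ω))
        (cubicDefect ((p n : ℝ) / n) z (E n))
      have h3 : ‖m n ω - E n‖ * L ≤ (1 / z.im + 1 / z.im) * L := by
        gcongr
        exact (norm_sub_le _ _).trans (add_le_add (hmb n ω) (hEb n))
      linarith
    have hI2 : Integrable (fun ω => ‖m n ω - E n‖ * L) P :=
      ((hint n).sub (integrable_const _)).norm.mul_const _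
    calc ‖cubicDefect ((p n : ℝ) / n) z (E n)‖
        = ∫ _, ‖cubicDefect ((p n : ℝ) / n) z (E n)‖ ∂P := by simp
      _ ≤ ∫ ω, ‖cubicDefect ((p n : ℝ) / n) z (m n ω)‖ + ‖m n ω - E n‖ * L ∂P :=
          integral_mono (integrable_const _) (hI1.add hI2) hpt
      _ = _ := by rw [integral_add hI1 hI2, integral_mul_const]
  have him : ∀ n, 0 ≤ (E n).im := by
    intro n
    have e : ∫ ω, (m n ω).im ∂P = (E n).im := integral_im (hint n)
    rw [← e]
    exact integral_nonneg fun ω => im_traceMean_nonneg hz _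
  have hfin := tendsto_of_approx_sol hc hz (y := fun n => (p n : ℝ) / n) (s := E) hp hEb him
    (by simpa only [cubicDefect] using hdef)
  refine ⟨hfin.1, ?_⟩
  filter_upwards [hconv] with ω hω
  have := hω.add hfin.2
  simpa using this

end Concentration

/-! ### Convergence of random spectral distributions -/

section RandomMeasures

variable {Ω : Type*} [MeasurableSpace Ω] {P : Measure Ω} [IsProbabilityMeasure P]

/-- Almost sure convergence of Stieltjes transforms at each point holds at all points at once. -/
theorem ae_forall_tendsto_stieltjesTransform {μs : ℕ → Ω → ProbabilityMeasure ℝ} {L : ℂ → ℂ}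
    (h : ∀ z : ℂ, 0 < z.im → ∀ᵐ ω ∂P,
      Tendsto (fun n => stieltjesTransform (μs n ω : Measure ℝ) z) atTop (𝓝 (L z))) :
    ∀ᵐ ω ∂P, ∀ z : ℂ, 0 < z.im →
      Tendsto (fun n => stieltjesTransform (μs n ω : Measure ℝ) z) atTop (𝓝 (L z)) := by
  -- The limit inherits the Lipschitz bound: a common sample point exists where convergence holds at
  -- both `z` and `w`.
  have hL : ∀ z w : ℂ, 0 < z.im → 0 < w.im → ‖L z - L w‖ ≤ ‖z - w‖ / (z.im * w.im) := by
    intro z w hz hw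
    obtain ⟨ω, h1, h2⟩ := ((h z hz).and (h w hw)).exists
    exact le_of_tendsto (h1.sub h2).norm
      (Eventually.of_forall fun n => norm_stieltjesTransform_sub_le _ hz hw)
  have hD : ∀ᵐ ω ∂P, ∀ k : ℕ, 0 < (TopologicalSpace.denseSeq ℂ k).im →
      Tendsto (fun n => stieltjesTransform (μs n ω : Measure ℝ) (TopologicalSpace.denseSeq ℂ k))
        atTop (𝓝 (L (TopologicalSpace.denseSeq ℂ k))) := by
    refine ae_all_iff.mpr fun k => ?_
    by_cases hk : 0 < (TopologicalSpace.denseSeq ℂ k).im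
    · filter_upwards [h _ hk] with ω hω _ using hω
    · exact Eventually.of_forall fun ω hω => absurd hω hk
  filter_upwards [hD] with ω hω z hz
  rw [Metric.tendsto_atTop]
  intro ε hε
  obtain ⟨k, hk⟩ := (TopologicalSpace.denseRange_denseSeq ℂ).exists_dist_lt z
    -- The first radius keeps `Im w > Im z / 2`; with it the second makes the Lipschitz error at
    -- most `ε/4`.
    (show 0 < min (z.im / 2) (ε * z.im ^ 2 / 8) by positivity)
  set w := TopologicalSpace.denseSeq ℂ k
  rw [dist_eq_norm] at hk
  have h1 : ‖z - w‖ < z.im / 2 := hk.trans_le (min_le_left _ _)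
  have h2 : ‖z - w‖ < ε * z.im ^ 2 / 8 := hk.trans_le (min_le_right _ _)
  have hw2 : z.im / 2 < w.im := by
    have := (abs_le.mp (Complex.abs_im_le_norm (z - w))).2
    rw [Complex.sub_im] at this
    linarith
  have hw : 0 < w.im := by linarith
  have hb : ‖z - w‖ / (z.im * w.im) ≤ ε / 4 := by
    rw [div_le_iff₀ (by positivity)]
    have : z.im * (z.im / 2) ≤ z.im * w.im := by gcongr
    nlinarith
  obtain ⟨N, hN⟩ := Metric.tendsto_atTop.mp (hω k hw) (ε / 4) (by positivity)
  refine ⟨N, fun n hn => ?_⟩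
  have h3 := hN n hn
  have h4 := norm_stieltjesTransform_sub_le (μs n ω : Measure ℝ) hz hw
  have h5 := hL z w hz hw
  rw [dist_eq_norm] at h3 ⊢
  set s := stieltjesTransform (μs n ω : Measure ℝ) z
  set t := stieltjesTransform (μs n ω : Measure ℝ) w
  rw [norm_sub_rev] at h5
  have e : s - L z = (s - t) + (t - L w) + (L w - L z) := by ring
  rw [e]
  refine (norm_add₃_le).trans_lt ?_
  linarith

/-- One good sample point produces a law; since the equation determines the law, every other good
sample point has the same limit, which is therefore nonrandom. -/
theorem exists_limitLaw_of_ae_tendsto {c : ℝ} (hc : 0 < c) {μs : ℕ → Ω → ProbabilityMeasure ℝ}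
    (h : ∀ z : ℂ, 0 < z.im → Admissible c z (limitTransform c z) ∧ ∀ᵐ ω ∂P,
      Tendsto (fun n => stieltjesTransform (μs n ω : Measure ℝ) z) atTop
        (𝓝 (limitTransform c z))) :
    ∃ μ : ProbabilityMeasure ℝ, IsLimitLaw c (μ : Measure ℝ) ∧
      ∀ᵐ ω ∂P, Tendsto (fun n => μs n ω) atTop (𝓝 μ) := by
  have key := ae_forall_tendsto_stieltjesTransform (P := P) fun z hz => (h z hz).2
  obtain ⟨ω₀, hω₀⟩ := key.exists
  obtain ⟨μ, hμ, -⟩ := exists_limitLaw_of_tendsto hc fun z hz => ⟨(h z hz).1, hω₀ z hz⟩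
  refine ⟨μ, hμ, ?_⟩
  filter_upwards [key] with ω hω
  obtain ⟨ν, hν, ht⟩ := exists_limitLaw_of_tendsto hc fun z hz => ⟨(h z hz).1, hω z hz⟩
  have e : (ν : Measure ℝ) = (μ : Measure ℝ) := hν.unique hc hμ
  rwa [show ν = μ from Subtype.ext e] at ht

end RandomMeasures

/-! ### The data matrices -/

section Data

variable {Ω : Type*} [MeasurableSpace Ω] {P : Measure Ω} [IsProbabilityMeasure P] {p : ℕ → ℕ}
  {Z : Fin 2 → (n : ℕ) → Ω → Matrix (Fin (p n)) (Fin n) ℂ}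

/-- The pair of the `k`-th columns of the two data matrices. -/
def dataColumn (Z : Fin 2 → (n : ℕ) → Ω → Matrix (Fin (p n)) (Fin n) ℂ) (n : ℕ) (k : Fin n)
    (ω : Ω) : (Fin (p n) → ℂ) × (Fin (p n) → ℂ) :=
  (fun i => Z 0 n ω i k, fun i => Z 1 n ω i k)

theorem IsDataModel.measurable_dataColumn (hZ : IsDataModel P p Z) (n : ℕ) (k : Fin n) :
    Measurable (dataColumn Z n k) :=
  (measurable_pi_lambda _ fun i => hZ.measurable_entry 0 n i k).prodMk
    (measurable_pi_lambda _ fun i => hZ.measurable_entry 1 n i k)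

/-- Reindex the entries with the column index first, then group them by column. -/
theorem IsDataModel.iIndepFun_dataColumn (hZ : IsDataModel P p Z) (n : ℕ) :
    iIndepFun (dataColumn Z n) P := by
  have h := (hZ.indep n).precomp
    (g := fun t : Fin n × (Fin 2 × Fin (p n)) => (t.2.1, t.2.2, t.1)) (by
      rintro ⟨k, u, i⟩ ⟨k', u', i'⟩ h
      simp only [Prod.mk.injEq] at h ⊢
      tauto)
  have h' := iIndepFun_curry (fun t => hZ.measurable_entry _ n _ _) h
  exact h'.comp (fun _ x => (fun i => x (0, i), fun i => x (1, i))) fun _ => by fun_prop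

/-- Since `t⁴ ≤ 1 + t^(4 + η)` for `t ≥ 0`, the moment assumption controls fourth moments; `max M 0`
covers a negative `M`, which `ENNReal.ofReal` sends to `0`. -/
theorem integrable_norm_pow_four {x : Ω → ℂ} (hx : Measurable x) {η M : ℝ} (hη : 0 < η)
    (h : ∫⁻ ω, ENNReal.ofReal (‖x ω‖ ^ (4 + η)) ∂P ≤ ENNReal.ofReal M) :
    Integrable (fun ω => ‖x ω‖ ^ 4) P ∧ ∫ ω, ‖x ω‖ ^ 4 ∂P ≤ 1 + max M 0 := by
  have hpt : ∀ ω, ‖x ω‖ ^ 4 ≤ 1 + ‖x ω‖ ^ (4 + η) := by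
    intro ω
    have h0 : (0 : ℝ) ≤ ‖x ω‖ ^ (4 + η) := Real.rpow_nonneg (norm_nonneg _) _
    rcases le_total ‖x ω‖ 1 with h1 | h1
    · have := pow_le_one₀ (n := 4) (norm_nonneg (x ω)) h1
      linarith
    · have := Real.rpow_le_rpow_of_exponent_le h1 (show (4 : ℝ) ≤ 4 + η by linarith)
      rw [show (4 : ℝ) = ((4 : ℕ) : ℝ) by norm_num, Real.rpow_natCast] at this
      push_cast at this
      linarith
  have hle : ∫⁻ ω, ENNReal.ofReal (‖x ω‖ ^ 4) ∂P ≤ ENNReal.ofReal (1 + max M 0) := by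
    calc ∫⁻ ω, ENNReal.ofReal (‖x ω‖ ^ 4) ∂P
        ≤ ∫⁻ ω, 1 + ENNReal.ofReal (‖x ω‖ ^ (4 + η)) ∂P := by
          refine lintegral_mono fun ω => ?_
          rw [← ENNReal.ofReal_one, ← ENNReal.ofReal_add zero_le_one
            (Real.rpow_nonneg (norm_nonneg _) _)]
          exact ENNReal.ofReal_le_ofReal (hpt ω)
      _ = 1 + ∫⁻ ω, ENNReal.ofReal (‖x ω‖ ^ (4 + η)) ∂P := by
          rw [lintegral_add_left measurable_const]; simp
      _ ≤ 1 + ENNReal.ofReal (max M 0) := by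
          gcongr
          exact h.trans (ENNReal.ofReal_le_ofReal (le_max_left _ _))
      _ = ENNReal.ofReal (1 + max M 0) := by
          rw [ENNReal.ofReal_add zero_le_one (le_max_right _ _), ENNReal.ofReal_one]
  have hI : Integrable (fun ω => ‖x ω‖ ^ 4) P := by
    refine ⟨(hx.norm.pow_const 4).aestronglyMeasurable, ?_⟩
    rw [hasFiniteIntegral_iff_ofReal (Eventually.of_forall fun ω => by positivity)]
    exact hle.trans_lt ENNReal.ofReal_lt_top
  refine ⟨hI, ?_⟩
  rw [← ofReal_integral_eq_lintegral_ofReal hI (Eventually.of_forall fun ω => by positivity)]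
    at hle
  exact (ENNReal.ofReal_le_ofReal_iff (by positivity)).mp hle

theorem IsDataModel.exists_isStdPair (hZ : IsDataModel P p Z) :
    ∃ M : ℝ, 1 ≤ M ∧ ∀ n k, IsStdPair P M (dataColumn Z n k) := by
  obtain ⟨η, hη, M, hM⟩ := hZ.moment_bound
  refine ⟨1 + max M 0, by linarith [le_max_right M 0], fun n k => ?_⟩
  let g : Bool × Fin (p n) → Fin 2 × Fin (p n) × Fin n := fun t => (bif t.1 then 0 else 1, t.2, k)
  have hg : Function.Injective g := by
    rintro ⟨u, i⟩ ⟨u', i'⟩ h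
    simp only [g, Prod.mk.injEq, and_true] at h
    cases u <;> cases u' <;> simp_all
  have e : (fun (t : Bool × Fin (p n)) ω => leg t.1 (dataColumn Z n k ω) t.2) =
      fun t ω => Z (g t).1 n ω (g t).2.1 (g t).2.2 := by
    funext t ω
    rcases t with ⟨u, i⟩
    cases u <;> rfl
  have e' : ∀ (t : Bool × Fin (p n)) ω, leg t.1 (dataColumn Z n k ω) t.2 =
      Z (g t).1 n ω (g t).2.1 (g t).2.2 := fun t ω => congrFun (congrFun e t) ω
  have h4 := fun t => integrable_norm_pow_four (hZ.measurable_entry (g t).1 n (g t).2.1 (g t).2.2)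
    hη (hM _ n _ _)
  refine ⟨?_, fun t => ?_, fun t => ?_⟩
  · rw [e]
    refine ⟨fun t => hZ.measurable_entry _ n _ _, (hZ.indep n).precomp hg,
      fun t => hZ.mean_zero _ n _ _, fun t => hZ.unit_variance _ n _ _, fun t => ?_⟩
    refine memLp_two_of_norm_sq (hZ.measurable_entry _ n _ _).aestronglyMeasurable ?_
    -- Square integrability is hidden in the unit variance: the integral of a nonintegrable function
    -- is `0` by convention, not `1`.
    by_contra hI
    have := hZ.unit_variance (g t).1 n (g t).2.1 (g t).2.2
    rw [integral_undef hI] at this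
    exact zero_ne_one this
  · simp_rw [e']; exact (h4 t).1
  · simp_rw [e']; exact (h4 t).2

theorem isProbabilityMeasure_skewESD {p : ℕ} (hp : p ≠ 0) (S : Matrix (Fin p) (Fin p) ℂ)
    (hS : Sᴴ = -S) : IsProbabilityMeasure (skewESD S hS : Measure ℝ) := by
  refine ⟨?_⟩
  change (∑ j : Fin p, (p : ENNReal)⁻¹ •
    Measure.dirac ((isHermitian_neg_I_smul hS).eigenvalues j)) Set.univ = 1
  simp only [Measure.coe_finsetSum, Finset.sum_apply, Measure.smul_apply, measure_univ,
    smul_eq_mul, mul_one, Finset.sum_const, Finset.card_univ, Fintype.card_fin, nsmul_eq_mul]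
  exact ENNReal.mul_inv_cancel (by exact_mod_cast hp) (ENNReal.natCast_ne_top p)

/-- The spectral distribution of a nonempty skew-Hermitian matrix, as a probability measure. -/
def probESD {p : ℕ} (hp : p ≠ 0) (S : Matrix (Fin p) (Fin p) ℂ) (hS : Sᴴ = -S) :
    ProbabilityMeasure ℝ :=
  ⟨skewESD S hS, isProbabilityMeasure_skewESD hp S hS⟩

/-- The spectral distribution of the sample commutator, as a probability measure (a Dirac mass for
matrices of size zero). -/
def dataESD (Z : Fin 2 → (n : ℕ) → Ω → Matrix (Fin (p n)) (Fin n) ℂ) (n : ℕ) (ω : Ω) :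
    ProbabilityMeasure ℝ :=
  if h : p n ≠ 0 then
    probESD h (commutatorMatrix (Z 0 n ω) (Z 1 n ω))
      (commutatorMatrix_conjTranspose (Z 0 n ω) (Z 1 n ω))
  else diracProba 0

theorem stieltjesTransform_dataESD {n : ℕ} (hn : p n ≠ 0) {z : ℂ} (hz : 0 < z.im) (ω : Ω) :
    stieltjesTransform (dataESD Z n ω : Measure ℝ) z =
      traceMean z fun k => dataColumn Z n k ω := by
  have h := integral_skewESD (commutatorMatrix (Z 0 n ω) (Z 1 n ω))
    (commutatorMatrix_conjTranspose (Z 0 n ω) (Z 1 n ω)) hz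
  rw [neg_I_smul_commutatorMatrix] at h
  rw [dataESD, dif_pos hn, traceMean, Fintype.card_fin]
  exact h

theorem IsDataModel.exists_isLSD (hZ : IsDataModel P p Z) {c : ℝ} (hc : 0 < c)
    (hp : Tendsto (fun n : ℕ => (p n : ℝ) / (n : ℝ)) atTop (𝓝 c)) :
    ∃ μ : ProbabilityMeasure ℝ, IsLimitLaw c (μ : Measure ℝ) ∧ IsLSD P p Z μ := by
  obtain ⟨M, hM1, hM⟩ := hZ.exists_isStdPair
  -- The limit `c` of `p n / n` is positive, so the convention for empty matrices affects only
  -- finitely many `n`.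
  have hpos : ∀ᶠ n in atTop, p n ≠ 0 := by
    filter_upwards [hp.eventually_const_lt hc] with n hn h0
    rw [h0] at hn
    simp at hn
  obtain ⟨μ, hμ, ht⟩ := exists_limitLaw_of_ae_tendsto (P := P) hc (μs := dataESD Z)
    fun z hz => by
      obtain ⟨ha, hae⟩ := ae_tendsto_traceMean (P := P) hc hp hZ.measurable_dataColumn
        hZ.iIndepFun_dataColumn hM1 hM hz
      refine ⟨ha, ?_⟩
      filter_upwards [hae] with ω hω
      refine hω.congr' ?_
      filter_upwards [hpos] with n hn
      exact (stieltjesTransform_dataESD hn hz ω).symm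
  refine ⟨μ, hμ, ?_⟩
  filter_upwards [ht] with ω hω
  refine ((ProbabilityMeasure.tendsto_nhds_iff_toFiniteMeasure_tendsto_nhds _).mp hω).congr' ?_
  filter_upwards [hpos] with n hn
  simp only [Function.comp_apply, dataESD, dif_pos hn]
  rfl

end Data

end CommutatorLSD

end

/-- Here `cdf μ` is the distribution function of the limiting spectral distribution `μ`, read on
the real line. -/
theorem theorem5p1 {Ω : Type*} [MeasurableSpace Ω] (P : Measure Ω) [IsProbabilityMeasure P]
    (c : ℝ) (hc : 0 < c) (p : ℕ → ℕ)
    (hp : Tendsto (fun n : ℕ => (p n : ℝ) / (n : ℝ)) atTop (𝓝 c))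
    (Z : Fin 2 → (n : ℕ) → Ω → Matrix (Fin (p n)) (Fin n) ℂ)
    (hZ : CommutatorLSD.IsDataModel P p Z) :
    ∃ μ : ProbabilityMeasure ℝ,
      CommutatorLSD.IsLSD P p Z μ ∧
      (∀ x : ℝ, x ≠ 0 →
        HasDerivAt (fun t : ℝ => cdf (μ : Measure ℝ) t) (CommutatorLSD.density c x) x) ∧
      (c < 2 →
        HasDerivAt (fun t : ℝ => cdf (μ : Measure ℝ) t)
          (1 / (Real.pi * √(2 * c - c ^ 2))) 0) ∧
      (2 ≤ c → ¬ DifferentiableAt ℝ (fun t : ℝ => cdf (μ : Measure ℝ) t) 0) ∧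
      ContinuousOn (deriv fun t : ℝ => cdf (μ : Measure ℝ) t)
        {x : ℝ | DifferentiableAt ℝ (fun t : ℝ => cdf (μ : Measure ℝ) t) x} ∧
      (μ : Measure ℝ).restrict {0}ᶜ =
        volume.withDensity (fun x : ℝ => ENNReal.ofReal (CommutatorLSD.density c x)) := by
  obtain ⟨μ, hμ, hlsd⟩ := hZ.exists_isLSD hc hp
  refine ⟨μ, hlsd, fun x hx => ?_, fun hc2 => ?_, fun hc2 => hμ.not_differentiableAt_zero hc2,
    hμ.continuousOn_deriv hc, hμ.restrict_compl_zero hc⟩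
  · rw [← CommutatorLSD.boundaryDensity_eq_density hc hx (hμ.boundary hc (Or.inl hx)).1]
    exact hμ.hasDerivAt_cdf hc (Or.inl hx)
  · rw [← CommutatorLSD.boundaryDensity_zero hc hc2 (hμ.boundary hc (Or.inr hc2)).1]
    exact hμ.hasDerivAt_cdf hc (Or.inr hc2)
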